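/- **Setting.** Let $\mu>0$ and let $V:\mathbb R\to\mathbb R$ satisfy $V(-r)=V(r)$ and $(1+|\cdot|^2)V\in L^1(\mathbb R)$. On $L^2(\mathbb R\times\mathbb R)$ let $h_x=-\partial_x^2-\mu$, $h_y=-\partial_y^2-\mu$ and, for $T>0$, define through functional calculus $$L_T=\frac{h_x+h_y}{\tanh(h_x/2T)+\tanh(h_y/2T)},\qquad D_T=\frac12\,\frac{h_x}{\tanh(h_x/2T)}+\frac12\,\frac{h_y}{\tanh(h_y/2T)} .$$ For $\lambda>0$ let $V$ also denote multiplication by $V(x-y)$, let $L_T-\lambda V$ and $D_T-\lambda V$ be the self-adjoint operators defined through their quadratic forms (KLMN theorem), and let $\sigma_s$ denote the spectrum of the restriction to symmetric functions, $\alpha(x,y)=\alpha(y,x)$. Define $$T_l(\lambda)=\inf\{T>0:\inf\sigma_s(L_T-\lambda V)\ge 0\},\qquad T_u(\lambda)=\sup\{T>0:\inf\sigma_s(D_T-\lambda V)\le 0\}.$$ Let $\widehat V(p)=(2\pi)^{-1/2}\int_{\mathbb R}e^{-ipr}V(r)\,dr$. Let $e_\mu^s$ be the supremum of the spectrum, restricted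 to even functions, of the operator on $L^2(\{-1,1\})$ (counting measure) with integral kernel $(2\pi)^{-1/2}\widehat V(\sqrt\mu(p-q))$, i.e. $e_\mu^s=(2\pi)^{-1/2}\big(\widehat V(0)+\widehat V(2\sqrt\mu)\big)$, and let $e_0^s=2(2\pi)^{-1/2}\widehat V(0)$. **Theorem 1.1.** Suppose $e_\mu^s>0$. Then $T_l(\lambda)>0$ and $T_u(\lambda)>0$ for all $\lambda>0$. As $\lambda\to0^+$, $$T_l(\lambda)=\mu\exp\Big(-\frac{\sqrt\mu}{\lambda e_\mu^s}+O(1)\Big),\qquad T_u(\lambda)=\mu\exp\Big(-\frac{\sqrt\mu}{\lambda\max\{e_\mu^s,\frac12e_0^s\}}+O(1)\Big).$$ In particular, if $\widehat V(0)>0$ and $\widehat V(2\sqrt\mu)<0$, then $T_u(\lambda)/T_l(\lambda)\to\infty$ as $\lambda\to0^+$. -/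

import Mathlib

open MeasureTheory Filter Topology Asymptotics
open scoped FourierTransform ComplexConjugate

noncomputable section

namespace BCS

/-! ### Spectrum of a (possibly unbounded) operator restricted to a subspace -/

/-- Let `A` be an operator in `H` with graph `G = {(f, A f)}` and let `S` be a subspace of `H`.
This is the spectrum of `A` with its domain restricted to `S`, as an operator in `S`: a number `z`
lies outside of it if and only if `A - z`, restricted to `S`, has an everywhere defined bounded
inverse `R : S → S`, that is, `R g = f` holds exactly when `A f = g + z f`. -/
def spectrumOn {H : Type*} [NormedAddCommGroup H] [NormedSpace ℂ H]
    (G : Set (H × H)) (S : Submodule ℂ H) : Set ℂ :=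
  {z : ℂ | ¬ ∃ R : S →L[ℂ] S, ∀ g f : S, R g = f ↔ ((f : H), (g : H) + z • (f : H)) ∈ G}

/-- The infimum of the spectrum (of a self-adjoint operator), as an extended real number. -/
def infSpec {H : Type*} [NormedAddCommGroup H] [NormedSpace ℂ H]
    (G : Set (H × H)) (S : Submodule ℂ H) : EReal :=
  ⨅ t ∈ {t : ℝ | (t : ℂ) ∈ spectrumOn G S}, (t : EReal)

/-! ### The two-particle Hilbert space `L²(ℝ × ℝ)` -/

/-- The plane `ℝ × ℝ`; a point is a pair `(x, y)` of positions (or momenta) of two particles in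
dimension one. -/
abbrev Plane : Type := EuclideanSpace ℝ (Fin 2)

/-- The complex Hilbert space `L²(ℝ × ℝ)`. -/
abbrev TwoBody : Type := Lp ℂ 2 (volume : Measure Plane)

/-- The exchange of the two particles, `(x, y) ↦ (y, x)`. -/
def exchange : Plane ≃ₗᵢ[ℝ] Plane :=
  LinearIsometryEquiv.piLpCongrLeft 2 ℝ ℝ (Equiv.swap (0 : Fin 2) 1)

/-- The symmetric functions, `α (x, y) = α (y, x)` for almost all `(x, y)`. -/
def symmetricSubspace : Submodule ℂ TwoBody where
  carrier := {α | ∀ᵐ x : Plane, α (exchange x) = α x}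
  zero_mem' := by
    have h := Lp.coeFn_zero ℂ 2 (volume : Measure Plane)
    have h' := exchange.measurePreserving.quasiMeasurePreserving.ae h
    filter_upwards [h, h'] with x h1 h2
    rw [h1, h2]; rfl
  add_mem' := by
    intro a b ha hb
    change ∀ᵐ x : Plane, (a + b : TwoBody) (exchange x) = (a + b : TwoBody) x
    have h := Lp.coeFn_add a b
    have h' := exchange.measurePreserving.quasiMeasurePreserving.ae h
    filter_upwards [h, h', ha, hb] with x h1 h2 h3 h4
    rw [h1, h2, Pi.add_apply, Pi.add_apply, h3, h4]
  smul_mem' := by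
    intro c a ha
    change ∀ᵐ x : Plane, (c • a : TwoBody) (exchange x) = (c • a : TwoBody) x
    have h := Lp.coeFn_smul c a
    have h' := exchange.measurePreserving.quasiMeasurePreserving.ae h
    filter_upwards [h, h', ha] with x h1 h2 h3
    rw [h1, h2, Pi.smul_apply, Pi.smul_apply, h3]

/-! ### The operators `L_T - W` and `D_T - W` -/

/-- The one-particle Hamiltonian `h = -Δ - μ` in momentum space. -/
def hSymbol (μ p : ℝ) : ℝ := p ^ 2 - μ

/-- The symbol of `L_T = (h_x + h_y) / (tanh (h_x / 2T) + tanh (h_y / 2T))`, as a function of the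
momenta. Where numerator and denominator both vanish (a null set, which does not affect the
multiplication operator) it has the value `0`. -/
def symbolL (μ T : ℝ) (p : Plane) : ℝ :=
  (hSymbol μ (p 0) + hSymbol μ (p 1)) /
    (Real.tanh (hSymbol μ (p 0) / (2 * T)) + Real.tanh (hSymbol μ (p 1) / (2 * T)))

/-- The symbol of `D_T = (1/2) h_x / tanh (h_x / 2T) + (1/2) h_y / tanh (h_y / 2T)`, as a function
of the momenta. A quotient `0 / 0`, which occurs on a null set only, has the value `0`. -/
def symbolD (μ T : ℝ) (p : Plane) : ℝ :=
  1 / 2 * (hSymbol μ (p 0) / Real.tanh (hSymbol μ (p 0) / (2 * T))) +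
    1 / 2 * (hSymbol μ (p 1) / Real.tanh (hSymbol μ (p 1) / (2 * T)))

/-- The form domain of the Fourier multiplier with the symbol `m ≥ 0`. Mathlib's Fourier transform
on `L²` uses the characters `exp (-2 π i ⟨ξ, x⟩)`, so that the momentum is `2 π ξ`. -/
def formDomain (m : Plane → ℝ) : Set TwoBody :=
  {ψ | Integrable (fun ξ : Plane => m ((2 * Real.pi) • ξ) * ‖(𝓕 ψ : TwoBody) ξ‖ ^ 2)}

/-- The sesquilinear form of (Fourier multiplier with symbol `m`) `-` (multiplication with
`W (x - y)`). -/
def form (m : Plane → ℝ) (W : ℝ → ℝ) (φ ψ : TwoBody) : ℂ :=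
  (∫ ξ : Plane, (m ((2 * Real.pi) • ξ) : ℂ) *
      (conj ((𝓕 φ : TwoBody) ξ) * (𝓕 ψ : TwoBody) ξ)) -
    ∫ x : Plane, (W (x 0 - x 1) : ℂ) * (conj (φ x) * ψ x)

/-- The graph of the self-adjoint operator which the KLMN theorem associates with this form:
`ψ` is in its domain and is mapped to `f` if and only if `ψ` is in the form domain and
`form φ ψ = ⟨φ, f⟩` for all `φ` in the form domain. -/
def formOperator (m : Plane → ℝ) (W : ℝ → ℝ) : Set (TwoBody × TwoBody) :=
  {z | z.1 ∈ formDomain m ∧ ∀ φ ∈ formDomain m, form m W φ z.1 = inner ℂ φ z.2}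

/-! ### The two temperatures -/

/-- `T_l = inf {T > 0 : inf σ_s (L_T - W) ≥ 0}`. -/
def Tl (μ : ℝ) (W : ℝ → ℝ) : ℝ :=
  sInf {T : ℝ | 0 < T ∧ 0 ≤ infSpec (formOperator (symbolL μ T) W) symmetricSubspace}

/-- `T_u = sup {T > 0 : inf σ_s (D_T - W) ≤ 0}`. -/
def Tu (μ : ℝ) (W : ℝ → ℝ) : ℝ :=
  sSup {T : ℝ | 0 < T ∧ infSpec (formOperator (symbolD μ T) W) symmetricSubspace ≤ 0}

/-! ### The weak-coupling constants -/

/-- `V̂ (p) = (2 π)^(-1/2) ∫ exp (-i p r) V (r) dr`. It is real if `V` is even. -/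
def VHat (V : ℝ → ℝ) (p : ℝ) : ℂ :=
  ((1 / Real.sqrt (2 * Real.pi) : ℝ) : ℂ) *
    ∫ r : ℝ, Complex.exp (-Complex.I * (p : ℂ) * (r : ℂ)) * (V r : ℂ)

/-- The Hilbert space `L²(S⁰)`; the sphere `S⁰ = {1, -1}` with the counting measure is realised as
the units of `ℤ`. -/
abbrev SphereL2 : Type := EuclideanSpace ℂ ℤˣ

/-- The operator on `L²(S⁰)` with the kernel `(2 π)^(-1/2) V̂ (√μ (p - q))`. -/
def sphereOperator (μ : ℝ) (V : ℝ → ℝ) : SphereL2 →ₗ[ℂ] SphereL2 :=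
  Matrix.toEuclideanLin (Matrix.of fun p q : ℤˣ =>
    ((1 / Real.sqrt (2 * Real.pi) : ℝ) : ℂ) *
      VHat V (Real.sqrt μ * (((p : ℤ) : ℝ) - ((q : ℤ) : ℝ))))

/-- The even functions on `S⁰`. -/
def sphereEven : Submodule ℂ SphereL2 where
  carrier := {f | ∀ p : ℤˣ, f (-p) = f p}
  zero_mem' := by intro p; simp
  add_mem' := by intro a b ha hb p; simp [ha p, hb p]
  smul_mem' := by intro c a ha p; simp [ha p]

/-- `e_μ^s`, the supremum of the spectrum of the operator above restricted to even functions. -/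
def eS (μ : ℝ) (V : ℝ → ℝ) : ℝ :=
  sSup {t : ℝ | (t : ℂ) ∈ spectrumOn {z | z.2 = sphereOperator μ V z.1} sphereEven}

/-- `e_0^s = 2 V̂ (0) / (2 π)^(1/2)`. -/
def eS0 (V : ℝ → ℝ) : ℝ := 2 * (VHat V 0).re / Real.sqrt (2 * Real.pi)

end BCS

end

/-! Write κ = √μ. Total momentum P is conserved, so both operators decompose into fibres over P
acting on functions of the relative momentum k; exchange symmetry means evenness in k. On a fibre
with symbol m, the operator is nonnegative when l ∫ V |𝓕⁻f|² ≤ ∫ m |f|² for all even f. For a weight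
ω ≥ 1/m one has ∫ |f|²/ω ≤ ∫ m |f|², and the extremal direction is f = aω. If ω has logarithmic
singularities at k = ±c, the function 𝓕⁻ω is (∫ ω) cos(c r) up to an error that stays bounded as T →
0. The criterion is therefore l · (∫ ω) · ∫ V cos²(c r) dr ≤ 1 up to O(l), and the whole asymptotics
lies in the coefficient of log(κ²/T) in ∫ 1/m.

Near P = 0 both symbols behave like |k² − κ²| cut off at T. There are two singular points, the
coefficient is 1/(πκ) and ∫ V cos²(κ r) dr = π e_μ^s, which gives the exponent −κ/(l e_μ^s). Near
|P| = 2κ both particles sit at the same Fermi point when k = 0. There D_T behaves like 2κ|k|, with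
one singular point, coefficient 1/(2πκ) and ∫ V = π e_0^s, so e_0^s/2 competes with e_μ^s. In L_T
the two energies have opposite signs, the denominator nearly cancels and L_T is exponentially large:
for |P| ≥ κ/2 the integral of 1/L_T is bounded uniformly in T, and these fibres are harmless at weak
coupling.

Upper bounds on the temperatures: `one_div_le_weight_near`, `one_div_le_weight_far` and
`one_div_energyL_le_farW` bound 1/m by explicit weights, and `potential_le_of_weight` splits f into
its component along ω and a mean-zero remainder. Lower bounds: `IsSymbol.infSpec_neg` tests with a
weight in k times an indicator in P, concentrated at P = 0 or P = 2κ.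

The passage between forms and spectra goes through J = (1+m)^(-1/2). The potential is form bounded
with relative bound 1/2 (`IsSymbol.formData`), so the KLMN operator is the pullback under J of a
bounded operator (`FormData.formOperator_eq`). For such operators `le_infSpec_pullbackGraph` and
`infSpec_pullbackGraph_neg` turn inequalities on trial functions into bounds on the spectrum.
Monotonicity in T is never needed: above the upper threshold the form is nonnegative with a gap, and
below the lower one the spectrum reaches negative values. -/

noncomputable section
namespace BCS

/-! ### Spectrum of operators defined by coercive forms -/

section AbstractSpectrum

variable {H : Type*} [NormedAddCommGroup H] [InnerProductSpace ℂ H]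

/-- A bounded coercive operator on a Hilbert space is boundedly invertible. -/
theorem exists_inverse_of_coercive [CompleteSpace H] (M : H →L[ℂ] H) {δ : ℝ} (hδ : 0 < δ)
    (hM : ∀ v, δ * ‖v‖ ^ 2 ≤ (inner ℂ v (M v)).re) :
    ∃ N : H →L[ℂ] H, (∀ v, N (M v) = v) ∧ ∀ v, M (N v) = v := by
  have hb : ∀ v, δ * ‖v‖ ≤ ‖M v‖ := by
    intro v
    rcases eq_or_ne v 0 with rfl | hv
    · simp
    have hv' : 0 < ‖v‖ := norm_pos_iff.mpr hv
    have h2 : (inner ℂ v (M v)).re ≤ ‖v‖ * ‖M v‖ :=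
      (Complex.re_le_norm _).trans (norm_inner_le_norm v (M v))
    have h1 := hM v
    by_contra! h
    nlinarith [mul_lt_mul_of_pos_left h hv']
  have hanti : AntilipschitzWith (Real.toNNReal δ⁻¹) M := by
    refine ContinuousLinearMap.antilipschitz_of_bound M fun v => ?_
    rw [Real.coe_toNNReal _ (by positivity), inv_mul_eq_div, le_div_iff₀ hδ, mul_comm]
    exact hb v
  have hker : LinearMap.ker (M : H →ₗ[ℂ] H) = ⊥ := LinearMap.ker_eq_bot.mpr hanti.injective
  have hclosed : IsClosed (M.range : Set H) :=
    hanti.isClosed_range M.uniformContinuous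
  have : CompleteSpace (M.range) := hclosed.completeSpace_coe
  have hrange : LinearMap.range (M : H →ₗ[ℂ] H) = ⊤ := by
    -- The range is closed, hence equal to its double orthogonal complement. A vector `w` orthogonal
    -- to it satisfies ⟨w, M w⟩ = 0 and vanishes by coercivity.
    rw [← (M.range).orthogonal_orthogonal, Submodule.eq_top_iff']
    intro v w hw
    have h0 : inner ℂ (M w) w = (0 : ℂ) := hw (M w) ⟨w, rfl⟩
    have h1 := hM w
    rw [← inner_conj_symm, h0] at h1
    have : w = 0 := by
      by_contra hne
      have : 0 < ‖w‖ := norm_pos_iff.mpr hne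
      have : 0 < δ * ‖w‖ ^ 2 := by positivity
      simp at h1
      linarith
    simp [this]
  let e := ContinuousLinearEquiv.ofBijective M hker hrange
  refine ⟨e.symm, fun v => ?_, fun v => ?_⟩
  · exact e.symm_apply_apply v
  · exact e.apply_symm_apply v

/-- The graph of the operator of the form `⟨J⁻¹ φ, A J⁻¹ ψ⟩` with domain the range of `J`. -/
def pullbackGraph (J A : H →L[ℂ] H) : Set (H × H) :=
  {z | ∃ v, J v = z.1 ∧ ∀ u, inner ℂ u (A v) = inner ℂ (J u) z.2}

/-- A form with symmetry `U` that is coercive relative to `J` and bounded below by `t₀` on the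
fixed space of `U` defines an operator whose spectrum there is bounded below by `t₀`. -/
theorem le_infSpec_pullbackGraph [CompleteSpace H] {J A U : H →L[ℂ] H} {S : Submodule ℂ H}
    (hS : ∀ v, v ∈ S ↔ U v = v)
    (hJ : Function.Injective J) (hJU : ∀ v, J (U v) = U (J v)) (hAU : ∀ v, A (U v) = U (A v))
    (hJadj : ∀ v, (ContinuousLinearMap.adjoint J) (U v) = U (ContinuousLinearMap.adjoint J v))
    {t₀ δ C : ℝ} (hδ : 0 < δ)
    (hlow : ∀ v ∈ S, t₀ * ‖J v‖ ^ 2 ≤ (inner ℂ v (A v)).re)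
    (hco : ∀ v ∈ S, δ * ‖v‖ ^ 2 - C * ‖J v‖ ^ 2 ≤ (inner ℂ v (A v)).re) :
    (t₀ : EReal) ≤ infSpec (pullbackGraph J A) S := by
  refine le_iInf₂ fun t ht => ?_
  by_contra! hlt
  have hlt : t < t₀ := EReal.coe_lt_coe_iff.mp hlt
  refine ht ?_
  have hSc : IsClosed (S : Set H) := by
    have : (S : Set H) = {v | U v = v} := by ext v; exact hS v
    rw [this]
    exact isClosed_eq U.continuous continuous_id
  have : CompleteSpace S := hSc.completeSpace_coe
  set Ja := ContinuousLinearMap.adjoint J with hJa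
  -- In the variable v = J⁻¹ψ the form of the operator minus `t` is A − t J*J, so the resolvent at
  -- `t` has to be J M⁻¹ J*.
  let M : H →L[ℂ] H := A - (t : ℂ) • (Ja ∘L J)
  have hMv : ∀ v, M v = A v - (t : ℂ) • Ja (J v) := fun v => rfl
  have hJS : ∀ v ∈ S, J v ∈ S := fun v hv => by
    rw [hS] at hv ⊢; rw [← hJU, hv]
  have hJaS : ∀ v ∈ S, Ja v ∈ S := fun v hv => by
    rw [hS] at hv ⊢; rw [← hJadj, hv]
  have hAS : ∀ v ∈ S, A v ∈ S := fun v hv => by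
    rw [hS] at hv ⊢; rw [← hAU, hv]
  have hMS : ∀ v ∈ S, M v ∈ S := fun v hv => by
    rw [hMv]
    exact S.sub_mem (hAS v hv) (S.smul_mem _ (hJaS _ (hJS v hv)))
  let MS : S →L[ℂ] S := (M ∘L S.subtypeL).codRestrict S fun v => hMS v v.2
  let JS : S →L[ℂ] S := (J ∘L S.subtypeL).codRestrict S fun v => hJS v v.2
  let JaS : S →L[ℂ] S := (Ja ∘L S.subtypeL).codRestrict S fun v => hJaS v v.2
  have hinner : ∀ v : H, (inner ℂ v (M v)).re = (inner ℂ v (A v)).re - t * ‖J v‖ ^ 2 := by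
    intro v
    rw [hMv, inner_sub_right, inner_smul_right, hJa, ContinuousLinearMap.adjoint_inner_right,
      inner_self_eq_norm_sq_to_K]
    simp [← Complex.ofReal_pow]
  -- a convex combination of the two lower bounds is coercive
  set D := |C + t| with hD
  have hD0 : 0 ≤ D := abs_nonneg _
  have hCD : C + t ≤ D := le_abs_self _
  have hgap : 0 < t₀ - t := by linarith
  -- `θ` solves (1 − θ)(t₀ − t) = θ D, so that the ‖J v‖² terms cancel and θ δ ‖v‖² survives.
  let θ := (t₀ - t) / (t₀ - t + D)
  have hθ : 0 < θ := by positivity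
  have hθ' : (1 - θ) * (t₀ - t) = θ * D := by
    simp only [θ]; field_simp; ring
  have hθ1 : θ ≤ 1 := by
    simp only [θ]; rw [div_le_one (by positivity)]; linarith
  obtain ⟨N, hN1, hN2⟩ := exists_inverse_of_coercive MS (δ := θ * δ) (by positivity) (by
    rintro ⟨v, hv⟩
    change θ * δ * ‖v‖ ^ 2 ≤ (inner ℂ v (M v)).re
    rw [hinner]
    have h1 := hlow v hv
    have h2 := hco v hv
    have h3 : (t₀ - t) * ‖J v‖ ^ 2 ≤ (inner ℂ v (A v)).re - t * ‖J v‖ ^ 2 := by linarith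
    have h4 : δ * ‖v‖ ^ 2 - D * ‖J v‖ ^ 2 ≤ (inner ℂ v (A v)).re - t * ‖J v‖ ^ 2 := by
      nlinarith [sq_nonneg ‖J v‖, mul_le_mul_of_nonneg_right hCD (sq_nonneg ‖J v‖)]
    have h5 := mul_le_mul_of_nonneg_left h3 (sub_nonneg.mpr hθ1)
    have h6 := mul_le_mul_of_nonneg_left h4 hθ.le
    have h7 : (1 - θ) * ((t₀ - t) * ‖J v‖ ^ 2) = θ * (D * ‖J v‖ ^ 2) := by
      rw [← mul_assoc, hθ', mul_assoc]
    nlinarith)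
  refine ⟨JS ∘L N ∘L JaS, fun g f => ?_⟩
  have hkey : ∀ v : H, (∀ u, inner ℂ u (A v) = inner ℂ (J u) ((g : H) + (t : ℂ) • J v)) ↔
      M v = Ja g := by
    intro v
    have : ∀ u, inner ℂ (J u) ((g : H) + (t : ℂ) • J v)
        = inner ℂ u (Ja ((g : H) + (t : ℂ) • J v)) := fun u => by
      rw [hJa, ContinuousLinearMap.adjoint_inner_right]
    simp_rw [this]
    rw [← ext_iff_inner_left ℂ, hMv, map_add, map_smul, sub_eq_iff_eq_add]
  constructor
  · rintro rfl
    refine ⟨(N (JaS g) : S), rfl, (hkey _).mpr ?_⟩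
    exact congrArg Subtype.val (hN2 (JaS g))
  · rintro ⟨v, hv, hv'⟩
    dsimp only at hv hv'
    rw [← hv] at hv'
    -- The graph allows any `v` in `H`; injectivity of `J` and its commutation with `U` force `v`
    -- into `S`.
    have hvS : v ∈ S := by
      rw [hS]
      apply hJ
      rw [hJU, hv]
      exact (hS _).mp f.2
    have hMSv : MS ⟨v, hvS⟩ = JaS g := Subtype.ext ((hkey v).mp hv')
    apply Subtype.ext
    change J (N (JaS g) : S) = f
    rw [← hMSv, hN1, hv]

/-- If the form takes a negative value on `S`, then the operator on `S` has negative spectrum. -/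
theorem infSpec_pullbackGraph_neg {J A : H →L[ℂ] H} {S : Submodule ℂ H}
    (hJS : ∀ v, J v ∈ S → v ∈ S) (hJ : Function.Injective J)
    (hA : ∀ u v, inner ℂ (A u) v = (inner ℂ u (A v) : ℂ))
    {C : ℝ} (hC : ∀ v ∈ S, -C * ‖J v‖ ^ 2 ≤ (inner ℂ v (A v)).re)
    {v₀ : H} (hv₀S : J v₀ ∈ S) (hv₀ : (inner ℂ v₀ (A v₀)).re < 0) :
    infSpec (pullbackGraph J A) S < 0 := by
  have hJpos : ∀ v, v ≠ 0 → 0 < ‖J v‖ := fun v hv => norm_pos_iff.mpr fun h =>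
    hv (hJ (by rw [h, map_zero]))
  let Q : Set ℝ := {s | ∃ v, J v ∈ S ∧ v ≠ 0 ∧ s = (inner ℂ v (A v)).re / ‖J v‖ ^ 2}
  have hv₀ne : v₀ ≠ 0 := by rintro rfl; simp at hv₀
  have hQb : BddBelow Q := by
    refine ⟨-C, ?_⟩
    rintro s ⟨v, hv, hv0, rfl⟩
    rw [le_div_iff₀ (by have := hJpos v hv0; positivity)]
    exact hC v (hJS v hv)
  have hmem : (inner ℂ v₀ (A v₀)).re / ‖J v₀‖ ^ 2 ∈ Q := ⟨v₀, hv₀S, hv₀ne, rfl⟩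
  -- The infimum of the Rayleigh quotients is itself a spectral point: a bounded resolvent at `s`
  -- would produce a vector with a smaller quotient.
  set s := sInf Q with hs
  have hs0 : s < 0 := (csInf_le hQb hmem).trans_lt
    (div_neg_of_neg_of_pos hv₀ (by have := hJpos v₀ hv₀ne; positivity))
  have hQs : ∀ v, J v ∈ S → s * ‖J v‖ ^ 2 ≤ (inner ℂ v (A v)).re := by
    intro v hv
    rcases eq_or_ne v 0 with rfl | h0
    · simp
    rw [← le_div_iff₀ (by have := hJpos v h0; positivity)]
    exact csInf_le hQb ⟨v, hv, h0, rfl⟩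
  have hspec : (s : ℂ) ∈ spectrumOn (pullbackGraph J A) S := by
    rintro ⟨R, hR⟩
    -- With x = 1/(‖R‖ + 1), accuracy x in the quotient suffices. Along v − x w the form minus `s`
    -- is then below (x − 2x + x² ‖R‖) ‖J v‖² ≤ 0, where J w = R (J v).
    obtain ⟨q, ⟨v, hvS, hv0, rfl⟩, hq⟩ := exists_lt_of_csInf_lt ⟨_, hmem⟩
      (show sInf Q < s + 1 / (‖R‖ + 1) by rw [← hs]; have := norm_nonneg R; simp; positivity)
    have hpos := hJpos v hv0
    set g : S := ⟨J v, hvS⟩ with hg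
    obtain ⟨w, hw, hw'⟩ := (hR g (R g)).mp rfl
    dsimp only at hw hw'
    have hwS : J w ∈ S := by rw [hw]; exact (R g).2
    have hb : (inner ℂ v (A w)).re - s * (inner ℂ (J v) (J w)).re = ‖J v‖ ^ 2 := by
      rw [hw' v, ← hw, inner_add_right, inner_smul_right, inner_self_eq_norm_sq_to_K]
      simp [← Complex.ofReal_pow]
    have hc : (inner ℂ w (A w)).re - s * ‖J w‖ ^ 2 = (inner ℂ (J w) (J v)).re := by
      rw [hw' w, ← hw, inner_add_right, inner_smul_right, inner_self_eq_norm_sq_to_K]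
      simp [hg, ← Complex.ofReal_pow]
    have hRg : (inner ℂ (J w) (J v)).re ≤ ‖R‖ * ‖J v‖ ^ 2 := by
      refine (Complex.re_le_norm _).trans ((norm_inner_le_norm _ _).trans ?_)
      have : ‖J w‖ ≤ ‖R‖ * ‖J v‖ := by rw [hw]; exact R.le_opNorm g
      nlinarith
    have hq' : (inner ℂ v (A v)).re - s * ‖J v‖ ^ 2 < 1 / (‖R‖ + 1) * ‖J v‖ ^ 2 := by
      rw [div_lt_iff₀ (by positivity)] at hq
      nlinarith
    have hsym : (inner ℂ w (A v)).re = (inner ℂ v (A w)).re := by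
      rw [← hA w v, ← inner_conj_symm, Complex.conj_re]
    have hsymJ : (inner ℂ (J w) (J v)).re = (inner ℂ (J v) (J w)).re := by
      rw [← inner_conj_symm, Complex.conj_re]
    -- the polarised form is nonnegative along the real line through `v` and `w`
    have hline : ∀ x : ℝ, 0 ≤ ((inner ℂ v (A v)).re - s * ‖J v‖ ^ 2)
        - 2 * x * ‖J v‖ ^ 2 + x ^ 2 * ((inner ℂ w (A w)).re - s * ‖J w‖ ^ 2) := by
      intro x
      have hz := hQs (v - (x : ℂ) • w) (by
        rw [map_sub, map_smul]; exact S.sub_mem hvS (S.smul_mem _ hwS))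
      have e1 : (inner ℂ (v - (x : ℂ) • w) (A (v - (x : ℂ) • w))).re
          = (inner ℂ v (A v)).re - 2 * x * (inner ℂ v (A w)).re
            + x ^ 2 * (inner ℂ w (A w)).re := by
        simp only [map_sub, map_smul, inner_sub_left, inner_sub_right, inner_smul_left,
          inner_smul_right, Complex.conj_ofReal, Complex.sub_re, Complex.re_ofReal_mul, hsym]
        ring
      have e2 : ‖J (v - (x : ℂ) • w)‖ ^ 2
          = ‖J v‖ ^ 2 - 2 * x * (inner ℂ (J v) (J w)).re + x ^ 2 * ‖J w‖ ^ 2 := by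
        rw [map_sub, map_smul, @norm_sub_sq ℂ, inner_smul_right, norm_smul, mul_pow]
        simp
        ring
      rw [e1, e2] at hz
      have h3 : 2 * x * ((inner ℂ v (A w)).re - s * (inner ℂ (J v) (J w)).re)
          = 2 * x * ‖J v‖ ^ 2 := by rw [hb]
      linarith
    have hRpos : 0 < ‖R‖ + 1 := by positivity
    have h1 := hline (1 / (‖R‖ + 1))
    rw [hc] at h1
    have hx : (1 / (‖R‖ + 1)) ^ 2 * (inner ℂ (J w) (J v)).re
        ≤ (1 / (‖R‖ + 1)) ^ 2 * (‖R‖ * ‖J v‖ ^ 2) := by gcongr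
    have hx2 : (1 / (‖R‖ + 1)) ^ 2 * (‖R‖ * ‖J v‖ ^ 2) ≤ 1 / (‖R‖ + 1) * ‖J v‖ ^ 2 := by
      have : (1 / (‖R‖ + 1)) ^ 2 * ‖R‖ ≤ 1 / (‖R‖ + 1) := by
        rw [div_pow, one_pow, div_mul_eq_mul_div, one_mul,
          div_le_div_iff₀ (by positivity) (by positivity)]
        nlinarith [norm_nonneg R]
      calc _ = ((1 / (‖R‖ + 1)) ^ 2 * ‖R‖) * ‖J v‖ ^ 2 := by ring
        _ ≤ _ := by gcongr
    linarith
  refine (iInf₂_le s hspec).trans_lt ?_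
  exact_mod_cast hs0

end AbstractSpectrum

/-! ### The Fourier transform on L² in terms of integrals -/

section FourierL2

variable {E : Type*} [NormedAddCommGroup E] [InnerProductSpace ℝ E] [FiniteDimensional ℝ E]
  [MeasurableSpace E] [BorelSpace E]

theorem integral_mul_fourierInv {f g : E → ℂ} (hf : Integrable f) (hg : Integrable g) :
    ∫ x, 𝓕⁻ f x * g x = ∫ x, f x * 𝓕⁻ g x := by
  have h : ∀ f g : E → ℂ, Integrable f → Integrable g →
      ∫ x, 𝓕 f x * g x = ∫ x, f x * 𝓕 g x := by
    intro f g hf hg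
    have := VectorFourier.integral_fourierIntegral_smul_eq_flip (μ := (volume : Measure E))
      (ν := (volume : Measure E)) (L := innerₗ E) Real.continuous_fourierChar
      continuous_inner hf hg
    simp only [flip_innerₗ, smul_eq_mul] at this
    exact this
  simp only [Real.fourierInv_eq_fourier_comp_neg]
  have h1 := h (fun x => f (-x)) g hf.comp_neg hg
  rw [h1, ← integral_neg_eq_self]
  refine integral_congr_ae (Eventually.of_forall fun x => ?_)
  simp only [neg_neg]
  rw [← Real.fourierInv_eq_fourier_neg, Real.fourierInv_eq_fourier_comp_neg]

/-- The inverse Fourier transform on `L²` is given by the integral on `L¹ ∩ L²`. -/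
theorem coeFn_fourierInv_toLp {f : E → ℂ} (h1 : Integrable f) (h2 : MemLp f 2) :
    ((𝓕⁻ (h2.toLp f) : Lp ℂ 2 (volume : Measure E)) : E → ℂ) =ᵐ[volume] 𝓕⁻ f := by
  have hcont : Continuous (𝓕⁻ f) := by
    rw [Real.fourierInv_eq_fourier_comp_neg]
    exact VectorFourier.fourierIntegral_continuous Real.continuous_fourierChar
      continuous_inner h1.comp_neg
  refine ae_eq_of_integral_contDiff_smul_eq
    ((Lp.memLp _).locallyIntegrable (by norm_num)) hcont.locallyIntegrable fun g hg hgc => ?_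
  have hg' : ContDiff ℝ (⊤ : ℕ∞) (fun x => (g x : ℂ)) :=
    Complex.ofRealCLM.contDiff.comp hg
  have hgc' : HasCompactSupport (fun x => (g x : ℂ)) := hgc.comp_left (g := ((↑) : ℝ → ℂ)) rfl
  set G := hgc'.toSchwartzMap hg' with hG
  have hGx : ∀ x, G x = (g x : ℂ) := fun x => rfl
  -- The L² transform agrees with that of tempered distributions, so pairing it with the test
  -- function `G` moves the transform onto `G`; the multiplication formula then moves it onto `f`.
  have key := congrArg (fun D => D G) (Lp.fourierInv_toTemperedDistribution_eq (h2.toLp f))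
  simp only [TemperedDistribution.fourierInv_apply, Lp.toTemperedDistribution_apply] at key
  have e1 : ∫ x, g x • ((𝓕⁻ (h2.toLp f) : Lp ℂ 2 (volume : Measure E)) : E → ℂ) x
      = ∫ x, G x • ((𝓕⁻ (h2.toLp f) : Lp ℂ 2 (volume : Measure E)) : E → ℂ) x := by
    simp [hGx]
  rw [e1, ← key]
  have e2 : ∫ x, (𝓕⁻ G) x • (h2.toLp f) x = ∫ x, 𝓕⁻ (G : E → ℂ) x * f x := by
    refine integral_congr_ae ?_
    filter_upwards [h2.coeFn_toLp] with x hx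
    rw [hx, SchwartzMap.fourierInv_coe, smul_eq_mul]
  rw [e2, integral_mul_fourierInv G.integrable h1]
  simp [hGx]

/-- Plancherel for the transform defined pointwise; it is applied slice by slice, where honest
functions rather than classes in L² are needed. -/
theorem lintegral_fourierInv_sq {f : E → ℂ} (h1 : Integrable f) (h2 : MemLp f 2) :
    ∫⁻ x, ‖𝓕⁻ f x‖ₑ ^ 2 = ∫⁻ x, ‖f x‖ₑ ^ 2 := by
  have hn : ∀ g : Lp ℂ 2 (volume : Measure E), ∫⁻ x, ‖g x‖ₑ ^ 2 = ‖g‖ₑ ^ 2 := by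
    intro g
    rw [Lp.enorm_def, eLpNorm_eq_lintegral_rpow_enorm_toReal (by norm_num) (by norm_num)]
    rw [← ENNReal.rpow_natCast, ← ENNReal.rpow_mul]
    simp
  have e1 : ∫⁻ x, ‖𝓕⁻ f x‖ₑ ^ 2
      = ∫⁻ x, ‖((𝓕⁻ (h2.toLp f) : Lp ℂ 2 (volume : Measure E)) : E → ℂ) x‖ₑ ^ 2 :=
    lintegral_congr_ae (by
      filter_upwards [coeFn_fourierInv_toLp h1 h2] with x hx
      rw [hx])
  have e2 : ∫⁻ x, ‖f x‖ₑ ^ 2 = ∫⁻ x, ‖(h2.toLp f) x‖ₑ ^ 2 :=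
    lintegral_congr_ae (by
      filter_upwards [h2.coeFn_toLp] with x hx
      rw [hx])
  rw [e1, e2, hn, hn]
  congr 1
  have : ‖(𝓕⁻ (h2.toLp f) : Lp ℂ 2 (volume : Measure E))‖ = ‖h2.toLp f‖ :=
    (Lp.fourierTransformₗᵢ E ℂ).symm.norm_map _
  rw [← ofReal_norm, ← ofReal_norm, this]

/-- Composition with a linear isometry, as an operator on `L²`. -/
def compIsometry (A : E ≃ₗᵢ[ℝ] E) : Lp ℂ 2 (volume : Measure E) →L[ℂ] Lp ℂ 2 (volume : Measure E) :=
  (Lp.compMeasurePreservingₗᵢ ℂ A A.measurePreserving).toContinuousLinearMap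

theorem coeFn_compIsometry (A : E ≃ₗᵢ[ℝ] E) (f : Lp ℂ 2 (volume : Measure E)) :
    (compIsometry A f : E → ℂ) =ᵐ[volume] fun x => f (A x) :=
  Lp.coeFn_compMeasurePreserving f A.measurePreserving

/-- Both sides are continuous in `f`, and on the dense set of Schwartz functions this is a change of
variables in the Fourier integral. -/
theorem fourierInv_compIsometry (A : E ≃ₗᵢ[ℝ] E) (f : Lp ℂ 2 (volume : Measure E)) :
    (𝓕⁻ (compIsometry A f) : Lp ℂ 2 (volume : Measure E)) = compIsometry A (𝓕⁻ f) := by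
  have hc : Continuous (fun g : Lp ℂ 2 (volume : Measure E) =>
      (𝓕⁻ g : Lp ℂ 2 (volume : Measure E))) := (Lp.fourierTransformₗᵢ E ℂ).symm.continuous
  refine DenseRange.induction_on
    (p := fun f => (𝓕⁻ (compIsometry A f) : Lp ℂ 2 (volume : Measure E))
      = compIsometry A (𝓕⁻ f))
    (SchwartzMap.denseRange_toLpCLM (p := 2) ENNReal.ofNat_ne_top) f ?_ ?_
  · exact isClosed_eq (hc.comp (compIsometry A).continuous) ((compIsometry A).continuous.comp hc)
  · intro g
    have hg1 : Integrable (fun x => g (A x)) :=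
      (A.measurePreserving.integrable_comp_emb A.toMeasurableEquiv.measurableEmbedding).mpr
        g.integrable
    have hg2 : MemLp (fun x => g (A x)) 2 :=
      (g.memLp 2).comp_measurePreserving A.measurePreserving
    have e1 : compIsometry A (SchwartzMap.toLpCLM ℝ ℂ 2 volume g) = hg2.toLp _ := by
      apply Lp.ext
      have h := A.measurePreserving.quasiMeasurePreserving.ae (g.coeFn_toLp 2 volume)
      filter_upwards [coeFn_compIsometry A (SchwartzMap.toLpCLM ℝ ℂ 2 volume g),
        hg2.coeFn_toLp, h] with x h1 h2 h3
      rw [h1, h2]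
      exact h3
    have e2 : SchwartzMap.toLpCLM ℝ ℂ 2 volume g = (g.memLp 2).toLp g := rfl
    rw [e1, e2]
    apply Lp.ext
    have h := A.measurePreserving.quasiMeasurePreserving.ae
      (coeFn_fourierInv_toLp g.integrable (g.memLp 2))
    filter_upwards [coeFn_fourierInv_toLp hg1 hg2, h,
      coeFn_compIsometry A (𝓕⁻ ((g.memLp 2).toLp g))] with x h1 h2 h3
    rw [h1, h3, h2]
    exact Real.fourierInv_comp_linearIsometry A g x

end FourierL2

/-! ### Multiplication operators on L² -/

section Multiplication

variable {E : Type*} [MeasurableSpace E] {ν : Measure E}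

/-- The operator `v ↦ s · J v` on `L²`, for a function `s` that is bounded relative to `J`. -/
def mulComp (s : E → ℝ) (J : Lp ℂ 2 ν →L[ℂ] Lp ℂ 2 ν)
    (h : ∀ v, MemLp (fun x => (s x : ℂ) * J v x) 2 ν) (C : ℝ)
    (hC : ∀ v, ‖(h v).toLp‖ ≤ C * ‖v‖) : Lp ℂ 2 ν →L[ℂ] Lp ℂ 2 ν :=
  LinearMap.mkContinuous
    { toFun := fun v => (h v).toLp
      map_add' := by
        intro v w
        apply Lp.ext
        filter_upwards [(h (v + w)).coeFn_toLp, (h v).coeFn_toLp, (h w).coeFn_toLp,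
          Lp.coeFn_add (h v).toLp (h w).toLp, Lp.coeFn_add (J v) (J w)] with x h1 h2 h3 h4 h5
        rw [h1, h4, Pi.add_apply, h2, h3, map_add, h5, Pi.add_apply]
        ring
      map_smul' := by
        intro c v
        apply Lp.ext
        filter_upwards [(h (c • v)).coeFn_toLp, (h v).coeFn_toLp,
          Lp.coeFn_smul c (h v).toLp, Lp.coeFn_smul c (J v)] with x h1 h2 h4 h5
        rw [h1, RingHom.id_apply, h4, Pi.smul_apply, h2, map_smul, h5, Pi.smul_apply]
        simp only [smul_eq_mul]
        ring } C hC

theorem coeFn_mulComp (s : E → ℝ) (J : Lp ℂ 2 ν →L[ℂ] Lp ℂ 2 ν)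
    (h : ∀ v, MemLp (fun x => (s x : ℂ) * J v x) 2 ν) (C : ℝ)
    (hC : ∀ v, ‖(h v).toLp‖ ≤ C * ‖v‖) (v : Lp ℂ 2 ν) :
    (mulComp s J h C hC v : E → ℂ) =ᵐ[ν] fun x => (s x : ℂ) * J v x :=
  (h v).coeFn_toLp

theorem memLp_mul_bounded {b : E → ℝ} (hb : AEStronglyMeasurable b ν) (hb1 : ∀ x, |b x| ≤ 1)
    (v : Lp ℂ 2 ν) : MemLp (fun x => (b x : ℂ) * v x) 2 ν :=
  (Lp.memLp v).of_le_mul (c := 1)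
    ((Complex.continuous_ofReal.comp_aestronglyMeasurable hb).mul (Lp.aestronglyMeasurable v))
    (Eventually.of_forall fun x => by
      rw [norm_mul, Complex.norm_real, Real.norm_eq_abs]
      gcongr
      exact hb1 x)

/-- Multiplication by a real function bounded by `1`, as an operator on `L²`. -/
def mulOp (b : E → ℝ) (hb : AEStronglyMeasurable b ν) (hb1 : ∀ x, |b x| ≤ 1) :
    Lp ℂ 2 ν →L[ℂ] Lp ℂ 2 ν :=
  mulComp b (ContinuousLinearMap.id ℂ _) (memLp_mul_bounded hb hb1) 1 fun v => by
    refine Lp.norm_le_mul_norm_of_ae_le_mul ?_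
    filter_upwards [(memLp_mul_bounded hb hb1 v).coeFn_toLp] with x hx
    simp only [ContinuousLinearMap.id_apply]
    rw [hx, norm_mul, Complex.norm_real, Real.norm_eq_abs]
    gcongr
    exact hb1 x

theorem coeFn_mulOp {b : E → ℝ} (hb : AEStronglyMeasurable b ν) (hb1 : ∀ x, |b x| ≤ 1)
    (v : Lp ℂ 2 ν) : (mulOp b hb hb1 v : E → ℂ) =ᵐ[ν] fun x => (b x : ℂ) * v x :=
  coeFn_mulComp _ _ _ _ _ v

theorem inner_mulOp_left {b : E → ℝ} (hb : AEStronglyMeasurable b ν) (hb1 : ∀ x, |b x| ≤ 1)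
    (u v : Lp ℂ 2 ν) : inner ℂ (mulOp b hb hb1 u) v = (inner ℂ u (mulOp b hb hb1 v) : ℂ) := by
  rw [L2.inner_def, L2.inner_def]
  refine integral_congr_ae ?_
  filter_upwards [coeFn_mulOp hb hb1 u, coeFn_mulOp hb hb1 v] with x h1 h2
  rw [h1, h2]
  simp only [RCLike.inner_apply, map_mul, Complex.conj_ofReal]
  ring

theorem lintegral_enorm_sq_Lp (g : Lp ℂ 2 ν) : ∫⁻ x, ‖g x‖ₑ ^ 2 ∂ν = ENNReal.ofReal (‖g‖ ^ 2) := by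
  rw [ENNReal.ofReal_pow (norm_nonneg _), ofReal_norm, Lp.enorm_def,
    eLpNorm_eq_lintegral_rpow_enorm_toReal (by norm_num) (by norm_num),
    ← ENNReal.rpow_natCast, ← ENNReal.rpow_mul]
  simp

theorem integral_norm_sq_Lp (g : Lp ℂ 2 ν) : ∫ x, ‖g x‖ ^ 2 ∂ν = ‖g‖ ^ 2 := by
  have h := @inner_self_eq_norm_sq_to_K ℂ _ _ _ _ g
  rw [L2.inner_def] at h
  have h2 : ∀ x, (inner ℂ (g x) (g x) : ℂ) = ((‖g x‖ ^ 2 : ℝ) : ℂ) := fun x => by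
    rw [inner_self_eq_norm_sq_to_K]; push_cast; rfl
  simp_rw [h2] at h
  rw [integral_complex_ofReal] at h
  have h3 : (((∫ x, ‖g x‖ ^ 2 ∂ν : ℝ)) : ℂ) = ((‖g‖ ^ 2 : ℝ) : ℂ) := by rw [h]; push_cast; rfl
  exact Complex.ofReal_injective h3

end Multiplication

/-! ### The form of a multiplier minus a relatively bounded potential -/

section FormModel

/-- The exchange operator on `L²(ℝ × ℝ)`. -/
abbrev exchangeOp : TwoBody →L[ℂ] TwoBody := compIsometry exchange

theorem mem_symmetricSubspace_iff (v : TwoBody) : v ∈ symmetricSubspace ↔ exchangeOp v = v := by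
  constructor
  · intro h
    apply Lp.ext
    filter_upwards [coeFn_compIsometry exchange v, (h : ∀ᵐ x : Plane, v (exchange x) = v x)]
      with x h1 h2
    rw [h1, h2]
  · intro h
    change ∀ᵐ x : Plane, v (exchange x) = v x
    have := coeFn_compIsometry exchange v
    rw [show compIsometry exchange v = v from h] at this
    filter_upwards [this] with x hx
    exact hx.symm

theorem exchange_exchange (x : Plane) : exchange (exchange x) = x := by
  ext i
  fin_cases i <;> simp [exchange]

theorem exchange_apply_zero (x : Plane) : exchange x 0 = x 1 := by simp [exchange]

theorem exchange_apply_one (x : Plane) : exchange x 1 = x 0 := by simp [exchange]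

theorem exchangeOp_exchangeOp (v : TwoBody) : exchangeOp (exchangeOp v) = v := by
  apply Lp.ext
  have h := exchange.measurePreserving.quasiMeasurePreserving.ae
    (coeFn_compIsometry exchange v)
  filter_upwards [coeFn_compIsometry exchange (exchangeOp v), h] with x h1 h2
  rw [h1, h2, exchange_exchange]

theorem inner_exchangeOp (u v : TwoBody) :
    inner ℂ (exchangeOp u) (exchangeOp v) = (inner ℂ u v : ℂ) :=
  (Lp.compMeasurePreservingₗᵢ ℂ exchange exchange.measurePreserving).inner_map_map u v

theorem adjoint_exchangeOp : ContinuousLinearMap.adjoint exchangeOp = exchangeOp := by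
  symm
  rw [ContinuousLinearMap.eq_adjoint_iff]
  intro u v
  rw [← inner_exchangeOp u, exchangeOp_exchangeOp]

theorem mulOp_exchangeOp {b : Plane → ℝ} (hb : AEStronglyMeasurable b volume)
    (hb1 : ∀ x, |b x| ≤ 1) (hbs : ∀ x, b (exchange x) = b x) (v : TwoBody) :
    mulOp b hb hb1 (exchangeOp v) = exchangeOp (mulOp b hb hb1 v) := by
  apply Lp.ext
  have h := exchange.measurePreserving.quasiMeasurePreserving.ae (coeFn_mulOp hb hb1 v)
  filter_upwards [coeFn_mulOp hb hb1 (exchangeOp v), coeFn_compIsometry exchange v,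
    coeFn_compIsometry exchange (mulOp b hb hb1 v), h] with x h1 h2 h3 h4
  rw [h1, h2, h3, h4, hbs]

/-- Data of a nonnegative symmetric multiplier `m` and a symmetric potential `W` that is form
bounded with respect to it with relative bound `1 / 2`. -/
structure FormData (m : Plane → ℝ) (W : ℝ → ℝ) (M : ℝ) : Prop where
  meas : Measurable m
  nonneg : ∀ p, 0 ≤ m p
  symm : ∀ p, m (exchange p) = m p
  measW : AEStronglyMeasurable (fun x : Plane => W (x 0 - x 1)) volume
  evenW : ∀ r, W (-r) = W r
  posM : 0 ≤ M
  bound : ∀ ψ : TwoBody, ∫⁻ x : Plane, ‖W (x 0 - x 1)‖ₑ * ‖ψ x‖ₑ ^ 2 ≤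
    ∫⁻ ξ : Plane, ENNReal.ofReal ((m ((2 * Real.pi) • ξ) + M) / 2) *
      ‖(𝓕 ψ : TwoBody) ξ‖ₑ ^ 2

namespace FormData

variable {m : Plane → ℝ} {W : ℝ → ℝ} {M : ℝ}

theorem meas_scaled (D : FormData m W M) : Measurable fun ξ : Plane => m ((2 * Real.pi) • ξ) :=
  D.meas.comp (measurable_const_smul _)

theorem meas_rsqrt (D : FormData m W M) : AEStronglyMeasurable
    (fun ξ : Plane => (Real.sqrt (1 + m ((2 * Real.pi) • ξ)))⁻¹) volume :=
  ((measurable_const.add D.meas_scaled).sqrt.inv).aestronglyMeasurable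

theorem one_le (D : FormData m W M) (p : Plane) : 1 ≤ Real.sqrt (1 + m p) := by
  rw [Real.one_le_sqrt]; linarith [D.nonneg p]

theorem rsqrt_le (D : FormData m W M) (ξ : Plane) :
    |(Real.sqrt (1 + m ((2 * Real.pi) • ξ)))⁻¹| ≤ 1 := by
  rw [abs_of_nonneg (by positivity)]
  exact inv_le_one_of_one_le₀ (D.one_le _)

theorem rsqrt_sq (D : FormData m W M) (p : Plane) :
    (Real.sqrt (1 + m p))⁻¹ ^ 2 = 1 / (1 + m p) := by
  rw [inv_pow, Real.sq_sqrt (by linarith [D.nonneg p]), one_div]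

theorem symm_scaled (D : FormData m W M) (ξ : Plane) :
    m ((2 * Real.pi) • exchange ξ) = m ((2 * Real.pi) • ξ) := by
  rw [← map_smul, D.symm]

/-- The operator `(1 + m)^(-1/2)`, from momentum to position space. -/
def J (D : FormData m W M) : TwoBody →L[ℂ] TwoBody :=
  ((Lp.fourierTransformₗᵢ Plane ℂ).symm : TwoBody →L[ℂ] TwoBody) ∘L
    mulOp _ D.meas_rsqrt D.rsqrt_le

theorem J_apply (D : FormData m W M) (v : TwoBody) :
    D.J v = (𝓕⁻ (mulOp _ D.meas_rsqrt D.rsqrt_le v) : TwoBody) := rfl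

theorem fourier_J (D : FormData m W M) (v : TwoBody) :
    (𝓕 (D.J v) : TwoBody) = mulOp _ D.meas_rsqrt D.rsqrt_le v := by
  rw [J_apply, FourierTransform.fourier_fourierInv_eq]

theorem coeFn_fourier_J (D : FormData m W M) (v : TwoBody) :
    ((𝓕 (D.J v) : TwoBody) : Plane → ℂ) =ᵐ[volume]
    fun ξ => ((Real.sqrt (1 + m ((2 * Real.pi) • ξ)))⁻¹ : ℝ) * v ξ := by
  rw [fourier_J]
  exact coeFn_mulOp _ _ v

theorem J_injective (D : FormData m W M) : Function.Injective D.J := by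
  rw [injective_iff_map_eq_zero]
  intro v hv
  have h0 : (𝓕 (D.J v) : TwoBody) = 0 := by
    rw [hv]; exact (Lp.fourierTransformₗᵢ Plane ℂ).map_zero
  apply Lp.ext
  have h := D.coeFn_fourier_J v
  rw [h0] at h
  filter_upwards [h, Lp.coeFn_zero ℂ 2 (volume : Measure Plane)] with ξ h1 h2
  rw [h2] at h1 ⊢
  have h3 := D.one_le ((2 * Real.pi) • ξ)
  have h4 : (((Real.sqrt (1 + m ((2 * Real.pi) • ξ)))⁻¹ : ℝ) : ℂ) ≠ 0 := by
    rw [Complex.ofReal_ne_zero]; positivity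
  exact (mul_eq_zero.mp h1.symm).resolve_left h4

theorem J_exchangeOp (D : FormData m W M) (v : TwoBody) :
    D.J (exchangeOp v) = exchangeOp (D.J v) := by
  rw [J_apply, J_apply, mulOp_exchangeOp, fourierInv_compIsometry]
  intro ξ
  rw [D.symm_scaled]

/-- On the range of `J` the form bound becomes a norm bound, as (m + M)/(2(1 + m)) ≤ 1 + M. This
makes √|W| J a bounded operator. -/
theorem lintegral_bound (D : FormData m W M) (v : TwoBody) :
    ∫⁻ x : Plane, ‖W (x 0 - x 1)‖ₑ * ‖D.J v x‖ₑ ^ 2 ≤ ENNReal.ofReal ((1 + M) * ‖v‖ ^ 2) := by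
  refine (D.bound _).trans ?_
  rw [ENNReal.ofReal_mul (by linarith [D.posM]), ← lintegral_enorm_sq_Lp,
    ← lintegral_const_mul' _ _ ENNReal.ofReal_ne_top]
  refine lintegral_mono_ae ?_
  filter_upwards [D.coeFn_fourier_J v] with ξ hξ
  rw [hξ, enorm_mul, mul_pow, ← mul_assoc]
  gcongr
  have h0 := D.nonneg ((2 * Real.pi) • ξ)
  rw [← ofReal_norm, ← ENNReal.ofReal_pow (norm_nonneg _),
    ← ENNReal.ofReal_mul (by linarith [D.posM])]
  refine ENNReal.ofReal_le_ofReal ?_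
  rw [Complex.norm_real, Real.norm_eq_abs, sq_abs, D.rsqrt_sq, mul_one_div,
    div_le_iff₀ (by linarith)]
  nlinarith [D.posM, mul_nonneg D.posM h0]

theorem meas_sqrtW (D : FormData m W M) :
    AEStronglyMeasurable (fun x : Plane => Real.sqrt |W (x 0 - x 1)|) volume :=
  (Real.continuous_sqrt.comp continuous_abs).comp_aestronglyMeasurable D.measW

theorem enorm_sqrtW_mul (D : FormData m W M) (v : TwoBody) (x : Plane) :
    ‖(Real.sqrt |W (x 0 - x 1)| : ℂ) * D.J v x‖ₑ ^ 2 = ‖W (x 0 - x 1)‖ₑ * ‖D.J v x‖ₑ ^ 2 := by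
  rw [enorm_mul, mul_pow]
  congr 1
  rw [← ofReal_norm, ← ENNReal.ofReal_pow (norm_nonneg _), Complex.norm_real, Real.norm_eq_abs,
    sq_abs, Real.sq_sqrt (abs_nonneg _), ← Real.norm_eq_abs, ofReal_norm]

theorem memLp_sqrtW (D : FormData m W M) (v : TwoBody) :
    MemLp (fun x : Plane => (Real.sqrt |W (x 0 - x 1)| : ℂ) * D.J v x) 2 volume := by
  refine ⟨(Complex.continuous_ofReal.comp_aestronglyMeasurable D.meas_sqrtW).mul
    (Lp.aestronglyMeasurable _), ?_⟩
  rw [eLpNorm_lt_top_iff_lintegral_rpow_enorm_lt_top (by norm_num) (by norm_num)]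
  refine lt_of_le_of_lt ?_ (ENNReal.ofReal_lt_top (r := (1 + M) * ‖v‖ ^ 2))
  refine le_trans (le_of_eq ?_) (D.lintegral_bound v)
  refine lintegral_congr fun x => ?_
  rw [← D.enorm_sqrtW_mul]
  simp

/-- The operator `√|W| (1 + m)^(-1/2)`. -/
def Y (D : FormData m W M) : TwoBody →L[ℂ] TwoBody :=
  mulComp (fun x : Plane => Real.sqrt |W (x 0 - x 1)|) D.J D.memLp_sqrtW (1 + M) fun v => by
    have h1 : ENNReal.ofReal (‖(D.memLp_sqrtW v).toLp‖ ^ 2)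
        ≤ ENNReal.ofReal ((1 + M) * ‖v‖ ^ 2) := by
      rw [← lintegral_enorm_sq_Lp]
      refine le_trans (le_of_eq ?_) (D.lintegral_bound v)
      refine lintegral_congr_ae ?_
      filter_upwards [(D.memLp_sqrtW v).coeFn_toLp] with x hx
      rw [hx, D.enorm_sqrtW_mul]
    have hM := D.posM
    rw [ENNReal.ofReal_le_ofReal_iff (by positivity)] at h1
    refine abs_le_of_sq_le_sq' (h1.trans ?_) (by positivity) |>.2
    rw [mul_pow]
    gcongr
    nlinarith

theorem coeFn_Y (D : FormData m W M) (v : TwoBody) : (D.Y v : Plane → ℂ) =ᵐ[volume]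
    fun x => (Real.sqrt |W (x 0 - x 1)| : ℂ) * D.J v x :=
  coeFn_mulComp _ _ _ _ _ v

theorem evenW_exchange (D : FormData m W M) (x : Plane) :
    W (exchange x 0 - exchange x 1) = W (x 0 - x 1) := by
  rw [exchange_apply_zero, exchange_apply_one, ← D.evenW, neg_sub]

theorem Y_exchangeOp (D : FormData m W M) (v : TwoBody) :
    D.Y (exchangeOp v) = exchangeOp (D.Y v) := by
  apply Lp.ext
  have h := exchange.measurePreserving.quasiMeasurePreserving.ae (D.coeFn_Y v)
  filter_upwards [D.coeFn_Y (exchangeOp v), coeFn_compIsometry exchange (D.J v),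
    coeFn_compIsometry exchange (D.Y v), h] with x h1 h2 h3 h4
  rw [h1, h3, h4, D.J_exchangeOp, h2, D.evenW_exchange]

/-- W/|W| serves as the sign of W. Where W = 0 the quotient is 0 by convention, which is harmless
because √|W| vanishes there too. -/
theorem meas_sign (D : FormData m W M) : AEStronglyMeasurable
    (fun x : Plane => W (x 0 - x 1) / |W (x 0 - x 1)|) volume :=
  (D.measW.aemeasurable.div
    (continuous_abs.comp_aestronglyMeasurable D.measW).aemeasurable).aestronglyMeasurable

theorem sign_le (_D : FormData m W M) (x : Plane) : |(W (x 0 - x 1) / |W (x 0 - x 1)|)| ≤ 1 := by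
  rw [abs_div, abs_abs]
  exact div_self_le_one _

theorem meas_kin (D : FormData m W M) : AEStronglyMeasurable
    (fun ξ : Plane => m ((2 * Real.pi) • ξ) / (1 + m ((2 * Real.pi) • ξ))) volume :=
  (D.meas_scaled.div (measurable_const.add D.meas_scaled)).aestronglyMeasurable

theorem kin_le (D : FormData m W M) (ξ : Plane) :
    |m ((2 * Real.pi) • ξ) / (1 + m ((2 * Real.pi) • ξ))| ≤ 1 := by
  have h0 := D.nonneg ((2 * Real.pi) • ξ)
  rw [abs_of_nonneg (by positivity), div_le_one (by positivity)]
  linarith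

/-- The bounded operator representing the form in the variable `J⁻¹ ψ`. -/
def A (D : FormData m W M) : TwoBody →L[ℂ] TwoBody :=
  mulOp _ D.meas_kin D.kin_le -
    ContinuousLinearMap.adjoint D.Y ∘L mulOp _ D.meas_sign D.sign_le ∘L D.Y

theorem inner_A (D : FormData m W M) (u v : TwoBody) : inner ℂ u (D.A v) =
    (inner ℂ u (mulOp _ D.meas_kin D.kin_le v) -
      inner ℂ (D.Y u) (mulOp _ D.meas_sign D.sign_le (D.Y v)) : ℂ) := by
  change inner ℂ u (mulOp _ D.meas_kin D.kin_le v -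
    ContinuousLinearMap.adjoint D.Y (mulOp _ D.meas_sign D.sign_le (D.Y v))) = _
  rw [inner_sub_right, ContinuousLinearMap.adjoint_inner_right]

theorem inner_A_left (D : FormData m W M) (u v : TwoBody) :
    inner ℂ (D.A u) v = (inner ℂ u (D.A v) : ℂ) := by
  rw [← inner_conj_symm, inner_A, inner_A, map_sub, inner_conj_symm, inner_conj_symm,
    inner_mulOp_left, inner_mulOp_left]

theorem A_exchangeOp (D : FormData m W M) (v : TwoBody) :
    D.A (exchangeOp v) = exchangeOp (D.A v) := by
  refine ext_inner_left ℂ fun u => ?_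
  have e : inner ℂ u (exchangeOp (D.A v)) = (inner ℂ (exchangeOp u) (D.A v) : ℂ) := by
    rw [← inner_exchangeOp u, exchangeOp_exchangeOp]
  rw [e, inner_A, inner_A, D.Y_exchangeOp, D.Y_exchangeOp, mulOp_exchangeOp, mulOp_exchangeOp,
    ← inner_exchangeOp u, exchangeOp_exchangeOp, ← inner_exchangeOp (D.Y u),
    exchangeOp_exchangeOp]
  · intro x; rw [D.evenW_exchange]
  · intro x; rw [D.symm_scaled]

/-- Write W = sgn(W) √|W| √|W| and give one root to each argument; in the kinetic term the two
factors (1 + m)^(-1/2) combine to m/(1 + m). -/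
theorem form_J (D : FormData m W M) (u v : TwoBody) :
    form m W (D.J u) (D.J v) = inner ℂ u (D.A v) := by
  rw [inner_A, form, L2.inner_def, L2.inner_def]
  congr 1
  · refine integral_congr_ae ?_
    filter_upwards [D.coeFn_fourier_J u, D.coeFn_fourier_J v,
      coeFn_mulOp D.meas_kin D.kin_le v] with ξ h1 h2 h3
    rw [h1, h2, h3]
    simp only [RCLike.inner_apply, map_mul, Complex.conj_ofReal]
    have h4 : ((m ((2 * Real.pi) • ξ) / (1 + m ((2 * Real.pi) • ξ)) : ℝ) : ℂ)
        = (m ((2 * Real.pi) • ξ) : ℂ) *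
          (((Real.sqrt (1 + m ((2 * Real.pi) • ξ)))⁻¹ : ℝ) : ℂ) ^ 2 := by
      rw [← Complex.ofReal_pow, D.rsqrt_sq, ← Complex.ofReal_mul, mul_one_div]
    rw [h4]
    ring
  · refine integral_congr_ae ?_
    filter_upwards [D.coeFn_Y u, D.coeFn_Y v,
      coeFn_mulOp D.meas_sign D.sign_le (D.Y v)] with x h1 h2 h3
    rw [h3, h1, h2]
    simp only [RCLike.inner_apply, map_mul, Complex.conj_ofReal]
    have h4 : (W (x 0 - x 1) : ℂ) = ((W (x 0 - x 1) / |W (x 0 - x 1)| : ℝ) : ℂ) *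
        (Real.sqrt |W (x 0 - x 1)| : ℂ) ^ 2 := by
      rw [← Complex.ofReal_pow, ← Complex.ofReal_mul, Real.sq_sqrt (abs_nonneg _)]
      congr 1
      rcases eq_or_ne (W (x 0 - x 1)) 0 with h | h
      · simp [h]
      · rw [div_mul_cancel₀ _ (abs_ne_zero.mpr h)]
    rw [h4]
    ring

/-- The preimage is √(1 + m) 𝓕ψ. Since 𝓕ψ is already in L², it is square integrable exactly when m
|𝓕ψ|² is integrable. -/
theorem mem_formDomain_iff (D : FormData m W M) (ψ : TwoBody) :
    ψ ∈ formDomain m ↔ ∃ v, D.J v = ψ := by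
  constructor
  · intro h
    have h : Integrable (fun ξ : Plane => m ((2 * Real.pi) • ξ) * ‖(𝓕 ψ : TwoBody) ξ‖ ^ 2) := h
    have hm : AEStronglyMeasurable (fun ξ : Plane =>
        ((Real.sqrt (1 + m ((2 * Real.pi) • ξ)) : ℝ) : ℂ) * (𝓕 ψ : TwoBody) ξ) volume :=
      (Complex.continuous_ofReal.comp_aestronglyMeasurable
        ((measurable_const.add D.meas_scaled).sqrt.aestronglyMeasurable)).mul
        (Lp.aestronglyMeasurable _)
    have hL : MemLp (fun ξ : Plane =>
        ((Real.sqrt (1 + m ((2 * Real.pi) • ξ)) : ℝ) : ℂ) * (𝓕 ψ : TwoBody) ξ) 2 volume := by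
      rw [memLp_two_iff_integrable_sq_norm hm]
      have h2 := (memLp_two_iff_integrable_sq_norm (Lp.aestronglyMeasurable _)).mp
        (Lp.memLp (𝓕 ψ : TwoBody))
      refine (h2.add h).congr (Eventually.of_forall fun ξ => ?_)
      have h0 := D.nonneg ((2 * Real.pi) • ξ)
      simp only [Pi.add_apply, norm_mul, Complex.norm_real, Real.norm_eq_abs, mul_pow, sq_abs]
      rw [Real.sq_sqrt (by linarith)]
      ring
    refine ⟨hL.toLp, ?_⟩
    have h3 : (𝓕 (D.J hL.toLp) : TwoBody) = 𝓕 ψ := by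
      apply Lp.ext
      filter_upwards [D.coeFn_fourier_J hL.toLp, hL.coeFn_toLp] with ξ h1 h2
      rw [h1, h2, ← mul_assoc, ← Complex.ofReal_mul,
        inv_mul_cancel₀ (by linarith [D.one_le ((2 * Real.pi) • ξ)])]
      simp
    exact (Lp.fourierTransformₗᵢ Plane ℂ).injective h3
  · rintro ⟨v, rfl⟩
    change Integrable (fun ξ : Plane => m ((2 * Real.pi) • ξ) * ‖(𝓕 (D.J v) : TwoBody) ξ‖ ^ 2)
    have h2 := (memLp_two_iff_integrable_sq_norm (Lp.aestronglyMeasurable _)).mp (Lp.memLp v)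
    refine h2.mono' (D.meas_scaled.aestronglyMeasurable.mul
      ((Lp.aestronglyMeasurable _).norm.pow 2)) ?_
    filter_upwards [D.coeFn_fourier_J v] with ξ h1
    have h0 := D.nonneg ((2 * Real.pi) • ξ)
    rw [Real.norm_of_nonneg (by positivity), h1, norm_mul, Complex.norm_real, Real.norm_eq_abs,
      mul_pow, sq_abs, D.rsqrt_sq, ← mul_assoc]
    refine mul_le_of_le_one_left (by positivity) ?_
    rw [mul_one_div, div_le_one (by positivity)]
    linarith

/-- This places the KLMN operator in the abstract setting, where domain questions are replaced by
the bounded operators `J` and `A`. -/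
theorem formOperator_eq (D : FormData m W M) : formOperator m W = pullbackGraph D.J D.A := by
  ext ⟨ψ, f⟩
  simp only [formOperator, pullbackGraph, Set.mem_ofPred_eq]
  rw [D.mem_formDomain_iff]
  constructor
  · rintro ⟨⟨v, rfl⟩, h⟩
    refine ⟨v, rfl, fun u => ?_⟩
    rw [← D.form_J]
    exact h _ ((D.mem_formDomain_iff _).mpr ⟨u, rfl⟩)
  · rintro ⟨v, rfl, h⟩
    refine ⟨⟨v, rfl⟩, fun φ hφ => ?_⟩
    obtain ⟨u, rfl⟩ := (D.mem_formDomain_iff _).mp hφ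
    rw [D.form_J, h u]

theorem norm_J_sq (D : FormData m W M) (v : TwoBody) :
    ‖D.J v‖ ^ 2 = ∫ ξ : Plane, 1 / (1 + m ((2 * Real.pi) • ξ)) * ‖v ξ‖ ^ 2 := by
  have h : ‖D.J v‖ = ‖(𝓕 (D.J v) : TwoBody)‖ := (Lp.norm_fourier_eq _).symm
  rw [h, ← integral_norm_sq_Lp]
  refine integral_congr_ae ?_
  filter_upwards [D.coeFn_fourier_J v] with ξ h1
  rw [h1, norm_mul, Complex.norm_real, Real.norm_eq_abs, mul_pow, sq_abs, D.rsqrt_sq]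

theorem re_inner_A (D : FormData m W M) (v : TwoBody) : (inner ℂ v (D.A v)).re =
    (∫ ξ : Plane, m ((2 * Real.pi) • ξ) / (1 + m ((2 * Real.pi) • ξ)) * ‖v ξ‖ ^ 2) -
      ∫ x : Plane, W (x 0 - x 1) * ‖D.J v x‖ ^ 2 := by
  rw [← D.form_J, form]
  have hz : ∀ z : ℂ, conj z * z = ((‖z‖ ^ 2 : ℝ) : ℂ) := fun z => by
    rw [mul_comm, Complex.mul_conj, Complex.normSq_eq_norm_sq]
  simp only [hz, ← Complex.ofReal_mul, integral_complex_ofReal, ← Complex.ofReal_sub,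
    Complex.ofReal_re]
  congr 1
  refine integral_congr_ae ?_
  filter_upwards [D.coeFn_fourier_J v] with ξ h1
  rw [h1, norm_mul, Complex.norm_real, Real.norm_eq_abs, mul_pow, sq_abs, D.rsqrt_sq]
  ring

/-- The potential uses up at most (m + M)/2, which leaves half of the kinetic energy, and m/(1 + m)
= 1 − 1/(1 + m) turns that half into ‖v‖² and ‖J v‖² terms. -/
theorem coercive (D : FormData m W M) (v : TwoBody) :
    1 / 2 * ‖v‖ ^ 2 - (M + 1) / 2 * ‖D.J v‖ ^ 2 ≤ (inner ℂ v (D.A v)).re := by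
  have hv2 : Integrable (fun ξ : Plane => ‖v ξ‖ ^ 2) :=
    (memLp_two_iff_integrable_sq_norm (Lp.aestronglyMeasurable _)).mp (Lp.memLp v)
  have hJ2 : Integrable (fun ξ : Plane => 1 / (1 + m ((2 * Real.pi) • ξ)) * ‖v ξ‖ ^ 2) := by
    refine hv2.bdd_mul (c := 1) ?_ ?_
    · exact (measurable_const.div (measurable_const.add D.meas_scaled)).aestronglyMeasurable
    · refine Eventually.of_forall fun ξ => ?_
      have h0 := D.nonneg ((2 * Real.pi) • ξ)
      rw [Real.norm_of_nonneg (by positivity), div_le_one (by positivity)]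
      linarith
  have hk2 : Integrable (fun ξ : Plane =>
      m ((2 * Real.pi) • ξ) / (1 + m ((2 * Real.pi) • ξ)) * ‖v ξ‖ ^ 2) :=
    hv2.bdd_mul (c := 1) D.meas_kin (Eventually.of_forall D.kin_le)
  have hpot : ∫ x : Plane, W (x 0 - x 1) * ‖D.J v x‖ ^ 2 ≤
      ∫ ξ : Plane, ((m ((2 * Real.pi) • ξ) + M) / 2) *
        (1 / (1 + m ((2 * Real.pi) • ξ)) * ‖v ξ‖ ^ 2) := by
    have hI : Integrable (fun ξ : Plane => ((m ((2 * Real.pi) • ξ) + M) / 2) *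
        (1 / (1 + m ((2 * Real.pi) • ξ)) * ‖v ξ‖ ^ 2)) := by
      refine ((hk2.const_mul (1 / 2)).add (hJ2.const_mul (M / 2))).congr
        (Eventually.of_forall fun ξ => ?_)
      simp only [Pi.add_apply]
      ring
    have hnn : ∀ ξ : Plane, 0 ≤ ((m ((2 * Real.pi) • ξ) + M) / 2) *
        (1 / (1 + m ((2 * Real.pi) • ξ)) * ‖v ξ‖ ^ 2) := fun ξ => by
      have h0 := D.nonneg ((2 * Real.pi) • ξ)
      have := D.posM
      positivity
    have hb := D.bound (D.J v)
    have e1 : ∫⁻ ξ : Plane, ENNReal.ofReal ((m ((2 * Real.pi) • ξ) + M) / 2) *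
        ‖(𝓕 (D.J v) : TwoBody) ξ‖ₑ ^ 2 = ENNReal.ofReal (∫ ξ : Plane,
          ((m ((2 * Real.pi) • ξ) + M) / 2) *
            (1 / (1 + m ((2 * Real.pi) • ξ)) * ‖v ξ‖ ^ 2)) := by
      rw [ofReal_integral_eq_lintegral_ofReal hI (Eventually.of_forall hnn)]
      refine lintegral_congr_ae ?_
      filter_upwards [D.coeFn_fourier_J v] with ξ h1
      have h0 := D.nonneg ((2 * Real.pi) • ξ)
      have := D.posM
      rw [ENNReal.ofReal_mul (by positivity), h1, ← ofReal_norm,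
        ← ENNReal.ofReal_pow (norm_nonneg _), norm_mul, Complex.norm_real, Real.norm_eq_abs,
        mul_pow, sq_abs, D.rsqrt_sq]
    rw [e1] at hb
    have e2 : ∫⁻ x : Plane, ‖W (x 0 - x 1) * ‖D.J v x‖ ^ 2‖ₑ ≤ ENNReal.ofReal (∫ ξ : Plane,
          ((m ((2 * Real.pi) • ξ) + M) / 2) *
            (1 / (1 + m ((2 * Real.pi) • ξ)) * ‖v ξ‖ ^ 2)) := by
      refine le_trans (le_of_eq (lintegral_congr fun x => ?_)) hb
      rw [enorm_mul, enorm_pow, enorm_norm]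
    have e3 : ‖∫ x : Plane, W (x 0 - x 1) * ‖D.J v x‖ ^ 2‖ₑ ≤ _ :=
      (enorm_integral_le_lintegral_enorm _).trans e2
    rw [← ofReal_norm, ENNReal.ofReal_le_ofReal_iff (integral_nonneg hnn)] at e3
    exact (le_abs_self _).trans e3
  rw [D.re_inner_A, D.norm_J_sq, ← integral_norm_sq_Lp]
  have e4 : ∫ ξ : Plane, ((m ((2 * Real.pi) • ξ) + M) / 2) *
        (1 / (1 + m ((2 * Real.pi) • ξ)) * ‖v ξ‖ ^ 2)
      = 1 / 2 * (∫ ξ : Plane, m ((2 * Real.pi) • ξ) / (1 + m ((2 * Real.pi) • ξ)) * ‖v ξ‖ ^ 2)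
        + M / 2 * ∫ ξ : Plane, 1 / (1 + m ((2 * Real.pi) • ξ)) * ‖v ξ‖ ^ 2 := by
    rw [← integral_const_mul, ← integral_const_mul,
      ← integral_add (hk2.const_mul _) (hJ2.const_mul _)]
    refine integral_congr_ae (Eventually.of_forall fun ξ => ?_)
    simp only
    ring
  have e5 : ∫ ξ : Plane, ‖v ξ‖ ^ 2
      = (∫ ξ : Plane, m ((2 * Real.pi) • ξ) / (1 + m ((2 * Real.pi) • ξ)) * ‖v ξ‖ ^ 2)
        + ∫ ξ : Plane, 1 / (1 + m ((2 * Real.pi) • ξ)) * ‖v ξ‖ ^ 2 := by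
    rw [← integral_add hk2 hJ2]
    refine integral_congr_ae (Eventually.of_forall fun ξ => ?_)
    have h0 := D.nonneg ((2 * Real.pi) • ξ)
    simp only
    field_simp
    ring
  rw [e5]
  linarith

end FormData
end FormModel
/-! ### Centre-of-mass coordinates -/

section Coordinates

/-- The linear map `ℝ × ℝ → ℝ²` with the given matrix. -/
def planeMap (a b c d : ℝ) (z : ℝ × ℝ) : Plane := !₂[a * z.1 + b * z.2, c * z.1 + d * z.2]

theorem measurePreserving_planeMap {a b c d : ℝ} (h : |a * d - b * c| = 1) :
    MeasurePreserving (planeMap a b c d) volume volume := by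
  set A : Matrix (Fin 2) (Fin 2) ℝ := !![a, b; c, d] with hA
  have hdet : A.det = a * d - b * c := by rw [hA, Matrix.det_fin_two_of]
  have hne : A.det ≠ 0 := by
    intro h0; rw [hdet] at h0; rw [h0] at h; simp at h
  have h1 : MeasurePreserving (Matrix.toLin' A) volume volume := by
    refine ⟨(Matrix.toLin' A).continuous_of_finiteDimensional.measurable, ?_⟩
    rw [Real.map_matrix_volume_pi_eq_smul_volume_pi hne, hdet, abs_inv, h]
    simp
  have h2 := (volume_preserving_finTwoArrow ℝ).symm
  have h3 := (EuclideanSpace.volume_preserving_symm_measurableEquiv_toLp (Fin 2)).symm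
  have h4 := (h3.comp h1).comp h2
  convert! h4 using 1
  funext z
  ext i
  fin_cases i <;> simp [planeMap, hA, MeasurableEquiv.finTwoArrow,
    MeasurableEquiv.piFinTwo] <;> ring

/-- Total and relative momentum to momenta. -/
abbrev momMap : ℝ × ℝ → Plane := planeMap (1 / 2) 1 (1 / 2) (-1)

/-- Centre of mass and relative position to positions. -/
abbrev posMap : ℝ × ℝ → Plane := planeMap 1 (1 / 2) 1 (-1 / 2)

theorem measurePreserving_momMap : MeasurePreserving momMap volume volume :=
  measurePreserving_planeMap (by norm_num)

theorem measurePreserving_posMap : MeasurePreserving posMap volume volume :=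
  measurePreserving_planeMap (by norm_num)

theorem posMap_diff (R r : ℝ) : posMap (R, r) 0 - posMap (R, r) 1 = r := by
  simp [planeMap]; ring

theorem momMap_zero (η ζ : ℝ) : momMap (η, ζ) 0 = η / 2 + ζ := by
  simp [planeMap]; ring

theorem momMap_one (η ζ : ℝ) : momMap (η, ζ) 1 = η / 2 - ζ := by
  simp [planeMap]; ring

theorem exchange_momMap (η ζ : ℝ) : exchange (momMap (η, ζ)) = momMap (η, -ζ) := by
  ext i
  fin_cases i
  · change exchange (momMap (η, ζ)) 0 = momMap (η, -ζ) 0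
    rw [exchange_apply_zero, momMap_one, momMap_zero]; ring
  · change exchange (momMap (η, ζ)) 1 = momMap (η, -ζ) 1
    rw [exchange_apply_one, momMap_one, momMap_zero]; ring

theorem inner_momMap_posMap (η ζ R r : ℝ) :
    (inner ℝ (momMap (η, ζ)) (posMap (R, r)) : ℝ) = η * R + ζ * r := by
  simp [planeMap, PiLp.inner_apply, Fin.sum_univ_two]; ring

theorem integrable_comp_momMap {F : Type*} [NormedAddCommGroup F] {f : Plane → F}
    (hf : Integrable f) : Integrable (fun z => f (momMap z)) :=
  measurePreserving_momMap.integrable_comp_of_integrable hf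

theorem measurableEmbedding_planeMap {a b c d : ℝ} (h : |a * d - b * c| = 1) :
    MeasurableEmbedding (planeMap a b c d) := by
  have hmeas := (measurePreserving_planeMap h).measurable
  refine Measurable.measurableEmbedding hmeas fun z w hzw => ?_
  have h0 := congrArg (fun x : Plane => x 0) hzw
  have h1 := congrArg (fun x : Plane => x 1) hzw
  simp only [planeMap, PiLp.toLp_apply, Matrix.cons_val_zero, Matrix.cons_val_one] at h0 h1
  have hne : a * d - b * c ≠ 0 := by intro h0; rw [h0] at h; simp at h
  have e1 : (a * d - b * c) * (z.1 - w.1) = 0 := by linear_combination d * h0 - b * h1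
  have e2 : (a * d - b * c) * (z.2 - w.2) = 0 := by linear_combination a * h1 - c * h0
  exact Prod.ext (sub_eq_zero.mp ((mul_eq_zero.mp e1).resolve_left hne))
    (sub_eq_zero.mp ((mul_eq_zero.mp e2).resolve_left hne))

theorem integral_momMap {F : Type*} [NormedAddCommGroup F] [NormedSpace ℝ F] (f : Plane → F) :
    ∫ z, f (momMap z) = ∫ ξ, f ξ :=
  measurePreserving_momMap.integral_comp (measurableEmbedding_planeMap (by norm_num)) f

theorem integral_posMap {F : Type*} [NormedAddCommGroup F] [NormedSpace ℝ F] (f : Plane → F) :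
    ∫ z, f (posMap z) = ∫ ξ, f ξ :=
  measurePreserving_posMap.integral_comp (measurableEmbedding_planeMap (by norm_num)) f

theorem lintegral_posMap (f : Plane → ENNReal) : ∫⁻ z, f (posMap z) = ∫⁻ ξ, f ξ :=
  measurePreserving_posMap.lintegral_comp_emb (measurableEmbedding_planeMap (by norm_num)) f

theorem lintegral_momMap (f : Plane → ENNReal) : ∫⁻ z, f (momMap z) = ∫⁻ ξ, f ξ :=
  measurePreserving_momMap.lintegral_comp_emb (measurableEmbedding_planeMap (by norm_num)) f

end Coordinates

/-! ### Bounded functions with bounded support -/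

/-- Bounded measurable functions vanishing outside of a ball. -/
structure Nice {E : Type*} [NormedAddCommGroup E] [MeasurableSpace E] (u : E → ℂ) (C R : ℝ) :
    Prop where
  meas : Measurable u
  bound : ∀ x, ‖u x‖ ≤ C
  supp : ∀ x, R < ‖x‖ → u x = 0

namespace Nice

section
variable {E : Type*} [NormedAddCommGroup E] [MeasurableSpace E]
  [ProperSpace E] {ν : Measure E} [IsFiniteMeasureOnCompacts ν] {u : E → ℂ} {C R : ℝ}

theorem integrable (hu : Nice u C R) : Integrable u ν := by
  have h1 : IntegrableOn u (Metric.closedBall 0 R) ν :=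
    IntegrableOn.of_bound (isCompact_closedBall _ _).measure_lt_top
      hu.meas.aestronglyMeasurable C (Eventually.of_forall hu.bound)
  refine (integrableOn_iff_integrable_of_support_subset fun x hx => ?_).mp h1
  rw [mem_closedBall_zero_iff]
  by_contra! h
  exact hx (hu.supp x h)

theorem memLp (hu : Nice u C R) : MemLp u 2 ν := by
  rw [memLp_two_iff_integrable_sq_norm hu.meas.aestronglyMeasurable]
  refine (hu.integrable.norm.const_mul C).mono'
    (hu.meas.norm.pow_const 2).aestronglyMeasurable (Eventually.of_forall fun x => ?_)
  rw [Real.norm_of_nonneg (by positivity), sq]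
  exact mul_le_mul_of_nonneg_right (hu.bound x) (norm_nonneg _)

end

section
variable {u : Plane → ℂ} {C R : ℝ}

theorem norm_le_momMap (η ζ : ℝ) : |η| ≤ 2 * ‖momMap (η, ζ)‖ ∧ |ζ| ≤ ‖momMap (η, ζ)‖ := by
  have h0 := PiLp.norm_apply_le (momMap (η, ζ)) 0
  have h1 := PiLp.norm_apply_le (momMap (η, ζ)) 1
  rw [momMap_zero, Real.norm_eq_abs] at h0
  rw [momMap_one, Real.norm_eq_abs] at h1
  rw [abs_le] at h0 h1
  constructor <;> rw [abs_le] <;> constructor <;> linarith [h0.1, h0.2, h1.1, h1.2]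

theorem momMap_supp (hu : Nice u C R) {η ζ : ℝ} (h : 2 * R < |η| ∨ R < |ζ|) :
    u (momMap (η, ζ)) = 0 := by
  apply hu.supp
  have := norm_le_momMap η ζ
  rcases h with h | h <;> linarith [this.1, this.2]

theorem comp_momMap (hu : Nice u C R) : Nice (fun z => u (momMap z)) C (2 * |R|) where
  meas := hu.meas.comp measurePreserving_momMap.measurable
  bound _ := hu.bound _
  supp := by
    rintro ⟨η, ζ⟩ h
    apply hu.momMap_supp
    rw [Prod.norm_def, lt_max_iff] at h
    have := le_abs_self R
    have := abs_nonneg R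
    rcases h with h | h
    · left; rw [← Real.norm_eq_abs]; linarith
    · right; rw [← Real.norm_eq_abs]; linarith

theorem slice (hu : Nice u C R) (η : ℝ) : Nice (fun ζ => u (momMap (η, ζ))) C R where
  meas := hu.comp_momMap.meas.comp measurable_prodMk_left
  bound _ := hu.bound _
  supp _ h := hu.momMap_supp (Or.inr h)

/-- The Fourier transform in the relative momentum. -/
def relFourier (u : Plane → ℂ) (η r : ℝ) : ℂ := 𝓕⁻ (fun ζ : ℝ => u (momMap (η, ζ))) r

theorem relFourier_eq (u : Plane → ℂ) (η r : ℝ) : relFourier u η r =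
    ∫ ζ : ℝ, Complex.exp (2 * Real.pi * ζ * r * Complex.I) * u (momMap (η, ζ)) := by
  rw [relFourier, Real.fourierInv_eq']
  refine integral_congr_ae (Eventually.of_forall fun ζ => ?_)
  simp only [RCLike.inner_apply, conj_trivial, smul_eq_mul]
  push_cast
  congr 2
  ring

theorem measurable_relFourier (hu : Nice u C R) :
    Measurable (fun z : ℝ × ℝ => relFourier u z.1 z.2) := by
  simp only [relFourier_eq]
  refine (StronglyMeasurable.integral_prod_right (f := fun (z : ℝ × ℝ) (ζ : ℝ) =>
    Complex.exp (2 * Real.pi * ζ * z.2 * Complex.I) * u (momMap (z.1, ζ))) ?_).measurable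
  refine Measurable.stronglyMeasurable ?_
  refine Measurable.mul ?_ (hu.comp_momMap.meas.comp (by fun_prop))
  refine Complex.measurable_exp.comp ?_
  fun_prop

theorem norm_relFourier_le (hu : Nice u C R) (η r : ℝ) :
    ‖relFourier u η r‖ ≤ C * (2 * |R|) := by
  have hC : 0 ≤ C := (norm_nonneg _).trans (hu.bound 0)
  rw [relFourier_eq]
  have h1 : ∫ ζ : ℝ, Complex.exp (2 * Real.pi * ζ * r * Complex.I) * u (momMap (η, ζ))
      = ∫ ζ in Set.Icc (-|R|) |R|,
        Complex.exp (2 * Real.pi * ζ * r * Complex.I) * u (momMap (η, ζ)) := by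
    symm
    refine setIntegral_eq_integral_of_forall_compl_eq_zero fun ζ hζ => ?_
    rw [hu.momMap_supp, mul_zero]
    right
    by_contra! h
    exact hζ (abs_le.mp (h.trans (le_abs_self R)))
  rw [h1]
  refine (norm_setIntegral_le_of_norm_le_const (C := C) (by simp) fun ζ _ => ?_).trans ?_
  · rw [norm_mul]
    have : ‖Complex.exp (2 * Real.pi * ζ * r * Complex.I)‖ = 1 := by
      rw [show (2 * Real.pi * ζ * r * Complex.I : ℂ) = ((2 * Real.pi * ζ * r : ℝ) : ℂ) * Complex.I
        by push_cast; ring, Complex.norm_exp_ofReal_mul_I]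
    rw [this, one_mul]
    exact hu.bound _
  · simp only [Measure.real, Real.volume_Icc, sub_neg_eq_add]
    rw [ENNReal.toReal_ofReal (by positivity)]
    apply le_of_eq; ring

theorem relFourier_nice (hu : Nice u C R) (r : ℝ) :
    Nice (fun η => relFourier u η r) (C * (2 * |R|)) (2 * R) where
  meas := by
    have h := hu.measurable_relFourier.comp (measurable_id.prodMk (measurable_const (a := r)))
    exact h
  bound η := hu.norm_relFourier_le η r
  supp η h := by
    rw [relFourier_eq]
    refine integral_eq_zero_of_ae (Eventually.of_forall fun ζ => ?_)
    simp only [Pi.zero_apply]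
    rw [hu.momMap_supp (Or.inl h), mul_zero]

/-- The phase splits as ⟨ξ, x⟩ = η Q + ζ r, so Fubini factors the transform into one over the
relative and one over the total momentum. -/
theorem fourierInv_posMap (hu : Nice u C R) (Q r : ℝ) :
    𝓕⁻ u (posMap (Q, r)) = 𝓕⁻ (fun η => relFourier u η r) Q := by
  rw [Real.fourierInv_eq', Real.fourierInv_eq', ← integral_momMap]
  have hint : Integrable (fun z : ℝ × ℝ =>
      Complex.exp (↑(2 * Real.pi * inner ℝ (momMap z) (posMap (Q, r))) * Complex.I) •
        u (momMap z)) (volume.prod volume) := by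
    refine (hu.comp_momMap.integrable (ν := volume)).bdd_mul (c := 1) ?_ ?_
    · refine Measurable.aestronglyMeasurable ?_
      have := measurePreserving_momMap.measurable
      fun_prop
    · refine Eventually.of_forall fun z => ?_
      rw [Complex.norm_exp_ofReal_mul_I]
  rw [Measure.volume_eq_prod, integral_prod _ hint]
  refine integral_congr_ae (Eventually.of_forall fun η => ?_)
  simp only [inner_momMap_posMap, relFourier_eq]
  rw [smul_eq_mul, ← integral_const_mul]
  refine integral_congr_ae (Eventually.of_forall fun ζ => ?_)
  simp only [smul_eq_mul]
  rw [← mul_assoc, ← Complex.exp_add]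
  congr 2
  simp only [RCLike.inner_apply, conj_trivial]
  push_cast
  ring

theorem continuous_fourierInv (hu : Nice u C R) : Continuous (𝓕⁻ u) := by
  rw [Real.fourierInv_eq_fourier_comp_neg]
  exact VectorFourier.fourierIntegral_continuous Real.continuous_fourierChar
    continuous_inner hu.integrable.comp_neg

/-- Plancherel in the centre-of-mass variable at fixed relative position. The potential depends on
`r` alone, so this is what diagonalises it over total momenta. -/
theorem lintegral_slice (hu : Nice u C R) (r : ℝ) :
    ∫⁻ Q, ‖𝓕⁻ u (posMap (Q, r))‖ₑ ^ 2 = ∫⁻ η, ‖relFourier u η r‖ₑ ^ 2 := by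
  simp_rw [hu.fourierInv_posMap]
  exact lintegral_fourierInv_sq (hu.relFourier_nice r).integrable (hu.relFourier_nice r).memLp

theorem measurable_fourierInv_posMap (hu : Nice u C R) :
    Measurable (fun z : ℝ × ℝ => 𝓕⁻ u (posMap z)) :=
  hu.continuous_fourierInv.measurable.comp measurePreserving_posMap.measurable

theorem measurable_fourierInv_slice (hu : Nice u C R) (r : ℝ) :
    Measurable (fun Q : ℝ => 𝓕⁻ u (posMap (Q, r))) :=
  hu.measurable_fourierInv_posMap.comp (measurable_id.prodMk measurable_const)

theorem lintegral_potential (hu : Nice u C R) {F : ℝ → ENNReal} (hF : AEMeasurable F) :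
    ∫⁻ x : Plane, F (x 0 - x 1) * ‖𝓕⁻ u x‖ₑ ^ 2 =
      ∫⁻ r, F r * ∫⁻ η, ‖relFourier u η r‖ₑ ^ 2 := by
  rw [← lintegral_posMap, Measure.volume_eq_prod, lintegral_prod_symm]
  · refine lintegral_congr fun r => ?_
    simp_rw [posMap_diff]
    rw [lintegral_const_mul _ ((hu.measurable_fourierInv_slice r).enorm.pow_const 2)]
    congr 1
    exact hu.lintegral_slice r
  · refine AEMeasurable.mul ?_ (hu.measurable_fourierInv_posMap.enorm.pow_const 2).aemeasurable
    have : (fun z : ℝ × ℝ => F (posMap z 0 - posMap z 1)) = fun z => F z.2 := by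
      funext z; rw [← posMap_diff z.1 z.2]
    rw [this]
    exact hF.comp_quasiMeasurePreserving Measure.quasiMeasurePreserving_snd

/-- The relative transform is bounded and vanishes for |η| > 2R, hence the product of an indicator
in η and |V| in r dominates. -/
theorem integrable_relFourier (hu : Nice u C R) {V : ℝ → ℝ} (hV : Integrable V) :
    Integrable (fun z : ℝ × ℝ => V z.2 * ‖relFourier u z.1 z.2‖ ^ 2) (volume.prod volume) := by
  have h1 : Integrable (Set.indicator (Set.Icc (-(2 * R)) (2 * R)) fun _ : ℝ =>
      (C * (2 * |R|)) ^ 2) := by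
    rw [integrable_indicator_iff measurableSet_Icc]
    exact integrableOn_const (by simp)
  have h2 := h1.mul_prod hV.norm
  refine h2.mono' ?_ (Eventually.of_forall fun z => ?_)
  · exact (hV.aestronglyMeasurable.comp_quasiMeasurePreserving
      Measure.quasiMeasurePreserving_snd).mul
      (hu.measurable_relFourier.norm.pow_const 2).aestronglyMeasurable
  · rw [norm_mul, Real.norm_of_nonneg (sq_nonneg ‖relFourier u z.1 z.2‖), mul_comm]
    refine mul_le_mul_of_nonneg_right ?_ (norm_nonneg _)
    by_cases hz : z.1 ∈ Set.Icc (-(2 * R)) (2 * R)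
    · rw [Set.indicator_of_mem hz]
      gcongr
      exact hu.norm_relFourier_le _ _
    · rw [Set.indicator_of_notMem hz, (hu.relFourier_nice z.2).supp]
      · simp
      · rw [Real.norm_eq_abs]
        by_contra! h
        exact hz (abs_le.mp h)

/-- The potential energy in terms of the fibres of constant total momentum. -/
theorem integral_potential (hu : Nice u C R) {V : ℝ → ℝ} (hV : Integrable V) :
    ∫ x : Plane, V (x 0 - x 1) * ‖𝓕⁻ u x‖ ^ 2 =
      ∫ η, ∫ r, V r * ‖relFourier u η r‖ ^ 2 := by
  have hG := hu.integrable_relFourier hV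
  have hmeas : AEStronglyMeasurable (fun z : ℝ × ℝ => V z.2 * ‖𝓕⁻ u (posMap z)‖ ^ 2)
      (volume.prod volume) :=
    (hV.aestronglyMeasurable.comp_quasiMeasurePreserving
      Measure.quasiMeasurePreserving_snd).mul
      (hu.measurable_fourierInv_posMap.norm.pow_const 2).aestronglyMeasurable
  have hslice : ∀ r, ∫ Q, ‖𝓕⁻ u (posMap (Q, r))‖ ^ 2 = ∫ η, ‖relFourier u η r‖ ^ 2 := by
    intro r
    rw [integral_eq_lintegral_of_nonneg_ae (Eventually.of_forall fun _ => by positivity)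
        ((hu.measurable_fourierInv_slice r).norm.pow_const 2).aestronglyMeasurable,
      integral_eq_lintegral_of_nonneg_ae (Eventually.of_forall fun _ => by positivity)
        ((hu.relFourier_nice r).meas.norm.pow_const 2).aestronglyMeasurable]
    have h := hu.lintegral_slice r
    simp only [ENNReal.ofReal_pow (norm_nonneg _), ofReal_norm]
    rw [h]
  -- Integrability is carried over from the momentum side by Tonelli and the slicewise Plancherel
  -- identity.
  have hint : Integrable (fun z : ℝ × ℝ => V z.2 * ‖𝓕⁻ u (posMap z)‖ ^ 2)
      (volume.prod volume) := by
    refine ⟨hmeas, ?_⟩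
    have h2 := hG.2
    rw [hasFiniteIntegral_iff_enorm] at h2 ⊢
    refine lt_of_le_of_lt (le_of_eq ?_) h2
    rw [lintegral_prod_symm _ hmeas.enorm, lintegral_prod_symm _ hG.aestronglyMeasurable.enorm]
    refine lintegral_congr fun r => ?_
    simp only [enorm_mul, enorm_pow, enorm_norm]
    rw [lintegral_const_mul _ ((hu.measurable_fourierInv_slice r).enorm.pow_const 2),
      lintegral_const_mul _ ((hu.relFourier_nice r).meas.enorm.pow_const 2)]
    congr 1
    exact hu.lintegral_slice r
  rw [← integral_posMap]
  have e1 : ∀ z : ℝ × ℝ, V (posMap z 0 - posMap z 1) * ‖𝓕⁻ u (posMap z)‖ ^ 2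
      = V z.2 * ‖𝓕⁻ u (posMap z)‖ ^ 2 := fun z => by rw [← posMap_diff z.1 z.2]
  simp_rw [e1]
  rw [Measure.volume_eq_prod, integral_prod_symm _ hint,
    integral_integral_swap (f := fun η r => V r * ‖relFourier u η r‖ ^ 2) hG]
  refine integral_congr_ae (Eventually.of_forall fun r => ?_)
  simp only
  rw [integral_const_mul, integral_const_mul, hslice]

end
end Nice
/-! ### Density of nice functions -/

section Density

/-- Truncation of the argument and of the values. -/
def trunc (g : Plane → ℂ) (k : ℕ) : Plane → ℂ :=
  Set.indicator {ξ | ‖ξ‖ ≤ k ∧ ‖g ξ‖ ≤ k} g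

theorem nice_trunc {g : Plane → ℂ} (hg : Measurable g) (k : ℕ) : Nice (trunc g k) k k where
  meas := hg.indicator
    ((measurableSet_le measurable_norm measurable_const).inter
      (measurableSet_le hg.norm measurable_const))
  bound ξ := by
    by_cases h : ξ ∈ {ξ | ‖ξ‖ ≤ k ∧ ‖g ξ‖ ≤ k}
    · rw [trunc, Set.indicator_of_mem h]; exact h.2
    · rw [trunc, Set.indicator_of_notMem h]; simp
  supp ξ h := Set.indicator_of_notMem (fun h' => absurd h'.1 (not_le.mpr h)) _

theorem norm_trunc_le (g : Plane → ℂ) (k : ℕ) (ξ : Plane) : ‖trunc g k ξ‖ ≤ ‖g ξ‖ :=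
  norm_indicator_le_norm_self _ _

theorem trunc_eventually_eq (g : Plane → ℂ) (ξ : Plane) : ∀ᶠ k in atTop, trunc g k ξ = g ξ := by
  obtain ⟨N, hN⟩ := exists_nat_ge (max ‖ξ‖ ‖g ξ‖)
  filter_upwards [eventually_ge_atTop N] with k hk
  have hk' : (N : ℝ) ≤ k := by exact_mod_cast hk
  have hmem : ξ ∈ {ξ | ‖ξ‖ ≤ k ∧ ‖g ξ‖ ≤ k} :=
    ⟨(le_max_left _ _).trans (hN.trans hk'), (le_max_right _ _).trans (hN.trans hk')⟩
  exact Set.indicator_of_mem hmem _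

theorem tendsto_trunc (g : TwoBody) :
    Tendsto (fun k => ((nice_trunc (Lp.stronglyMeasurable g).measurable k).memLp
      (ν := volume)).toLp) atTop (𝓝 g) := by
  set t : ℕ → TwoBody := fun k => ((nice_trunc (Lp.stronglyMeasurable g).measurable k).memLp
      (ν := volume)).toLp with ht
  have hg2 : Integrable (fun ξ : Plane => ‖g ξ‖ ^ 2) :=
    (memLp_two_iff_integrable_sq_norm (Lp.aestronglyMeasurable _)).mp (Lp.memLp g)
  have hsq : ∀ k, ‖t k - g‖ ^ 2 = ∫ ξ, ‖trunc g k ξ - g ξ‖ ^ 2 := by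
    intro k
    rw [← integral_norm_sq_Lp]
    refine integral_congr_ae ?_
    filter_upwards [Lp.coeFn_sub (t k) g, ((nice_trunc (Lp.stronglyMeasurable g).measurable
      k).memLp (ν := volume)).coeFn_toLp] with ξ h1 h2
    rw [h1, Pi.sub_apply, h2]
  have hlim : Tendsto (fun k => ∫ ξ, ‖trunc g k ξ - g ξ‖ ^ 2) atTop
      (𝓝 (∫ _ξ : Plane, (0 : ℝ))) := by
    refine tendsto_integral_of_dominated_convergence (fun ξ => ‖g ξ‖ ^ 2) ?_ hg2 ?_ ?_
    · intro k
      exact (((nice_trunc (Lp.stronglyMeasurable g).measurable k).meas.sub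
        (Lp.stronglyMeasurable g).measurable).norm.pow_const 2).aestronglyMeasurable
    · intro k
      refine Eventually.of_forall fun ξ => ?_
      rw [Real.norm_of_nonneg (by positivity)]
      by_cases h : ξ ∈ {ξ | ‖ξ‖ ≤ k ∧ ‖g ξ‖ ≤ k}
      · rw [trunc, Set.indicator_of_mem h]; simp
      · rw [trunc, Set.indicator_of_notMem h]; simp
    · refine Eventually.of_forall fun ξ => ?_
      refine tendsto_const_nhds.congr' ?_
      filter_upwards [trunc_eventually_eq g ξ] with k hk
      simp [hk]
  simp only [integral_zero, ← hsq] at hlim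
  rw [tendsto_iff_norm_sub_tendsto_zero]
  have h := (Real.continuous_sqrt.tendsto _).comp hlim
  simp only [Real.sqrt_zero] at h
  refine h.congr fun k => ?_
  simp [Function.comp, Real.sqrt_sq (norm_nonneg _)]

/-- A relative form bound extends from nice functions to all of `L²`. -/
theorem relative_bound_of_nice {w : Plane → ℝ} {F : Plane → ENNReal}
    (hw : AEStronglyMeasurable w volume)
    (h : ∀ (u : Plane → ℂ) C R, Nice u C R →
      ∫⁻ x, ‖w x‖ₑ * ‖𝓕⁻ u x‖ₑ ^ 2 ≤ ∫⁻ ξ, F ξ * ‖u ξ‖ₑ ^ 2) (ψ : TwoBody) :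
    ∫⁻ x, ‖w x‖ₑ * ‖ψ x‖ₑ ^ 2 ≤ ∫⁻ ξ, F ξ * ‖(𝓕 ψ : TwoBody) ξ‖ₑ ^ 2 := by
  set g : TwoBody := 𝓕 ψ with hg
  have hgm := (Lp.stronglyMeasurable g).measurable
  set t : ℕ → TwoBody := fun k => ((nice_trunc hgm k).memLp (ν := volume)).toLp with ht
  have hlim : Tendsto (fun k => (𝓕⁻ (t k) : TwoBody)) atTop (𝓝 ψ) := by
    have h1 := ((Lp.fourierTransformₗᵢ Plane ℂ).symm.continuous.tendsto g).comp (tendsto_trunc g)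
    have h2 : (Lp.fourierTransformₗᵢ Plane ℂ).symm g = ψ :=
      (Lp.fourierTransformₗᵢ Plane ℂ).symm_apply_apply ψ
    rw [h2] at h1
    exact h1
  -- Fatou's lemma along an almost everywhere convergent subsequence gives the bound for ψ, since
  -- truncation only decreases the right-hand side.
  obtain ⟨ns, -, hns⟩ := (tendstoInMeasure_of_tendsto_Lp hlim).exists_seq_tendsto_ae
  have hpt : ∀ k, ((𝓕⁻ (t k) : TwoBody) : Plane → ℂ) =ᵐ[volume] 𝓕⁻ (trunc g k) := fun k =>
    coeFn_fourierInv_toLp (nice_trunc hgm k).integrable _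
  have hle : ∀ k, ∫⁻ x, ‖w x‖ₑ * ‖(𝓕⁻ (t (ns k)) : TwoBody) x‖ₑ ^ 2
      ≤ ∫⁻ ξ, F ξ * ‖g ξ‖ₑ ^ 2 := by
    intro k
    calc _ = ∫⁻ x, ‖w x‖ₑ * ‖𝓕⁻ (trunc g (ns k)) x‖ₑ ^ 2 := by
          refine lintegral_congr_ae ?_
          filter_upwards [hpt (ns k)] with x hx
          rw [hx]
      _ ≤ ∫⁻ ξ, F ξ * ‖trunc g (ns k) ξ‖ₑ ^ 2 := h _ _ _ (nice_trunc hgm (ns k))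
      _ ≤ _ := by
          refine lintegral_mono fun ξ => ?_
          gcongr
          exact enorm_le_iff_norm_le.mpr (norm_trunc_le _ _ _)
  calc ∫⁻ x, ‖w x‖ₑ * ‖ψ x‖ₑ ^ 2
      = ∫⁻ x, liminf (fun k => ‖w x‖ₑ * ‖(𝓕⁻ (t (ns k)) : TwoBody) x‖ₑ ^ 2) atTop := by
        refine lintegral_congr_ae ?_
        filter_upwards [hns] with x hx
        have h1 : Tendsto (fun k => ‖w x‖ₑ * ‖(𝓕⁻ (t (ns k)) : TwoBody) x‖ₑ ^ 2) atTop
            (𝓝 (‖w x‖ₑ * ‖ψ x‖ₑ ^ 2)) := by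
          refine ENNReal.Tendsto.const_mul ?_ (Or.inr enorm_ne_top)
          exact ((ENNReal.continuous_pow 2).tendsto _).comp
            ((continuous_enorm.tendsto _).comp hx)
        exact h1.liminf_eq.symm
    _ ≤ liminf (fun k => ∫⁻ x, ‖w x‖ₑ * ‖(𝓕⁻ (t (ns k)) : TwoBody) x‖ₑ ^ 2) atTop := by
        refine lintegral_liminf_le' fun k => ?_
        exact hw.enorm.mul ((Lp.aestronglyMeasurable _).enorm.pow_const 2)
    _ ≤ _ := by
        refine (liminf_le_liminf (Eventually.of_forall hle)).trans ?_
        simp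

end Density

/-! ### Spectral bounds from energies of nice functions -/

namespace FormData

variable {m : Plane → ℝ} {W : ℝ → ℝ} {M : ℝ}

section
variable {u : Plane → ℂ} {C R : ℝ} {v : TwoBody}

/-- The parametrisation v = √(1 + m) u cancels the weight in `J`, so the abstract form at `v` is the
physical energy of the momentum wave function `u`. -/
theorem J_of_nice (D : FormData m W M) (hu : Nice u C R) (hv : (v : Plane → ℂ) =ᵐ[volume]
      fun ξ => (Real.sqrt (1 + m ((2 * Real.pi) • ξ)) : ℂ) * u ξ) :
    D.J v = (𝓕⁻ (hu.memLp (ν := volume)).toLp : TwoBody) := by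
  rw [D.J_apply]
  congr 1
  apply Lp.ext
  filter_upwards [coeFn_mulOp D.meas_rsqrt D.rsqrt_le v, hv,
    (hu.memLp (ν := volume)).coeFn_toLp] with ξ h1 h2 h3
  rw [h1, h2, h3, ← mul_assoc, ← Complex.ofReal_mul,
    inv_mul_cancel₀ (by linarith [D.one_le ((2 * Real.pi) • ξ)])]
  simp

theorem norm_sq_of_eq (D : FormData m W M) {z : ℂ} (ξ : Plane)
    (hz : z = (Real.sqrt (1 + m ((2 * Real.pi) • ξ)) : ℂ) * u ξ) :
    ‖z‖ ^ 2 = (1 + m ((2 * Real.pi) • ξ)) * ‖u ξ‖ ^ 2 := by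
  rw [hz, norm_mul, Complex.norm_real, Real.norm_eq_abs, mul_pow, sq_abs, Real.sq_sqrt]
  linarith [D.nonneg ((2 * Real.pi) • ξ)]

theorem norm_J_sq_of_nice (D : FormData m W M) (hv : (v : Plane → ℂ) =ᵐ[volume]
      fun ξ => (Real.sqrt (1 + m ((2 * Real.pi) • ξ)) : ℂ) * u ξ) :
    ‖D.J v‖ ^ 2 = ∫ ξ, ‖u ξ‖ ^ 2 := by
  rw [D.norm_J_sq]
  refine integral_congr_ae ?_
  filter_upwards [hv] with ξ h2
  have h0 := D.nonneg ((2 * Real.pi) • ξ)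
  rw [D.norm_sq_of_eq ξ h2]
  field_simp

theorem re_inner_A_of_nice (D : FormData m W M) (hu : Nice u C R)
    (hv : (v : Plane → ℂ) =ᵐ[volume]
      fun ξ => (Real.sqrt (1 + m ((2 * Real.pi) • ξ)) : ℂ) * u ξ) :
    (inner ℂ v (D.A v)).re = (∫ ξ : Plane, m ((2 * Real.pi) • ξ) * ‖u ξ‖ ^ 2) -
      ∫ x : Plane, W (x 0 - x 1) * ‖𝓕⁻ u x‖ ^ 2 := by
  rw [D.re_inner_A]
  congr 1
  · refine integral_congr_ae ?_
    filter_upwards [hv] with ξ h2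
    have h0 := D.nonneg ((2 * Real.pi) • ξ)
    rw [D.norm_sq_of_eq ξ h2]
    field_simp
  · refine integral_congr_ae ?_
    rw [D.J_of_nice hu hv]
    filter_upwards [coeFn_fourierInv_toLp hu.integrable (hu.memLp (ν := volume))] with x hx
    rw [hx]

end

/-- A lower bound of the form on nice symmetric functions is a lower bound of the spectrum. -/
theorem le_infSpec (D : FormData m W M) {t₀ : ℝ}
    (h : ∀ (u : Plane → ℂ) C R, Nice u C R → (∀ ξ, u (exchange ξ) = u ξ) →
      Integrable (fun ξ : Plane => m ((2 * Real.pi) • ξ) * ‖u ξ‖ ^ 2) →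
      t₀ * ∫ ξ, ‖u ξ‖ ^ 2 ≤ (∫ ξ : Plane, m ((2 * Real.pi) • ξ) * ‖u ξ‖ ^ 2) -
        ∫ x : Plane, W (x 0 - x 1) * ‖𝓕⁻ u x‖ ^ 2) :
    (t₀ : EReal) ≤ infSpec (formOperator m W) symmetricSubspace := by
  rw [D.formOperator_eq]
  refine le_infSpec_pullbackGraph mem_symmetricSubspace_iff D.J_injective D.J_exchangeOp
    D.A_exchangeOp ?_ (δ := 1 / 2) (C := (M + 1) / 2) (by norm_num) ?_
    (fun v _ => D.coercive v)
  · intro v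
    have h1 : ContinuousLinearMap.adjoint D.J ∘L exchangeOp
        = exchangeOp ∘L ContinuousLinearMap.adjoint D.J := by
      have h2 : exchangeOp ∘L D.J = D.J ∘L exchangeOp := by
        ext1 v; exact (D.J_exchangeOp v).symm
      have h3 := congrArg ContinuousLinearMap.adjoint h2
      rw [ContinuousLinearMap.adjoint_comp, ContinuousLinearMap.adjoint_comp,
        adjoint_exchangeOp] at h3
      exact h3
    exact congrArg (fun T => T v) h1
  · intro v hv
    have hvm := (Lp.stronglyMeasurable v).measurable
    set t : ℕ → TwoBody := fun k => ((nice_trunc hvm k).memLp (ν := volume)).toLp with ht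
    -- Averaging with the exchange makes the truncations symmetric; the limit is still `v` because
    -- `v` is symmetric.
    let s : ℕ → TwoBody := fun k => (1 / 2 : ℂ) • (t k + exchangeOp (t k))
    have hs : Tendsto s atTop (𝓝 v) := by
      have h1 := tendsto_trunc v
      have h2 := (h1.add ((exchangeOp.continuous.tendsto v).comp h1)).const_smul (1 / 2 : ℂ)
      rw [(mem_symmetricSubspace_iff v).mp hv, ← two_smul ℂ v, smul_smul] at h2
      norm_num at h2
      convert! h2 using 2
      simp [s, t]
    have hcl : IsClosed {v : TwoBody | t₀ * ‖D.J v‖ ^ 2 ≤ (inner ℂ v (D.A v)).re} := by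
      refine isClosed_le ?_ ?_
      · exact continuous_const.mul ((continuous_norm.comp D.J.continuous).pow 2)
      · exact Complex.continuous_re.comp (continuous_id.inner D.A.continuous)
    refine hcl.mem_of_tendsto hs (Eventually.of_forall fun k => ?_)
    let w : Plane → ℂ := fun ξ => (1 / 2 : ℂ) * (trunc v k ξ + trunc v k (exchange ξ))
    have hn := nice_trunc hvm k
    have hw : Nice w k k := by
      refine ⟨(hn.meas.add (hn.meas.comp exchange.continuous.measurable)).const_mul _, ?_, ?_⟩
      · intro ξ
        have h1 := norm_add_le (trunc v k ξ) (trunc v k (exchange ξ))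
        have h2 := hn.bound ξ
        have h3 := hn.bound (exchange ξ)
        simp only [w, norm_mul]
        norm_num
        linarith
      · intro ξ hξ
        simp only [w]
        rw [hn.supp ξ hξ, hn.supp (exchange ξ) (by rwa [LinearIsometryEquiv.norm_map])]
        simp
    have hws : ∀ ξ, w (exchange ξ) = w ξ := by
      intro ξ
      simp only [w, exchange_exchange, add_comm]
    have hsw : (s k : Plane → ℂ) =ᵐ[volume] w := by
      have h0 := hn.memLp (ν := volume) |>.coeFn_toLp
      have h4 := exchange.measurePreserving.quasiMeasurePreserving.ae h0
      filter_upwards [Lp.coeFn_smul (1 / 2 : ℂ) (t k + exchangeOp (t k)),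
        Lp.coeFn_add (t k) (exchangeOp (t k)), h0, coeFn_compIsometry exchange (t k), h4]
        with ξ h1 h2 h3 h5 h6
      rw [h1, Pi.smul_apply, h2, Pi.add_apply, h5]
      simp only [t, w]
      rw [h3, h6, smul_eq_mul]
    -- The approximation takes place in the variable J⁻¹ψ. Dividing by √(1 + m) ≥ 1 keeps the
    -- function nice and makes its kinetic energy finite.
    let u : Plane → ℂ := fun ξ => ((Real.sqrt (1 + m ((2 * Real.pi) • ξ)))⁻¹ : ℝ) * w ξ
    have hrm : Measurable fun ξ : Plane => (Real.sqrt (1 + m ((2 * Real.pi) • ξ)))⁻¹ :=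
      (measurable_const.add D.meas_scaled).sqrt.inv
    have hule : ∀ ξ, ‖u ξ‖ ≤ ‖w ξ‖ := fun ξ => by
      simp only [u, norm_mul, Complex.norm_real, Real.norm_eq_abs]
      exact mul_le_of_le_one_left (norm_nonneg _) (D.rsqrt_le ξ)
    have hu : Nice u k k := by
      refine ⟨(Complex.measurable_ofReal.comp hrm).mul hw.meas,
        fun ξ => (hule ξ).trans (hw.bound ξ), fun ξ hξ => ?_⟩
      simp only [u]; rw [hw.supp ξ hξ, mul_zero]
    have hus : ∀ ξ, u (exchange ξ) = u ξ := fun ξ => by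
      simp only [u]; rw [hws, D.symm_scaled]
    have huv : (s k : Plane → ℂ) =ᵐ[volume]
        fun ξ => (Real.sqrt (1 + m ((2 * Real.pi) • ξ)) : ℂ) * u ξ := by
      filter_upwards [hsw] with ξ hξ
      rw [hξ]
      simp only [u]
      rw [← mul_assoc, ← Complex.ofReal_mul,
        mul_inv_cancel₀ (by linarith [D.one_le ((2 * Real.pi) • ξ)])]
      simp
    have hui : Integrable (fun ξ : Plane => m ((2 * Real.pi) • ξ) * ‖u ξ‖ ^ 2) := by
      have h1 := (memLp_two_iff_integrable_sq_norm hw.meas.aestronglyMeasurable).mp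
        (hw.memLp (ν := volume))
      refine h1.mono' (D.meas_scaled.mul (hu.meas.norm.pow_const 2)).aestronglyMeasurable
        (Eventually.of_forall fun ξ => ?_)
      have h0 := D.nonneg ((2 * Real.pi) • ξ)
      rw [Real.norm_of_nonneg (by positivity)]
      simp only [u, norm_mul, Complex.norm_real, Real.norm_eq_abs, mul_pow, sq_abs]
      rw [D.rsqrt_sq, ← mul_assoc]
      refine mul_le_of_le_one_left (by positivity) ?_
      rw [mul_one_div, div_le_one (by positivity)]
      linarith
    change t₀ * ‖D.J (s k)‖ ^ 2 ≤ (inner ℂ (s k) (D.A (s k))).re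
    rw [D.norm_J_sq_of_nice huv, D.re_inner_A_of_nice hu huv]
    exact h u k k hu hus hui

/-- A nice symmetric function with negative energy forces negative spectrum. -/
theorem infSpec_neg (D : FormData m W M) {u : Plane → ℂ} {C R : ℝ} (hu : Nice u C R)
    (hus : ∀ ξ, u (exchange ξ) = u ξ)
    (hui : Integrable (fun ξ : Plane => m ((2 * Real.pi) • ξ) * ‖u ξ‖ ^ 2))
    (hneg : (∫ ξ : Plane, m ((2 * Real.pi) • ξ) * ‖u ξ‖ ^ 2) -
        ∫ x : Plane, W (x 0 - x 1) * ‖𝓕⁻ u x‖ ^ 2 < 0) :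
    infSpec (formOperator m W) symmetricSubspace < 0 := by
  rw [D.formOperator_eq]
  have hm : AEStronglyMeasurable (fun ξ : Plane =>
      (Real.sqrt (1 + m ((2 * Real.pi) • ξ)) : ℂ) * u ξ) volume :=
    ((Complex.measurable_ofReal.comp (measurable_const.add D.meas_scaled).sqrt).mul
      hu.meas).aestronglyMeasurable
  have hL : MemLp (fun ξ : Plane =>
      (Real.sqrt (1 + m ((2 * Real.pi) • ξ)) : ℂ) * u ξ) 2 volume := by
    rw [memLp_two_iff_integrable_sq_norm hm]
    have h1 := (memLp_two_iff_integrable_sq_norm hu.meas.aestronglyMeasurable).mp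
        (hu.memLp (ν := volume))
    refine (h1.add hui).congr (Eventually.of_forall fun ξ => ?_)
    simp only [Pi.add_apply]
    rw [D.norm_sq_of_eq (u := u) ξ rfl]
    ring
  have hv := hL.coeFn_toLp
  have hJS : D.J hL.toLp ∈ symmetricSubspace := by
    rw [mem_symmetricSubspace_iff, ← D.J_exchangeOp]
    congr 1
    apply Lp.ext
    have h4 := exchange.measurePreserving.quasiMeasurePreserving.ae hv
    filter_upwards [coeFn_compIsometry exchange hL.toLp, hv, h4] with ξ h1 h2 h3
    rw [h1, h2, h3, hus, D.symm_scaled]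
  refine infSpec_pullbackGraph_neg (C := (M + 1) / 2) ?_ D.J_injective D.inner_A_left ?_ hJS ?_
  · intro v hv
    rw [mem_symmetricSubspace_iff] at hv ⊢
    apply D.J_injective
    rw [D.J_exchangeOp, hv]
  · intro v _
    have := D.coercive v
    nlinarith [sq_nonneg ‖v‖]
  · rw [D.re_inner_A_of_nice hu hv]
    exact hneg

end FormData
/-! ### One-dimensional estimates in the relative coordinate -/

section Fibre

/-- Weighted Cauchy–Schwarz inequality. -/
theorem sq_integral_le_mul {α : Type*} [MeasurableSpace α] {ν : Measure α} {g ω : α → ℝ}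
    (hg : ∀ x, 0 ≤ g x) (hgm : AEStronglyMeasurable g ν)
    (hω : ∀ x, 0 < ω x) (hωi : Integrable ω ν) (hi : Integrable (fun x => g x ^ 2 / ω x) ν) :
    Integrable g ν ∧ (∫ x, g x ∂ν) ^ 2 ≤ (∫ x, ω x ∂ν) * ∫ x, g x ^ 2 / ω x ∂ν := by
  -- AM–GM with a free parameter; s = 1 gives integrability of `g`, and s = N/I the inequality. If I
  -- = 0, a large s contradicts N > 0.
  have hpt : ∀ s : ℝ, 0 < s → ∀ x, g x ≤ (g x ^ 2 / ω x) * (1 / (2 * s)) + s / 2 * ω x := by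
    intro s hs x
    have h1 := hω x
    have : (g x ^ 2 / ω x) * (1 / (2 * s)) + s / 2 * ω x - g x
        = (g x - s * ω x) ^ 2 / (2 * s * ω x) := by
      field_simp; ring
    have h2 : 0 ≤ (g x - s * ω x) ^ 2 / (2 * s * ω x) := by positivity
    linarith
  have hgi : Integrable g ν := by
    refine ((hi.mul_const (1 / (2 * 1))).add (hωi.const_mul (1 / 2))).mono' hgm
      (Eventually.of_forall fun x => ?_)
    rw [Real.norm_of_nonneg (hg x)]
    exact hpt 1 one_pos x
  refine ⟨hgi, ?_⟩
  set N := ∫ x, g x ∂ν with hN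
  set I := ∫ x, ω x ∂ν with hI
  set B := ∫ x, g x ^ 2 / ω x ∂ν with hB
  have hN0 : 0 ≤ N := integral_nonneg hg
  have hI0 : 0 ≤ I := integral_nonneg fun x => (hω x).le
  have hB0 : 0 ≤ B := integral_nonneg fun x => div_nonneg (sq_nonneg _) (hω x).le
  have hs : ∀ s : ℝ, 0 < s → N ≤ B * (1 / (2 * s)) + s / 2 * I := by
    intro s hs
    rw [hN, hB, hI, ← integral_mul_const, ← integral_const_mul,
      ← integral_add (hi.mul_const _) (hωi.const_mul _)]
    exact integral_mono hgi ((hi.mul_const _).add (hωi.const_mul _)) (hpt s hs)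
  rcases hN0.eq_or_lt with h0 | h0
  · rw [← h0]; simpa using mul_nonneg hI0 hB0
  rcases hI0.eq_or_lt with h1 | h1
  · exfalso
    rw [← h1] at hs
    have := hs ((B + 1) / N) (by positivity)
    rw [mul_zero, add_zero, mul_one_div, le_div_iff₀ (by positivity)] at this
    have e : N * (2 * ((B + 1) / N)) = 2 * (B + 1) := by field_simp
    linarith
  · have := hs (N / I) (by positivity)
    have e : B * (1 / (2 * (N / I))) + N / I / 2 * I = (B * I) / (2 * N) + N / 2 := by
      field_simp
    rw [e] at this
    have h2 : N / 2 ≤ (B * I) / (2 * N) := by linarith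
    rw [le_div_iff₀ (by positivity)] at h2
    nlinarith

/-- The distance of the relative momentum `2 π ζ` to the pair of points `±κ`, cut off at `1`. -/
def cutDist (κ ζ : ℝ) : ℝ := min 1 |2 * Real.pi * |ζ| - κ|

theorem cutDist_nonneg (κ ζ : ℝ) : 0 ≤ cutDist κ ζ := le_min zero_le_one (abs_nonneg _)

theorem cutDist_le_one (κ ζ : ℝ) : cutDist κ ζ ≤ 1 := min_le_left _ _

theorem continuous_cutDist (κ : ℝ) : Continuous (cutDist κ) := by
  unfold cutDist; fun_prop

/-- The cosine is bounded and 1-Lipschitz, which matches the two entries of the minimum in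
`cutDist`; being even, it only sees |ζ|. -/
theorem abs_cos_sub_cos_le (κ ζ r : ℝ) :
    |Real.cos (2 * Real.pi * ζ * r) - Real.cos (κ * r)| ≤ 2 * (1 + |r|) * cutDist κ ζ := by
  have h1 : |Real.cos (2 * Real.pi * ζ * r) - Real.cos (κ * r)| ≤ 2 := by
    rw [abs_le]
    constructor <;> linarith [Real.cos_le_one (2 * Real.pi * ζ * r), Real.cos_le_one (κ * r),
      Real.neg_one_le_cos (2 * Real.pi * ζ * r), Real.neg_one_le_cos (κ * r)]
  have h2 : |Real.cos (2 * Real.pi * ζ * r) - Real.cos (κ * r)|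
      ≤ |r| * |2 * Real.pi * |ζ| - κ| := by
    have e : Real.cos (2 * Real.pi * ζ * r) = Real.cos (2 * Real.pi * |ζ| * r) := by
      rcases abs_choice ζ with h | h
      · rw [h]
      · rw [h, ← Real.cos_neg]; congr 1; ring
    have h3 : LipschitzWith 1 Real.cos := Real.lipschitzWith_cos
    have h4 := h3.dist_le_mul (2 * Real.pi * |ζ| * r) (κ * r)
    rw [e]
    simp only [Real.dist_eq, NNReal.coe_one, one_mul] at h4
    refine h4.trans (le_of_eq ?_)
    rw [← abs_mul]; congr 1; ring
  have hr := abs_nonneg r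
  rw [cutDist]
  rcases min_cases 1 |2 * Real.pi * |ζ| - κ| with ⟨h, _⟩ | ⟨h, _⟩
  · rw [h]; linarith
  · rw [h]
    nlinarith [abs_nonneg (2 * Real.pi * |ζ| - κ)]

theorem fourierInv_even {f : ℝ → ℂ} {C R : ℝ} (hf : Nice f C R) (hev : ∀ ζ, f (-ζ) = f ζ)
    (r : ℝ) : 𝓕⁻ f r = ∫ ζ, (Real.cos (2 * Real.pi * ζ * r) : ℂ) * f ζ := by
  have hfi := hf.integrable (ν := volume)
  have e1 : ∀ g : ℝ → ℝ, Continuous g →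
      Integrable (fun ζ => Complex.exp ((g ζ : ℝ) * Complex.I) * f ζ) := by
    intro g hg
    refine hfi.bdd_mul (c := 1) (by fun_prop) (Eventually.of_forall fun ζ => ?_)
    rw [Complex.norm_exp_ofReal_mul_I]
  have h1 : 𝓕⁻ f r = ∫ ζ, Complex.exp ((2 * Real.pi * ζ * r : ℝ) * Complex.I) * f ζ := by
    rw [Real.fourierInv_eq']
    refine integral_congr_ae (Eventually.of_forall fun ζ => ?_)
    simp only [RCLike.inner_apply, conj_trivial, smul_eq_mul]
    congr 4
    ring
  have h2 : 𝓕⁻ f r = ∫ ζ, Complex.exp ((-(2 * Real.pi * ζ * r) : ℝ) * Complex.I) * f ζ := by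
    rw [h1, ← integral_neg_eq_self]
    refine integral_congr_ae (Eventually.of_forall fun ζ => ?_)
    simp only [hev]
    congr 4
    ring
  have h3 : 𝓕⁻ f r = (1 / 2 : ℂ) * (𝓕⁻ f r + 𝓕⁻ f r) := by ring
  rw [h3]
  nth_rewrite 1 [h1]
  rw [h2, ← integral_add (e1 _ (by fun_prop)) (e1 _ (by fun_prop)), ← integral_const_mul]
  refine integral_congr_ae (Eventually.of_forall fun ζ => ?_)
  simp only [Complex.ofReal_cos, Complex.cos, Complex.ofReal_neg]
  ring

theorem integrable_cutDist_mul {f : ℝ → ℝ} (hf : Integrable f) (κ : ℝ) :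
    Integrable fun ζ => cutDist κ ζ * f ζ :=
  hf.bdd_mul (c := 1) (continuous_cutDist κ).aestronglyMeasurable
    (Eventually.of_forall fun ζ => by
      rw [Real.norm_of_nonneg (cutDist_nonneg _ _)]; exact cutDist_le_one _ _)

/-- The relative wave function is a multiple of `cos (κ r)` up to an error controlled by the
momentum distribution away from `±κ`. -/
theorem norm_fourierInv_sub_le {f : ℝ → ℂ} {C R : ℝ} (hf : Nice f C R)
    (hev : ∀ ζ, f (-ζ) = f ζ) (κ r : ℝ) :
    ‖𝓕⁻ f r - (∫ ζ, f ζ) * (Real.cos (κ * r) : ℂ)‖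
      ≤ 2 * (1 + |r|) * ∫ ζ, cutDist κ ζ * ‖f ζ‖ := by
  have hfi := hf.integrable (ν := volume)
  have hci : Integrable fun ζ => (Real.cos (2 * Real.pi * ζ * r) : ℂ) * f ζ := by
    refine hfi.bdd_mul (c := 1) (by fun_prop) (Eventually.of_forall fun ζ => ?_)
    rw [Complex.norm_real]
    exact Real.abs_cos_le_one _
  rw [fourierInv_even hf hev, ← integral_mul_const, ← integral_sub hci (hfi.mul_const _),
    ← integral_const_mul]
  refine norm_integral_le_of_norm_le ((integrable_cutDist_mul hfi.norm κ).const_mul _)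
    (Eventually.of_forall fun ζ => ?_)
  have e : (Real.cos (2 * Real.pi * ζ * r) : ℂ) * f ζ - f ζ * (Real.cos (κ * r) : ℂ)
      = ((Real.cos (2 * Real.pi * ζ * r) - Real.cos (κ * r) : ℝ) : ℂ) * f ζ := by
    push_cast; ring
  rw [e, norm_mul, Complex.norm_real, Real.norm_eq_abs, ← mul_assoc]
  gcongr
  exact abs_cos_sub_cos_le κ ζ r

variable {V : ℝ → ℝ}

/-- A moment of the potential bounding all error terms. -/
def errMoment (V : ℝ → ℝ) : ℝ := ∫ r, 4 * (1 + |r|) ^ 2 * |V r|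

theorem errMoment_nonneg (V : ℝ → ℝ) : 0 ≤ errMoment V :=
  integral_nonneg fun r => by positivity

/-- The moment `∫ V(r) cos² (κ r) dr`. -/
def cosMoment (V : ℝ → ℝ) (κ : ℝ) : ℝ := ∫ r, V r * Real.cos (κ * r) ^ 2

theorem aestronglyMeasurable_of_moment
    (hV : Integrable (fun r : ℝ => (1 + |r| ^ 2) * V r)) : AEStronglyMeasurable V := by
  have h1 : V = fun r => (1 + |r| ^ 2)⁻¹ * ((1 + |r| ^ 2) * V r) := by
    funext r
    rw [← mul_assoc, inv_mul_cancel₀ (by positivity), one_mul]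
  rw [h1]
  have hc : Continuous fun r : ℝ => (1 + |r| ^ 2)⁻¹ :=
    Continuous.inv₀ (by fun_prop) fun r => by positivity
  exact hc.aestronglyMeasurable.mul hV.aestronglyMeasurable

theorem integrable_errMoment (hV : Integrable (fun r : ℝ => (1 + |r| ^ 2) * V r)) :
    Integrable fun r => 4 * (1 + |r|) ^ 2 * |V r| := by
  have hm := aestronglyMeasurable_of_moment hV
  have hc : Continuous fun r : ℝ => 4 * (1 + |r|) ^ 2 := by fun_prop
  refine (hV.norm.const_mul 8).mono' (hc.aestronglyMeasurable.mul hm.norm)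
    (Eventually.of_forall fun r => ?_)
  rw [Real.norm_of_nonneg (by positivity), norm_mul, Real.norm_of_nonneg (by positivity),
    Real.norm_eq_abs, ← mul_assoc]
  refine mul_le_mul_of_nonneg_right ?_ (abs_nonneg _)
  nlinarith [sq_nonneg (|r| - 1)]

theorem integrable_of_moment (hV : Integrable (fun r : ℝ => (1 + |r| ^ 2) * V r)) :
    Integrable V := by
  refine (integrable_errMoment hV).mono' (aestronglyMeasurable_of_moment hV)
    (Eventually.of_forall fun r => ?_)
  rw [Real.norm_eq_abs]
  refine le_mul_of_one_le_left (abs_nonneg _) ?_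
  nlinarith [abs_nonneg r, sq_nonneg |r|]

theorem integrable_cosMoment (hV : Integrable (fun r : ℝ => (1 + |r| ^ 2) * V r)) (κ : ℝ) :
    Integrable fun r => V r * Real.cos (κ * r) ^ 2 := by
  refine (integrable_of_moment hV).mul_bdd (c := 1)
    (by fun_prop) (Eventually.of_forall fun r => ?_)
  rw [Real.norm_of_nonneg (by positivity)]
  exact Real.cos_sq_le_one _

theorem measurable_fourierInv_nice {f : ℝ → ℂ} {C R : ℝ} (hf : Nice f C R) :
    Continuous (𝓕⁻ f) := by
  rw [Real.fourierInv_eq_fourier_comp_neg]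
  exact VectorFourier.fourierIntegral_continuous Real.continuous_fourierChar
    continuous_inner (hf.integrable (ν := volume)).comp_neg

theorem norm_fourierInv_le {f : ℝ → ℂ} (r : ℝ) :
    ‖𝓕⁻ f r‖ ≤ ∫ ζ, ‖f ζ‖ := by
  rw [Real.fourierInv_eq']
  refine (norm_integral_le_integral_norm _).trans (le_of_eq ?_)
  refine integral_congr_ae (Eventually.of_forall fun ζ => ?_)
  simp only [norm_smul, Complex.norm_exp_ofReal_mul_I, one_mul]

theorem integrable_mul_fourierInv_sq {f : ℝ → ℂ} {C R : ℝ} (hf : Nice f C R)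
    (hV : Integrable V) : Integrable fun r => V r * ‖𝓕⁻ f r‖ ^ 2 := by
  refine hV.mul_bdd (c := (∫ ζ, ‖f ζ‖) ^ 2)
    ((measurable_fourierInv_nice hf).norm.pow 2).aestronglyMeasurable
    (Eventually.of_forall fun r => ?_)
  rw [Real.norm_of_nonneg (by positivity)]
  gcongr
  exact norm_fourierInv_le r

/-- The potential energy of a relative wave function in terms of its mass `∫ f` and its momentum
distribution away from `±κ`. -/
theorem abs_potential_sub_le (hV : Integrable (fun r : ℝ => (1 + |r| ^ 2) * V r))
    {f : ℝ → ℂ} {C R : ℝ} (hf : Nice f C R) (hev : ∀ ζ, f (-ζ) = f ζ) {κ q : ℝ}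
    (hq : ∫ ζ, cutDist κ ζ * ‖f ζ‖ ≤ q) :
    |(∫ r, V r * ‖𝓕⁻ f r‖ ^ 2) - ‖∫ ζ, f ζ‖ ^ 2 * cosMoment V κ|
      ≤ errMoment V * (‖∫ ζ, f ζ‖ * q + q ^ 2) := by
  set z := ∫ ζ, f ζ with hz
  have hq0 : 0 ≤ q := le_trans
    (integral_nonneg fun ζ => mul_nonneg (cutDist_nonneg _ _) (norm_nonneg _)) hq
  have hVi := integrable_of_moment hV
  rw [cosMoment, ← integral_const_mul, ← integral_sub (integrable_mul_fourierInv_sq hf hVi)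
    ((integrable_cosMoment hV κ).const_mul _), errMoment, ← integral_mul_const,
    ← Real.norm_eq_abs]
  refine norm_integral_le_of_norm_le ((integrable_errMoment hV).mul_const _)
    (Eventually.of_forall fun r => ?_)
  have hr := abs_nonneg r
  set e := 𝓕⁻ f r - z * (Real.cos (κ * r) : ℂ) with he
  have heb : ‖e‖ ≤ 2 * (1 + |r|) * q :=
    (norm_fourierInv_sub_le hf hev κ r).trans (by gcongr)
  have hG : 𝓕⁻ f r = z * (Real.cos (κ * r) : ℂ) + e := by rw [he]; ring
  have hzc : ‖z * (Real.cos (κ * r) : ℂ)‖ ≤ ‖z‖ := by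
    rw [norm_mul, Complex.norm_real]
    exact mul_le_of_le_one_right (norm_nonneg _) (Real.abs_cos_le_one _)
  have hzc2 : ‖z * (Real.cos (κ * r) : ℂ)‖ ^ 2 = ‖z‖ ^ 2 * Real.cos (κ * r) ^ 2 := by
    rw [norm_mul, mul_pow, Complex.norm_real, Real.norm_eq_abs, sq_abs]
  have hdiff : |‖𝓕⁻ f r‖ ^ 2 - ‖z‖ ^ 2 * Real.cos (κ * r) ^ 2| ≤ 2 * ‖z‖ * ‖e‖ + ‖e‖ ^ 2 := by
    rw [hG, ← hzc2]
    set y := z * (Real.cos (κ * r) : ℂ) with hy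
    have h1 := norm_add_le y e
    have h2 : ‖y‖ ≤ ‖y + e‖ + ‖e‖ := by
      have := norm_sub_le (y + e) e
      simpa using this
    have h3 := norm_nonneg (y + e)
    have h4 := norm_nonneg y
    have h5 := norm_nonneg e
    have h6 : (‖y + e‖ - ‖y‖) ≤ ‖e‖ := by linarith
    have h7 : -‖e‖ ≤ (‖y + e‖ - ‖y‖) := by linarith
    have h8 : ‖y + e‖ ^ 2 - ‖y‖ ^ 2 = (‖y + e‖ - ‖y‖) * (‖y + e‖ + ‖y‖) := by ring
    rw [abs_le, h8]
    constructor
    · nlinarith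
    · nlinarith
  have e1 : V r * ‖𝓕⁻ f r‖ ^ 2 - ‖z‖ ^ 2 * (V r * Real.cos (κ * r) ^ 2)
      = V r * (‖𝓕⁻ f r‖ ^ 2 - ‖z‖ ^ 2 * Real.cos (κ * r) ^ 2) := by ring
  rw [e1, norm_mul, Real.norm_eq_abs, Real.norm_eq_abs]
  have hz0 := norm_nonneg z
  -- The square of ‖e‖ ≤ 2(1 + |r|) q is what requires a second moment of V.
  have h9 : 2 * ‖z‖ * ‖e‖ + ‖e‖ ^ 2 ≤ 4 * (1 + |r|) ^ 2 * (‖z‖ * q + q ^ 2) := by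
    have h10 : ‖e‖ ^ 2 ≤ (2 * (1 + |r|) * q) ^ 2 := by gcongr
    have h11 : 2 * ‖z‖ * ‖e‖ ≤ 2 * ‖z‖ * (2 * (1 + |r|) * q) := by gcongr
    have h12 : 0 ≤ ‖z‖ * q := by positivity
    nlinarith [mul_nonneg h12 hr, mul_nonneg (mul_nonneg h12 hr) hr]
  calc |V r| * |‖𝓕⁻ f r‖ ^ 2 - ‖z‖ ^ 2 * Real.cos (κ * r) ^ 2|
      ≤ |V r| * (4 * (1 + |r|) ^ 2 * (‖z‖ * q + q ^ 2)) := by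
        gcongr
        exact hdiff.trans h9
    _ = _ := by ring

/-- The arithmetic of `potential_le_of_weight`, where x² I is the energy along the weight and N2
that of the remainder. The cross term l v x I K is split by AM–GM: half of N2 absorbs one part, and
l e I ≤ 1 turns the other into the correction v² C₁/(2e). The other half of N2 absorbs K² because 4
l v C₁ ≤ 1. The remaining error terms make up 3 v C₁. -/
theorem weighted_arith {x I c₁ K N2 C₁ e l v : ℝ} (he : 0 < e) (hC₁ : 0 < C₁) (hl : 0 < l)
    (hv0 : 0 ≤ v) (hIpos : 0 < I) (hc₁0 : 0 ≤ c₁) (hωd : c₁ ≤ C₁) (hc₁I : c₁ ≤ I)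
    (hK2 : K ^ 2 ≤ C₁ * N2) (hl1 : 4 * l * v * C₁ ≤ 1)
    (hl2 : l * (e * I) + l * (3 * v * C₁ + v ^ 2 * C₁ / (2 * e)) ≤ 1) :
    l * (x ^ 2 * I ^ 2 * e + v * (x * I * (x * c₁ + K) + (x * c₁ + K) ^ 2)) ≤
      x ^ 2 * I + N2 := by
  have t2 : l * v * x * I * K ≤ 1 / 2 * (l * v * x * I) ^ 2 * C₁ + N2 / 2 := by
    have h1 : 0 ≤ (l * v * x * I * C₁ - K) ^ 2 := sq_nonneg _
    have h2 : C₁ * (l * v * x * I * K) ≤ C₁ * (1 / 2 * (l * v * x * I) ^ 2 * C₁ + N2 / 2) := by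
      linarith
    exact le_of_mul_le_mul_left h2 hC₁
  have t3 : l * v * (x * c₁ + K) ^ 2 ≤ 2 * l * v * C₁ * (x ^ 2 * I) + N2 / 2 := by
    have h1 : (x * c₁ + K) ^ 2 ≤ 2 * (x * c₁) ^ 2 + 2 * K ^ 2 := by nlinarith [sq_nonneg (x * c₁ - K)]
    have h2 : (x * c₁) ^ 2 ≤ C₁ * (x ^ 2 * I) := by
      have : c₁ ^ 2 ≤ C₁ * I := by nlinarith
      calc (x * c₁) ^ 2 = x ^ 2 * c₁ ^ 2 := by ring
        _ ≤ x ^ 2 * (C₁ * I) := by gcongr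
        _ = _ := by ring
    have hlv : 0 ≤ l * v := by positivity
    have h3 : l * v * (x * c₁ + K) ^ 2 ≤ l * v * (2 * (C₁ * (x ^ 2 * I)) + 2 * (C₁ * N2)) := by
      apply mul_le_mul_of_nonneg_left _ hlv
      linarith
    have h4 : 2 * (l * v * C₁) * N2 ≤ N2 / 2 := by nlinarith
    linarith
  have t4 : 1 / 2 * (l * v * x * I) ^ 2 * C₁ ≤ x ^ 2 * I * (l * (v ^ 2 * C₁ / (2 * e))) := by
    have h1 : l * (e * I) ≤ 1 := by
      have : 0 ≤ l * (3 * v * C₁ + v ^ 2 * C₁ / (2 * e)) := by positivity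
      linarith
    have e1 : x ^ 2 * I * (l * (v ^ 2 * C₁ / (2 * e))) - 1 / 2 * (l * v * x * I) ^ 2 * C₁
        = x ^ 2 * I * l * v ^ 2 * C₁ / (2 * e) * (1 - l * (e * I)) := by
      field_simp
    have h2 : 0 ≤ x ^ 2 * I * l * v ^ 2 * C₁ / (2 * e) * (1 - l * (e * I)) :=
      mul_nonneg (by positivity) (by linarith)
    linarith
  have t5 : l * v * x ^ 2 * I * c₁ ≤ l * v * C₁ * (x ^ 2 * I) := by
    have : 0 ≤ l * v * x ^ 2 * I := by positivity
    nlinarith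
  have t6 : x ^ 2 * I * (l * (e * I) + l * (3 * v * C₁ + v ^ 2 * C₁ / (2 * e))) ≤ x ^ 2 * I * 1 :=
    mul_le_mul_of_nonneg_left hl2 (by positivity)
  have e7 : l * (x ^ 2 * I ^ 2 * e + v * (x * I * (x * c₁ + K) + (x * c₁ + K) ^ 2))
      = x ^ 2 * I * (l * (e * I)) + l * v * x ^ 2 * I * c₁ + l * v * x * I * K
        + l * v * (x * c₁ + K) ^ 2 := by ring
  rw [e7]
  linarith

/-- Upper bound on the potential energy by the energy of a weight with a singularity at `±κ`. -/
theorem potential_le_of_weight (hV : Integrable (fun r : ℝ => (1 + |r| ^ 2) * V r))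
    {f : ℝ → ℂ} {C R : ℝ} (hf : Nice f C R) (hev : ∀ ζ, f (-ζ) = f ζ) {ω : ℝ → ℝ}
    (hω : ∀ ζ, 0 < ω ζ) (hωi : Integrable ω) (hfω : Integrable fun ζ => ‖f ζ‖ ^ 2 / ω ζ)
    {κ e C₁ l : ℝ} (he : 0 < e) (hcos : cosMoment V κ ≤ e) (hC₁ : 0 < C₁)
    (hωd : ∫ ζ, cutDist κ ζ * ω ζ ≤ C₁) (hl : 0 < l) (hl1 : 4 * l * errMoment V * C₁ ≤ 1)
    (hl2 : l * (e * ∫ ζ, ω ζ) +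
      l * (3 * errMoment V * C₁ + errMoment V ^ 2 * C₁ / (2 * e)) ≤ 1) :
    l * ∫ r, V r * ‖𝓕⁻ f r‖ ^ 2 ≤ ∫ ζ, ‖f ζ‖ ^ 2 / ω ζ := by
  set v := errMoment V with hv
  have hv0 : 0 ≤ v := errMoment_nonneg V
  set I := ∫ ζ, ω ζ with hI
  have hIpos : 0 < I := by
    rw [hI, integral_pos_iff_support_of_nonneg (fun ζ => (hω ζ).le) hωi]
    have : Function.support ω = Set.univ := by
      ext ζ; simp [(hω ζ).ne']
    rw [this]; simp
  have hfi := hf.integrable (ν := volume)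
  set z := ∫ ζ, f ζ with hz
  -- f = aω + f₁ with ∫ f₁ = 0 is the orthogonal decomposition for the inner product with density
  -- 1/ω. The cross term is a multiple of ∫ f₁, so the energies add.
  set a : ℂ := z / (I : ℂ) with ha
  have hIC : (I : ℂ) ≠ 0 := Complex.ofReal_ne_zero.mpr hIpos.ne'
  have hza : ‖z‖ = ‖a‖ * I := by
    rw [ha, norm_div, Complex.norm_real, Real.norm_of_nonneg hIpos.le,
      div_mul_cancel₀ _ hIpos.ne']
  let f₁ : ℝ → ℂ := fun ζ => f ζ - a * (ω ζ : ℂ)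
  have hωCi : Integrable fun ζ => (ω ζ : ℂ) := hωi.ofReal
  have hf₁i : Integrable f₁ := hfi.sub (hωCi.const_mul a)
  have hf₁0 : ∫ ζ, f₁ ζ = 0 := by
    simp only [f₁]
    rw [integral_sub hfi (hωCi.const_mul a), integral_const_mul, integral_complex_ofReal,
      ← hI, ← hz, ha]
    field_simp
    ring
  have hexp : ∀ ζ, ‖f₁ ζ‖ ^ 2 / ω ζ = ‖f ζ‖ ^ 2 / ω ζ - ‖a‖ ^ 2 * ω ζ
      - 2 * (conj a * f₁ ζ).re := by
    intro ζ
    have h1 : ‖f ζ‖ ^ 2 = ‖f₁ ζ‖ ^ 2 + ‖a‖ ^ 2 * ω ζ ^ 2 + 2 * ω ζ * (conj a * f₁ ζ).re := by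
      have e1 : f ζ = f₁ ζ + a * (ω ζ : ℂ) := by simp only [f₁]; ring
      rw [e1, ← Complex.normSq_eq_norm_sq, ← Complex.normSq_eq_norm_sq,
        ← Complex.normSq_eq_norm_sq]
      simp only [Complex.normSq_apply, Complex.add_re, Complex.add_im, Complex.mul_re,
        Complex.mul_im, Complex.ofReal_re, Complex.ofReal_im, Complex.conj_re, Complex.conj_im]
      ring
    have h2 := hω ζ
    rw [h1]
    field_simp
    ring
  have hcr : Integrable fun ζ => (conj a * f₁ ζ).re := (hf₁i.const_mul _).re
  have hf₁ω : Integrable fun ζ => ‖f₁ ζ‖ ^ 2 / ω ζ := by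
    simp_rw [hexp]
    exact (hfω.sub (hωi.const_mul _)).sub (hcr.const_mul 2)
  set N2 := ∫ ζ, ‖f₁ ζ‖ ^ 2 / ω ζ with hN2
  have hN20 : 0 ≤ N2 := integral_nonneg fun ζ => div_nonneg (sq_nonneg _) (hω ζ).le
  have hsplit : ∫ ζ, ‖f ζ‖ ^ 2 / ω ζ = ‖a‖ ^ 2 * I + N2 := by
    have hre : ∫ ζ, (conj a * f₁ ζ).re = 0 := by
      have h1 := integral_re (hf₁i.const_mul (conj a))
      rw [integral_const_mul, hf₁0, mul_zero] at h1
      simpa using h1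
    have h2 : N2 = (∫ ζ, ‖f ζ‖ ^ 2 / ω ζ - ‖a‖ ^ 2 * ω ζ)
        - ∫ ζ, 2 * (conj a * f₁ ζ).re := by
      have h3 : Integrable fun ζ => ‖f ζ‖ ^ 2 / ω ζ - ‖a‖ ^ 2 * ω ζ :=
        hfω.sub (hωi.const_mul _)
      rw [hN2, ← integral_sub h3 (hcr.const_mul 2)]
      exact integral_congr_ae (Eventually.of_forall hexp)
    rw [h2, integral_sub hfω (hωi.const_mul _), integral_const_mul, integral_const_mul, hre]
    ring
  set c₁ := ∫ ζ, cutDist κ ζ * ω ζ with hc₁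
  have hcωi := integrable_cutDist_mul hωi κ
  have hc₁0 : 0 ≤ c₁ := integral_nonneg fun ζ => mul_nonneg (cutDist_nonneg _ _) (hω ζ).le
  have hc₁I : c₁ ≤ I := integral_mono hcωi hωi fun ζ =>
    mul_le_of_le_one_left (hω ζ).le (cutDist_le_one _ _)
  set K := ∫ ζ, cutDist κ ζ * ‖f₁ ζ‖ with hK
  have hK0 : 0 ≤ K := integral_nonneg fun ζ => mul_nonneg (cutDist_nonneg _ _) (norm_nonneg _)
  have hK2 : K ^ 2 ≤ C₁ * N2 := by
    -- work with the weight on the momentum line scaled by the cut-off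
    have hcut : ∀ s : ℝ, 0 < s → 2 * K ≤ s * N2 + c₁ / s := by
      intro s hs
      have hpt : ∀ ζ, 2 * (cutDist κ ζ * ‖f₁ ζ‖) ≤
          s * (‖f₁ ζ‖ ^ 2 / ω ζ) + (cutDist κ ζ * ω ζ) / s := by
        intro ζ
        have h1 := hω ζ
        have h2 := cutDist_nonneg κ ζ
        have h3 := cutDist_le_one κ ζ
        have e1 : s * (‖f₁ ζ‖ ^ 2 / ω ζ) + (cutDist κ ζ ^ 2 * ω ζ) / s
            - 2 * (cutDist κ ζ * ‖f₁ ζ‖) = (s * ‖f₁ ζ‖ - cutDist κ ζ * ω ζ) ^ 2 / (s * ω ζ) := by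
          field_simp; ring
        have h4 : 0 ≤ (s * ‖f₁ ζ‖ - cutDist κ ζ * ω ζ) ^ 2 / (s * ω ζ) := by positivity
        have h5 : (cutDist κ ζ ^ 2 * ω ζ) / s ≤ (cutDist κ ζ * ω ζ) / s := by
          gcongr
          nlinarith
        linarith
      have h6 := integral_mono ((integrable_cutDist_mul hf₁i.norm κ).const_mul 2)
        ((hf₁ω.const_mul s).add (hcωi.div_const s)) hpt
      simp only [Pi.add_apply] at h6
      rw [integral_const_mul, integral_add (hf₁ω.const_mul s) (hcωi.div_const s),
        integral_const_mul, integral_div] at h6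
      exact h6
    rcases hK0.eq_or_lt with h0 | h0
    · rw [← h0]; simpa using mul_nonneg hC₁.le hN20
    · have h1 := hcut (C₁ / K) (by positivity)
      have h2 : c₁ / (C₁ / K) ≤ K := by
        rw [div_div_eq_mul_div, div_le_iff₀ hC₁]
        nlinarith
      have h3 : K ≤ C₁ / K * N2 := by linarith
      rw [div_mul_eq_mul_div, le_div_iff₀ h0] at h3
      nlinarith
  have hq : ∫ ζ, cutDist κ ζ * ‖f ζ‖ ≤ ‖a‖ * c₁ + K := by
    rw [hc₁, hK, ← integral_const_mul, ← integral_add (hcωi.const_mul _)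
      (integrable_cutDist_mul hf₁i.norm κ)]
    refine integral_mono (integrable_cutDist_mul hfi.norm κ)
      ((hcωi.const_mul _).add (integrable_cutDist_mul hf₁i.norm κ)) fun ζ => ?_
    have h1 : ‖f ζ‖ ≤ ‖a‖ * ω ζ + ‖f₁ ζ‖ := by
      have e1 : f ζ = a * (ω ζ : ℂ) + f₁ ζ := by simp only [f₁]; ring
      rw [e1]
      refine (norm_add_le _ _).trans ?_
      rw [norm_mul, Complex.norm_real, Real.norm_of_nonneg (hω ζ).le]
    have h2 := mul_le_mul_of_nonneg_left h1 (cutDist_nonneg κ ζ)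
    simp only
    linarith
  have hmain := (abs_le.mp (abs_potential_sub_le hV hf hev hq)).2
  rw [← hz, hza] at hmain
  rw [hsplit]
  set x := ‖a‖ with hx
  have hx0 : 0 ≤ x := norm_nonneg a
  set Q := ∫ r, V r * ‖𝓕⁻ f r‖ ^ 2 with hQ
  have hQle : Q ≤ x ^ 2 * I ^ 2 * e + v * (x * I * (x * c₁ + K) + (x * c₁ + K) ^ 2) := by
    have : (x * I) ^ 2 * cosMoment V κ ≤ x ^ 2 * I ^ 2 * e := by
      rw [mul_pow]; gcongr
    linarith
  refine (mul_le_mul_of_nonneg_left hQle hl.le).trans ?_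
  exact weighted_arith he hC₁ hl hv0 hIpos hc₁0 hωd hc₁I hK2 hl1 hl2

/-- Crude upper bound on the potential energy. -/
theorem potential_le_of_weight_crude (hV : Integrable V) {f : ℝ → ℂ} {C R : ℝ}
    (hf : Nice f C R) {ω : ℝ → ℝ}
    (hω : ∀ ζ, 0 < ω ζ) (hωi : Integrable ω) (hfω : Integrable fun ζ => ‖f ζ‖ ^ 2 / ω ζ)
    {l B : ℝ} (hl : 0 ≤ l) (hB : ∫ ζ, ω ζ ≤ B) (hl1 : l * ((∫ r, |V r|) * B) ≤ 1) :
    l * ∫ r, V r * ‖𝓕⁻ f r‖ ^ 2 ≤ ∫ ζ, ‖f ζ‖ ^ 2 / ω ζ := by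
  set X := ∫ ζ, ‖f ζ‖ ^ 2 / ω ζ with hX
  have hX0 : 0 ≤ X := integral_nonneg fun ζ => div_nonneg (sq_nonneg _) (hω ζ).le
  have hG : ∀ r, ‖𝓕⁻ f r‖ ^ 2 ≤ B * X := by
    intro r
    have h1 := (sq_integral_le_mul (fun ζ => norm_nonneg (f ζ))
      hf.meas.norm.aestronglyMeasurable hω hωi hfω).2
    have h2 : ‖𝓕⁻ f r‖ ^ 2 ≤ (∫ ζ, ‖f ζ‖) ^ 2 := by gcongr; exact norm_fourierInv_le r
    exact h2.trans (h1.trans (by gcongr))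
  have h3 : ∫ r, V r * ‖𝓕⁻ f r‖ ^ 2 ≤ (∫ r, |V r|) * (B * X) := by
    rw [← integral_mul_const]
    refine integral_mono (integrable_mul_fourierInv_sq hf hV) (hV.norm.mul_const _) fun r => ?_
    simp only
    calc V r * ‖𝓕⁻ f r‖ ^ 2 ≤ |V r| * ‖𝓕⁻ f r‖ ^ 2 := by gcongr; exact le_abs_self _
      _ ≤ |V r| * (B * X) := by gcongr; exact hG r
  calc l * ∫ r, V r * ‖𝓕⁻ f r‖ ^ 2 ≤ l * ((∫ r, |V r|) * (B * X)) := by gcongr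
    _ = l * ((∫ r, |V r|) * B) * X := by ring
    _ ≤ 1 * X := by gcongr
    _ = X := one_mul _

/-- Lower bound on the potential energy of a positive weight. -/
theorem le_potential_of_weight (hV : Integrable (fun r : ℝ => (1 + |r| ^ 2) * V r))
    {ω : ℝ → ℝ} {C R : ℝ} (hf : Nice (fun ζ => (ω ζ : ℂ)) C R) (hev : ∀ ζ, ω (-ζ) = ω ζ)
    (hω : ∀ ζ, 0 ≤ ω ζ) {κ C₁ : ℝ} (hωd : ∫ ζ, cutDist κ ζ * ω ζ ≤ C₁) :
    (∫ ζ, ω ζ) ^ 2 * cosMoment V κ - errMoment V * ((∫ ζ, ω ζ) * C₁ + C₁ ^ 2) ≤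
      ∫ r, V r * ‖𝓕⁻ (fun ζ => (ω ζ : ℂ)) r‖ ^ 2 := by
  have hn : ∀ ζ, ‖(ω ζ : ℂ)‖ = ω ζ := fun ζ => by
    rw [Complex.norm_real, Real.norm_of_nonneg (hω ζ)]
  have h := abs_potential_sub_le hV hf (fun ζ => by rw [hev]) (κ := κ) (q := C₁)
    (by simpa only [hn] using hωd)
  have h1 : ‖∫ ζ, (ω ζ : ℂ)‖ = ∫ ζ, ω ζ := by
    rw [integral_complex_ofReal, Complex.norm_real,
      Real.norm_of_nonneg (integral_nonneg hω)]
  rw [h1] at h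
  linarith [(abs_le.mp h).1]

end Fibre
/-! ### Pointwise bounds on the symbols -/

section Hyperbolic

theorem sinh_le_mul_cosh {x : ℝ} (hx : 0 ≤ x) : Real.sinh x ≤ x * Real.cosh x := by
  have h : MonotoneOn (fun y : ℝ => y * Real.cosh y - Real.sinh y) (Set.Ici 0) := by
    refine monotoneOn_of_deriv_nonneg (convex_Ici 0) (by fun_prop) (by fun_prop) fun y hy => ?_
    rw [interior_Ici, Set.mem_Ioi] at hy
    have hd : HasDerivAt (fun y : ℝ => y * Real.cosh y - Real.sinh y)
        (1 * Real.cosh y + y * Real.sinh y - Real.cosh y) y :=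
      ((hasDerivAt_id y).mul (Real.hasDerivAt_cosh y)).sub (Real.hasDerivAt_sinh y)
    rw [hd.deriv]
    have := Real.sinh_nonneg_iff.mpr hy.le
    nlinarith
  have := h (Set.mem_Ici.mpr le_rfl) (Set.mem_Ici.mpr hx) hx
  simp only [zero_mul, Real.sinh_zero, sub_zero] at this
  linarith

/-- Monotonicity of sinh y / y. The derivative of d sinh y − y sinh d is d cosh y − sinh d,
nonnegative for y ≥ d because sinh d ≤ d cosh d. -/
theorem mul_sinh_le_mul_sinh {d s : ℝ} (hd : 0 ≤ d) (hds : d ≤ s) :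
    s * Real.sinh d ≤ d * Real.sinh s := by
  have h : MonotoneOn (fun y : ℝ => d * Real.sinh y - y * Real.sinh d) (Set.Ici d) := by
    refine monotoneOn_of_deriv_nonneg (convex_Ici d) (by fun_prop) (by fun_prop) fun y hy => ?_
    rw [interior_Ici, Set.mem_Ioi] at hy
    have h1 : HasDerivAt (fun y : ℝ => d * Real.sinh y - y * Real.sinh d)
        (d * Real.cosh y - 1 * Real.sinh d) y :=
      ((Real.hasDerivAt_sinh y).const_mul d).sub ((hasDerivAt_id y).mul_const _)
    rw [h1.deriv]
    have h2 : Real.cosh d ≤ Real.cosh y :=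
      Real.cosh_le_cosh.mpr (by rw [abs_of_nonneg hd, abs_of_nonneg (hd.trans hy.le)]; exact hy.le)
    have h3 := sinh_le_mul_cosh hd
    nlinarith
  have := h (Set.mem_Ici.mpr le_rfl) (Set.mem_Ici.mpr hds) hds
  simp only at this
  linarith

/-- `x ↦ x / sinh x` is positive. -/
theorem div_sinh_pos {p : ℝ} (hp : p ≠ 0) : 0 < p / Real.sinh p := by
  rcases lt_or_gt_of_ne hp with h | h
  · exact div_pos_of_neg_of_neg h (Real.sinh_neg_iff.mpr h)
  · exact div_pos h (Real.sinh_pos_iff.mpr h)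

theorem div_sinh_abs (p : ℝ) : p / Real.sinh p = |p| / Real.sinh |p| := by
  rcases abs_choice p with h | h
  · rw [h]
  · rw [h, Real.sinh_neg, neg_div_neg_eq]

theorem div_sinh_le_one (p : ℝ) : p / Real.sinh p ≤ 1 := by
  rw [div_sinh_abs]
  exact div_le_one_of_le₀ (Real.self_le_sinh_iff.mpr (abs_nonneg p))
    (Real.sinh_nonneg_iff.mpr (abs_nonneg p))

/-- For |q| ≤ |p| the second bound follows from the first, and for |q| ≥ |p| from |q| sinh|p| ≤ |p|
sinh|q| < |p| cosh q. -/
theorem abs_le_div_sinh_mul_cosh {p q : ℝ} (hp : p ≠ 0) :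
    |p| ≤ p / Real.sinh p * Real.cosh p ∧
      |q| ≤ p / Real.sinh p * (Real.cosh p + Real.cosh q) := by
  have hd : 0 < |p| := abs_pos.mpr hp
  have hs : 0 < Real.sinh |p| := Real.sinh_pos_iff.mpr hd
  have h1 : |p| ≤ p / Real.sinh p * Real.cosh p := by
    rw [div_sinh_abs, ← Real.cosh_abs p, div_mul_eq_mul_div, le_div_iff₀ hs]
    exact mul_le_mul_of_nonneg_left (Real.sinh_lt_cosh _).le hd.le
  refine ⟨h1, ?_⟩
  have h0 := div_sinh_pos hp
  rcases le_total |q| |p| with h | h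
  · have := mul_pos h0 (Real.cosh_pos q)
    rw [mul_add]; linarith
  · have h2 : |q| ≤ p / Real.sinh p * Real.cosh q := by
      rw [div_sinh_abs, ← Real.cosh_abs q, div_mul_eq_mul_div, le_div_iff₀ hs]
      exact (mul_sinh_le_mul_sinh hd.le h).trans
        (mul_le_mul_of_nonneg_left (Real.sinh_lt_cosh _).le hd.le)
    have := mul_pos h0 (Real.cosh_pos p)
    rw [mul_add]; linarith

/-- The worst case is q = 0, where the half-angle formulas give p coth(p/2) ≥ 2. -/
theorem two_le_div_sinh_mul_cosh {p q : ℝ} (hp : p ≠ 0) :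
    2 ≤ p / Real.sinh p * (Real.cosh p + Real.cosh q) := by
  have hd : 0 < |p| := abs_pos.mpr hp
  have hs : 0 < Real.sinh |p| := Real.sinh_pos_iff.mpr hd
  have h1 : 2 ≤ p / Real.sinh p * (Real.cosh p + 1) := by
    rw [div_sinh_abs, ← Real.cosh_abs p, div_mul_eq_mul_div, le_div_iff₀ hs]
    have e : |p| = 2 * (|p| / 2) := by ring
    have h2 := sinh_le_mul_cosh (x := |p| / 2) (by positivity)
    rw [e, Real.sinh_two_mul, Real.cosh_two_mul, ← e]
    have h3 := Real.cosh_sq (|p| / 2)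
    have h4 := Real.cosh_pos (|p| / 2)
    nlinarith
  have h2 := mul_le_mul_of_nonneg_left (Real.one_le_cosh q) (div_sinh_pos hp).le
  rw [mul_add] at h1 ⊢
  linarith

theorem div_sinh_mul_cosh_le (p : ℝ) : p / Real.sinh p * Real.cosh p ≤ 1 + |p| := by
  rcases eq_or_ne p 0 with rfl | hp
  · simp
  have hd : 0 < |p| := abs_pos.mpr hp
  have hs : 0 < Real.sinh |p| := Real.sinh_pos_iff.mpr hd
  rw [div_sinh_abs, ← Real.cosh_abs p, div_mul_eq_mul_div, div_le_iff₀ hs]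
  have h1 : Real.cosh |p| - Real.sinh |p| ≤ 1 := by
    rw [Real.cosh_sub_sinh, Real.exp_le_one_iff]; linarith
  have h2 := Real.self_le_sinh_iff.mpr hd.le
  nlinarith

theorem tanh_add_tanh (u v : ℝ) : Real.tanh u + Real.tanh v =
    2 * Real.sinh (u + v) / (Real.cosh (u + v) + Real.cosh (u - v)) := by
  have h1 := Real.cosh_pos u
  have h2 := Real.cosh_pos v
  have h3 : Real.cosh (u + v) + Real.cosh (u - v) = 2 * (Real.cosh u * Real.cosh v) := by
    rw [Real.cosh_add, Real.cosh_sub]; ring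
  rw [h3, Real.tanh_eq_sinh_div_cosh, Real.tanh_eq_sinh_div_cosh, Real.sinh_add]
  field_simp
  try ring

/-- The function `L_T` of the two energies. -/
def energyL (T a b : ℝ) : ℝ := (a + b) / (Real.tanh (a / (2 * T)) + Real.tanh (b / (2 * T)))

/-- The function `D_T` of the two energies. -/
def energyD (T a b : ℝ) : ℝ :=
  1 / 2 * (a / Real.tanh (a / (2 * T))) + 1 / 2 * (b / Real.tanh (b / (2 * T)))

variable {T : ℝ}

/-- Sum and difference of the energies separate: with p, q the rescaled sum and difference, (p/sinh
p) cosh p grows like |p|, while cosh q makes the symbol exponentially large when the energies nearly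
cancel. At p = 0 both sides are 0 by the convention for division. -/
theorem energyL_eq (hT : 0 < T) (a b : ℝ) :
    energyL T a b = T * ((a + b) / (2 * T) / Real.sinh ((a + b) / (2 * T)) *
    (Real.cosh ((a + b) / (2 * T)) + Real.cosh ((a - b) / (2 * T)))) := by
  rw [energyL, tanh_add_tanh, ← add_div, ← sub_div]
  set p := (a + b) / (2 * T) with hp
  have e : a + b = 2 * T * p := by rw [hp]; field_simp
  rw [e]
  rcases eq_or_ne p 0 with h | h
  · simp [h]
  have hs : Real.sinh p ≠ 0 := by rwa [Ne, Real.sinh_eq_zero]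
  have hc : Real.cosh p + Real.cosh ((a - b) / (2 * T)) ≠ 0 := by
    have := Real.cosh_pos p
    have := Real.cosh_pos ((a - b) / (2 * T))
    positivity
  field_simp

theorem energyL_nonneg (hT : 0 < T) (a b : ℝ) : 0 ≤ energyL T a b := by
  rw [energyL_eq hT]
  set p := (a + b) / (2 * T) with hp
  have h1 : 0 ≤ p / Real.sinh p := by
    rw [div_sinh_abs]
    exact div_nonneg (abs_nonneg p) (Real.sinh_nonneg_iff.mpr (abs_nonneg p))
  have := Real.cosh_pos p
  have := Real.cosh_pos ((a - b) / (2 * T))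
  positivity

/-- These bounds, which D_T satisfies as well, are all that the weights with a logarithmic
singularity use. The assumption excludes the conventional value 0 of the quotient. -/
theorem energyL_ge (hT : 0 < T) (a b : ℝ) (hab : a + b ≠ 0) :
    2 * T ≤ energyL T a b ∧ |a + b| / 2 ≤ energyL T a b ∧
    |a - b| / 2 ≤ energyL T a b := by
  rw [energyL_eq hT]
  have hp : (a + b) / (2 * T) ≠ 0 := div_ne_zero hab (by positivity)
  have e1 : |a + b| / 2 = T * |(a + b) / (2 * T)| := by
    rw [abs_div, abs_of_pos (show 0 < 2 * T by positivity)]; field_simp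
  have e2 : |a - b| / 2 = T * |(a - b) / (2 * T)| := by
    rw [abs_div, abs_of_pos (show 0 < 2 * T by positivity)]; field_simp
  rw [e1, e2]
  refine ⟨?_, ?_, ?_⟩
  · have := mul_le_mul_of_nonneg_left
      (two_le_div_sinh_mul_cosh (q := (a - b) / (2 * T)) hp) hT.le
    linarith
  · gcongr
    have h1 := (abs_le_div_sinh_mul_cosh (q := 0) hp).1
    have h2 := mul_pos (div_sinh_pos hp) (Real.cosh_pos ((a - b) / (2 * T)))
    rw [mul_add]; linarith
  · gcongr
    exact (abs_le_div_sinh_mul_cosh hp).2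

theorem energyL_le (hT : 0 < T) (a b : ℝ) :
    energyL T a b ≤ |a + b| / 2 + T + T * Real.cosh ((a - b) / (2 * T)) := by
  rw [energyL_eq hT]
  have e1 : |a + b| / 2 = T * |(a + b) / (2 * T)| := by
    rw [abs_div, abs_of_pos (show 0 < 2 * T by positivity)]; field_simp
  rw [e1, mul_add]
  set p := (a + b) / (2 * T) with hp
  have h1 := div_sinh_mul_cosh_le p
  have h2 := mul_le_mul_of_nonneg_right (div_sinh_le_one p)
    (Real.cosh_pos ((a - b) / (2 * T))).le
  nlinarith

/-- p/sinh p ≥ exp(−|p|) ≥ exp(−|q|/2), whereas cosh q ≥ exp|q|/2, so the product grows like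
exp(|q|/2). This growth, absent for D_T, is why the far fibres do not matter for L_T. -/
theorem one_div_energyL_le (hT : 0 < T) (a b : ℝ) (hab : a + b ≠ 0) (h : |a + b| ≤ |a - b| / 2) :
    1 / energyL T a b ≤ 2 / T * Real.exp (-(|a - b| / (4 * T))) := by
  rw [energyL_eq hT]
  have hp : (a + b) / (2 * T) ≠ 0 := div_ne_zero hab (by positivity)
  set p := (a + b) / (2 * T) with hp'
  set q := (a - b) / (2 * T) with hq'
  have hpq : |p| ≤ |q| / 2 := by
    rw [hp', hq', abs_div, abs_div, abs_of_pos (show 0 < 2 * T by positivity), div_div,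
      div_le_div_iff₀ (by positivity) (by positivity)]
    nlinarith
  have e1 : |a - b| / (4 * T) = |q| / 2 := by
    rw [hq', abs_div, abs_of_pos (show 0 < 2 * T by positivity)]; field_simp; norm_num
  rw [e1]
  have hd : 0 < |p| := abs_pos.mpr hp
  have hs : 0 < Real.sinh |p| := Real.sinh_pos_iff.mpr hd
  have h1 : Real.exp (-(|q| / 2)) ≤ p / Real.sinh p := by
    rw [div_sinh_abs, le_div_iff₀ hs]
    have h2 := sinh_le_mul_cosh hd.le
    have h3 : Real.cosh |p| ≤ Real.exp |p| := by
      have := Real.cosh_add_sinh |p|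
      linarith
    have h4 : Real.exp |p| ≤ Real.exp (|q| / 2) := Real.exp_le_exp.mpr hpq
    have h5 : Real.exp (-(|q| / 2)) * Real.exp (|q| / 2) = 1 := by
      rw [← Real.exp_add]; simp
    calc Real.exp (-(|q| / 2)) * Real.sinh |p|
        ≤ Real.exp (-(|q| / 2)) * (|p| * Real.exp (|q| / 2)) := by
          gcongr
          exact h2.trans (by gcongr; exact h3.trans h4)
      _ = (Real.exp (-(|q| / 2)) * Real.exp (|q| / 2)) * |p| := by ring
      _ = |p| := by rw [h5, one_mul]
  have h6 : Real.exp |q| / 2 ≤ Real.cosh p + Real.cosh q := by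
    have h7 : Real.exp |q| / 2 ≤ Real.cosh |q| := by
      rw [Real.cosh_eq]
      have := Real.exp_pos (-|q|)
      linarith
    rw [Real.cosh_abs] at h7
    linarith [Real.cosh_pos p]
  have h0 := (div_sinh_pos hp).le
  have h8 : T * (Real.exp (-(|q| / 2)) * (Real.exp |q| / 2)) ≤
      T * (p / Real.sinh p * (Real.cosh p + Real.cosh q)) := by gcongr
  have h9 : Real.exp (-(|q| / 2)) * Real.exp |q| = Real.exp (|q| / 2) := by
    rw [← Real.exp_add]; congr 1; ring
  have h10 : T * (Real.exp (-(|q| / 2)) * (Real.exp |q| / 2)) = T / 2 * Real.exp (|q| / 2) := by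
    rw [← h9]; ring
  rw [h10] at h8
  refine (one_div_le_one_div_of_le (by positivity) h8).trans (le_of_eq ?_)
  rw [Real.exp_neg]
  field_simp

/-- Bounds on `x / tanh (x / (2 T))`. -/
theorem div_tanh_bounds (hT : 0 < T) (x : ℝ) : 0 ≤ x / Real.tanh (x / (2 * T)) ∧
    x / Real.tanh (x / (2 * T)) ≤ |x| + 2 * T ∧
    (x ≠ 0 → |x| ≤ x / Real.tanh (x / (2 * T)) ∧ 2 * T ≤ x / Real.tanh (x / (2 * T))) := by
  have e : x / Real.tanh (x / (2 * T)) =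
      2 * T * (x / (2 * T) / Real.sinh (x / (2 * T)) * Real.cosh (x / (2 * T))) := by
    rw [Real.tanh_eq_sinh_div_cosh]
    rcases eq_or_ne x 0 with h | h
    · simp [h]
    have hp : x / (2 * T) ≠ 0 := div_ne_zero h (by positivity)
    have hs : Real.sinh (x / (2 * T)) ≠ 0 := by rwa [Ne, Real.sinh_eq_zero]
    have hc := (Real.cosh_pos (x / (2 * T))).ne'
    field_simp
  have e1 : |x| = 2 * T * |x / (2 * T)| := by
    rw [abs_div, abs_of_pos (show 0 < 2 * T by positivity)]; field_simp
  rw [e, e1]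
  set p := x / (2 * T) with hp
  have hnn : 0 ≤ p / Real.sinh p := by
    rw [div_sinh_abs]
    exact div_nonneg (abs_nonneg p) (Real.sinh_nonneg_iff.mpr (abs_nonneg p))
  have hc := Real.cosh_pos p
  refine ⟨by positivity, ?_, fun hx => ?_⟩
  · have := div_sinh_mul_cosh_le p
    nlinarith
  · have hp0 : p ≠ 0 := div_ne_zero hx (by positivity)
    refine ⟨by gcongr; exact (abs_le_div_sinh_mul_cosh (q := 0) hp0).1, ?_⟩
    have h1 : 1 ≤ p / Real.sinh p * Real.cosh p := by
      have := sinh_le_mul_cosh (abs_nonneg p)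
      rw [div_sinh_abs, ← Real.cosh_abs p, div_mul_eq_mul_div,
        le_div_iff₀ (Real.sinh_pos_iff.mpr (abs_pos.mpr hp0))]
      linarith
    nlinarith

theorem energyD_nonneg (hT : 0 < T) (a b : ℝ) : 0 ≤ energyD T a b := by
  have h1 := (div_tanh_bounds hT a).1
  have h2 := (div_tanh_bounds hT b).1
  rw [energyD]; linarith

theorem energyD_ge (hT : 0 < T) (a b : ℝ) (ha : a ≠ 0) (hb : b ≠ 0) : 2 * T ≤ energyD T a b ∧
    |a + b| / 2 ≤ energyD T a b ∧ |a - b| / 2 ≤ energyD T a b := by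
  have h1 := (div_tanh_bounds hT a).2.2 ha
  have h2 := (div_tanh_bounds hT b).2.2 hb
  have h3 := abs_add_le a b
  have h4 := abs_sub a b
  rw [energyD]
  refine ⟨?_, ?_, ?_⟩ <;> linarith [h1.1, h1.2, h2.1, h2.2]

theorem energyD_le (hT : 0 < T) (a b : ℝ) : energyD T a b ≤ (|a| + |b|) / 2 + 2 * T := by
  have h1 := (div_tanh_bounds hT a).2.1
  have h2 := (div_tanh_bounds hT b).2.1
  rw [energyD]; linarith

end Hyperbolic
/-! ### Weights bounding the inverse symbols -/

section Weights

/-- The singular part of the weights: a logarithmic singularity at `±c`, cut off at `T`. -/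
def singW (κ T c k : ℝ) : ℝ :=
  Set.indicator (Set.Icc (-(2 * κ)) (2 * κ)) (fun k => 1 / max (2 * T) (2 * κ * |(|k| - c)|)) k

/-- The regular part of the weights. -/
def tailW (κ k : ℝ) : ℝ := 80 / (κ ^ 2 + k ^ 2)

variable {κ T P k m : ℝ}

theorem singW_nonneg (hT : 0 < T) (c : ℝ) : 0 ≤ singW κ T c k :=
  Set.indicator_nonneg (fun k _ => one_div_nonneg.mpr (le_max_of_le_left (by linarith))) k

theorem singW_of_mem (c : ℝ) (h : |k| ≤ 2 * κ) :
    singW κ T c k = 1 / max (2 * T) (2 * κ * |(|k| - c)|) :=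
  Set.indicator_of_mem (s := Set.Icc (-(2 * κ)) (2 * κ)) (abs_le.mp h) _

theorem tailW_pos (hκ : 0 < κ) : 0 < tailW κ k := by rw [tailW]; positivity

/-- The 80 in `tailW` is 16 · 5, since κ² + k² ≤ 5κ² here; 16/κ² is the additive error that the
pointwise comparisons may spend. -/
theorem le_tailW (hκ : 0 < κ) (h : |k| ≤ 2 * κ) : 16 / κ ^ 2 ≤ tailW κ k := by
  rw [tailW, div_le_div_iff₀ (by positivity) (by positivity)]
  have : k ^ 2 ≤ (2 * κ) ^ 2 := sq_le_sq' (by linarith [(abs_le.mp h).1]) (abs_le.mp h).2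
  nlinarith

theorem one_div_le_tailW_of_large (hκ : 0 < κ) (h : 2 * κ < |k|)
    (hm : |k ^ 2 + P ^ 2 / 4 - κ ^ 2| ≤ m) : 1 / m ≤ tailW κ k := by
  have h1 : (2 * κ) ^ 2 < k ^ 2 := by rw [← sq_abs k]; gcongr
  have h2 : k ^ 2 - κ ^ 2 ≤ m := by
    have := le_abs_self (k ^ 2 + P ^ 2 / 4 - κ ^ 2)
    nlinarith [sq_nonneg P]
  have h3 : 0 < m := by nlinarith
  rw [tailW, div_le_div_iff₀ h3 (by positivity)]
  nlinarith

/-- It suffices to compare with the singularity without the cut-off. -/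
theorem one_div_le_of_cutoff {c C : ℝ} (hκ : 0 < κ) (hT : 0 < T) (h : |k| ≤ 2 * κ)
    (hC : C ≤ 16 / κ ^ 2) (hC0 : 0 ≤ C) (hmT : 2 * T ≤ m)
    (hm : 0 < |(|k| - c)| → 1 / m ≤ 1 / (2 * κ * |(|k| - c)|) + C) :
    1 / m ≤ singW κ T c k + tailW κ k := by
  have ht := le_tailW hκ h
  rw [singW_of_mem c h]
  rcases le_or_gt (2 * κ * |(|k| - c)|) (2 * T) with h1 | h1
  · rw [max_eq_left h1]
    have := one_div_le_one_div_of_le (by positivity) hmT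
    linarith
  · rw [max_eq_right h1.le]
    have : 0 < |(|k| - c)| := by
      by_contra! h2
      have : 2 * κ * |(|k| - c)| ≤ 0 := mul_nonpos_of_nonneg_of_nonpos (by positivity) h2
      linarith
    have := hm this
    linarith

/-- With y = q²/4 the difference of the reciprocals is y/(g(g − y)) ≤ (4/3) y/g², and κ² y ≤ g². The
shift by total momentum thus has bounded cost. -/
theorem one_div_sub_le {κ g q : ℝ} (hκ : 0 < κ) (hg : 0 < g) (h : q ^ 2 / 4 ≤ g / 4)
    (hq : (q * κ / 2) ^ 2 ≤ g ^ 2) : 1 / (g - q ^ 2 / 4) ≤ 1 / g + 2 / κ ^ 2 := by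
  obtain ⟨y, hy⟩ : ∃ y, y = q ^ 2 / 4 := ⟨_, rfl⟩
  rw [← hy] at h ⊢
  have hy2 : κ ^ 2 * y ≤ g ^ 2 := by
    calc κ ^ 2 * y = (q * κ / 2) ^ 2 := by rw [hy]; ring
      _ ≤ g ^ 2 := hq
  have h4 : 0 < g - y := by linarith
  have h5 : g * y ≤ g * (g / 4) := by gcongr
  rw [div_add_div _ _ hg.ne' (by positivity), div_le_div_iff₀ h4 (by positivity)]
  nlinarith

/-- Small total momentum: the singularity is at `±κ`. -/
theorem one_div_le_weight_near (hκ : 0 < κ) (hT : 0 < T) (hP : |P| ≤ κ / 2) (hmT : 2 * T ≤ m)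
    (hm1 : |k ^ 2 + P ^ 2 / 4 - κ ^ 2| ≤ m) (hm2 : |P * k| ≤ m) :
    1 / m ≤ singW κ T κ k + tailW κ k := by
  rcases lt_or_ge (2 * κ) |k| with h | h
  · have := one_div_le_tailW_of_large hκ h hm1
    have := singW_nonneg (κ := κ) (k := k) hT κ
    linarith
  refine one_div_le_of_cutoff (C := 4 / κ ^ 2) hκ hT h (by gcongr; norm_num) (by positivity) hmT
    fun hd => ?_
  rw [abs_mul] at hm2
  have hk2 : k ^ 2 = |k| ^ 2 := (sq_abs k).symm
  have hP2 : P ^ 2 = |P| ^ 2 := (sq_abs P).symm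
  rw [hk2, hP2] at hm1
  set x := |k| with hx
  set q := |P| with hq
  have hx0 : 0 ≤ x := abs_nonneg k
  have hq0 : 0 ≤ q := abs_nonneg P
  set d := |x - κ| with hd'
  have hm0 : 0 < m := by linarith
  have hX := (abs_le.mp hm1)
  -- Well inside the Fermi points the sum bound alone gives m ≥ κ² − κ²/4 − κ²/16 ≥ κ²/2.
  rcases lt_or_ge x (κ / 2) with hxs | hxs
  · have h1 : κ ^ 2 / 2 ≤ m := by nlinarith
    have h2 : 1 / m ≤ 4 / κ ^ 2 := by
      rw [div_le_div_iff₀ hm0 (by positivity)]; nlinarith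
    have h3 : 0 ≤ 1 / (2 * κ * d) := by positivity
    linarith
  -- `g = |x ^ 2 - κ ^ 2|`
  set g := d * (x + κ) with hg
  have hgpos : 0 < g := by positivity
  have hg1 : g = |x ^ 2 - κ ^ 2| := by
    rw [hg, hd', show x ^ 2 - κ ^ 2 = (x - κ) * (x + κ) by ring, abs_mul,
      abs_of_pos (show 0 < x + κ by positivity)]
  have hgd : 1 / g ≤ 1 / (2 * κ * d) + 1 / κ ^ 2 := by
    have e : 1 / (2 * κ * d) + 1 / κ ^ 2 - 1 / g
        = (κ * (x - κ) + 2 * d * (x + κ)) / (2 * κ ^ 2 * g) := by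
      rw [hg]; field_simp; ring
    have h1 : 0 ≤ κ * (x - κ) + 2 * d * (x + κ) := by
      have := neg_abs_le (x - κ)
      nlinarith
    have : 0 ≤ (κ * (x - κ) + 2 * d * (x + κ)) / (2 * κ ^ 2 * g) := by positivity
    linarith
  have hmg : 1 / m ≤ 1 / g + 2 / κ ^ 2 := by
    -- Either |P k| already dominates g, or q² ≤ q x < g, so that the shift q²/4 is at most a
    -- quarter of g.
    rcases le_or_gt g (q * x) with hc | hc
    · have := one_div_le_one_div_of_le hgpos (hc.trans hm2)
      have : 0 ≤ 2 / κ ^ 2 := by positivity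
      linarith
    · have h1 : g - q ^ 2 / 4 ≤ m := by
        have h2 : g - q ^ 2 / 4 ≤ |x ^ 2 + q ^ 2 / 4 - κ ^ 2| := by
          rw [hg1]
          have := abs_sub_abs_le_abs_sub (x ^ 2 - κ ^ 2) (-(q ^ 2 / 4))
          rw [abs_neg, abs_of_nonneg (show 0 ≤ q ^ 2 / 4 by positivity)] at this
          have e : x ^ 2 - κ ^ 2 - -(q ^ 2 / 4) = x ^ 2 + q ^ 2 / 4 - κ ^ 2 := by ring
          rwa [e] at this
        exact h2.trans hm1
      have h3 : q ^ 2 / 4 ≤ g / 4 := by nlinarith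
      have h4 : 0 < g - q ^ 2 / 4 := by linarith
      have h5 : 1 / m ≤ 1 / (g - q ^ 2 / 4) := one_div_le_one_div_of_le h4 h1
      have h7 : q * κ / 2 ≤ g := by
        have : q * (κ / 2) ≤ q * x := by gcongr
        linarith
      have h6 := one_div_sub_le hκ hgpos h3 (pow_le_pow_left₀ (by positivity) h7 2)
      linarith
  have e4 : 4 / κ ^ 2 = 1 / κ ^ 2 + 2 / κ ^ 2 + 1 / κ ^ 2 := by ring
  have : 0 ≤ 1 / κ ^ 2 := by positivity
  linarith

/-- Large total momentum: the only singularity is at `0`. -/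
theorem one_div_le_weight_far (hκ : 0 < κ) (hT : 0 < T) (hP : κ / 2 ≤ |P|) (hmT : 2 * T ≤ m)
    (hm1 : |k ^ 2 + P ^ 2 / 4 - κ ^ 2| ≤ m) (hm2 : |P * k| ≤ m) :
    1 / m ≤ singW κ T 0 k + tailW κ k := by
  rcases lt_or_ge (2 * κ) |k| with h | h
  · have := one_div_le_tailW_of_large hκ h hm1
    have := singW_nonneg (κ := κ) (k := k) hT 0
    linarith
  refine one_div_le_of_cutoff (C := 16 / κ ^ 2) hκ hT h le_rfl (by positivity) hmT
    fun hd => ?_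
  rw [sub_zero, abs_abs] at hd ⊢
  rw [abs_mul] at hm2
  have hk2 : k ^ 2 = |k| ^ 2 := (sq_abs k).symm
  have hP2 : P ^ 2 = |P| ^ 2 := (sq_abs P).symm
  rw [hk2, hP2] at hm1
  set x := |k| with hx
  set q := |P| with hq
  have hm0 : 0 < m := by linarith
  have hX := (abs_le.mp hm1)
  have hpos : 0 ≤ 16 / κ ^ 2 := by positivity
  have hq0 : 0 < q := by linarith
  -- For |P| ≥ 2κ the bound |P k| suffices. Otherwise, close to k = 0 the sum bound is at least of
  -- size κ² − P²/4 − k² and beats 2κ|k|; further out, replacing |P| by 2κ costs only a constant.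
  rcases le_or_gt (2 * κ) q with h1 | h1
  · have : 2 * κ * x ≤ m := by nlinarith
    have := one_div_le_one_div_of_le (by positivity) this
    linarith
  rcases lt_or_ge x ((2 * κ - q) / 8) with h2 | h2
  · have : 2 * κ * x ≤ m := by nlinarith
    have := one_div_le_one_div_of_le (by positivity) this
    linarith
  · have h3 : 1 / m ≤ 1 / (q * x) := one_div_le_one_div_of_le (by positivity) hm2
    have e : 1 / (q * x) - 1 / (2 * κ * x) = (2 * κ - q) / (2 * κ * q * x) := by
      field_simp
    have h4 : (2 * κ - q) / (2 * κ * q * x) ≤ 16 / κ ^ 2 := by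
      rw [div_le_div_iff₀ (by positivity) (by positivity)]
      have h5 : (2 * κ - q) * κ ^ 2 ≤ 8 * x * κ ^ 2 := by gcongr; linarith
      have h6 : 8 * x * κ * (κ / 2) ≤ 8 * x * κ * q := by gcongr
      nlinarith
    linarith

/-- The weight for `L_T` at large total momentum. -/
def farW (κ T P k : ℝ) : ℝ :=
  2 / T * Real.exp (-(|P| / (2 * T) * |k|)) +
    Set.indicator (Set.Icc (-(4 * |κ ^ 2 - P ^ 2 / 4| / |P|)) (4 * |κ ^ 2 - P ^ 2 / 4| / |P|))
      (fun _ => 3 / (2 * |κ ^ 2 - P ^ 2 / 4|)) k + tailW κ k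

theorem farW_pos (hκ : 0 < κ) (hT : 0 < T) : 0 < farW κ T P k := by
  have h1 : 0 < 2 / T * Real.exp (-(|P| / (2 * T) * |k|)) := by positivity
  have h2 : 0 ≤ Set.indicator (Set.Icc (-(4 * |κ ^ 2 - P ^ 2 / 4| / |P|))
      (4 * |κ ^ 2 - P ^ 2 / 4| / |P|)) (fun _ => 3 / (2 * |κ ^ 2 - P ^ 2 / 4|)) k :=
    Set.indicator_nonneg (fun k _ => by positivity) k
  have h3 := tailW_pos (κ := κ) (k := k) hκ
  rw [farW]; linarith

/-- Large total momentum: the inverse of `L_T` has no singularity. -/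
theorem one_div_energyL_le_farW (hκ : 0 < κ) (hT : 0 < T) (hP : κ / 2 ≤ |P|) (hk : k ≠ 0)
    (hs : k ^ 2 + P ^ 2 / 4 - κ ^ 2 ≠ 0) :
    1 / energyL T ((P / 2 + k) ^ 2 - κ ^ 2) ((P / 2 - k) ^ 2 - κ ^ 2) ≤ farW κ T P k := by
  set a := (P / 2 + k) ^ 2 - κ ^ 2 with ha
  set b := (P / 2 - k) ^ 2 - κ ^ 2 with hb
  have hsum : a + b = 2 * (k ^ 2 + P ^ 2 / 4 - κ ^ 2) := by rw [ha, hb]; ring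
  have hdiff : a - b = 2 * (P * k) := by rw [ha, hb]; ring
  have hab : a + b ≠ 0 := by rw [hsum]; exact mul_ne_zero two_ne_zero hs
  obtain ⟨hLT, hL1, hL2⟩ := energyL_ge hT a b hab
  rw [hsum, abs_mul, abs_two, mul_div_cancel_left₀ _ two_ne_zero] at hL1
  rw [hdiff, abs_mul, abs_two, mul_div_cancel_left₀ _ two_ne_zero] at hL2
  have hexp0 : 0 < 2 / T * Real.exp (-(|P| / (2 * T) * |k|)) := by positivity
  have hind0 : 0 ≤ Set.indicator (Set.Icc (-(4 * |κ ^ 2 - P ^ 2 / 4| / |P|))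
      (4 * |κ ^ 2 - P ^ 2 / 4| / |P|)) (fun _ => 3 / (2 * |κ ^ 2 - P ^ 2 / 4|)) k :=
    Set.indicator_nonneg (fun k _ => by positivity) k
  have htail0 := tailW_pos (κ := κ) (k := k) hκ
  rw [farW]
  have hL0 : 0 < energyL T a b := by linarith
  rcases lt_or_ge (2 * κ) |k| with h | h
  · have := one_div_le_tailW_of_large hκ h hL1
    linarith
  -- Here |P k| ≥ P²/4 ≥ κ²/16.
  rcases lt_or_ge (|P| / 4) |k| with h1 | h1
  · have ht := le_tailW hκ h
    rw [abs_mul] at hL2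
    have h2 : κ ^ 2 / 16 ≤ energyL T a b := by
      have : |P| * (|P| / 4) ≤ |P| * |k| := by gcongr
      nlinarith
    have h3 : 1 / energyL T a b ≤ 16 / κ ^ 2 := by
      rw [div_le_div_iff₀ hL0 (by positivity)]; linarith
    linarith
  -- If the difference dominates, the exponential term applies. Otherwise |k² − s| > |P||k|/2 ≥ 2k²
  -- with s = κ² − P²/4, hence |k² − s| ≥ 2|s|/3 and |k| ≤ 4|s|/|P|: this is the plateau.
  rcases le_or_gt |a + b| (|a - b| / 2) with h2 | h2
  · have h3 := one_div_energyL_le hT a b hab h2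
    have e : |a - b| / (4 * T) = |P| / (2 * T) * |k| := by
      rw [hdiff, abs_mul, abs_mul, abs_two]; field_simp; ring
    rw [e] at h3
    linarith
  · rw [hsum, hdiff, abs_mul, abs_mul, abs_mul, abs_two] at h2
    have hk2 : k ^ 2 = |k| ^ 2 := (sq_abs k).symm
    have hk0 : 0 < |k| := abs_pos.mpr hk
    set s := κ ^ 2 - P ^ 2 / 4 with hs'
    have e : k ^ 2 + P ^ 2 / 4 - κ ^ 2 = k ^ 2 - s := by rw [hs']; ring
    rw [e] at h2 hL1
    have hq0 : 0 < |P| := by linarith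
    have h3 : 2 * |k| ^ 2 < |k ^ 2 - s| := by nlinarith
    have h4 : |k ^ 2 - s| ≤ |k| ^ 2 + |s| := by
      have := abs_sub (k ^ 2) s
      rw [abs_of_nonneg (sq_nonneg k)] at this
      linarith
    have hspos : 0 < |s| := by nlinarith
    have h5 : 2 / 3 * |s| ≤ |k ^ 2 - s| := by
      have h6 : |s| ≤ |k ^ 2 - s| + |k| ^ 2 := by
        have := abs_sub_abs_le_abs_sub s (k ^ 2)
        rw [abs_of_nonneg (sq_nonneg k), abs_sub_comm s (k ^ 2)] at this
        linarith
      linarith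
    have hmem : k ∈ Set.Icc (-(4 * |s| / |P|)) (4 * |s| / |P|) := by
      rw [Set.mem_Icc, ← abs_le, le_div_iff₀ hq0]
      nlinarith
    rw [Set.indicator_of_mem hmem]
    have h7 : 1 / energyL T a b ≤ 3 / (2 * |s|) := by
      rw [div_le_div_iff₀ hL0 (by positivity)]; linarith
    linarith

end Weights
/-! ### Integrals of the weights -/

section WeightIntegrals

/-- A profile in the distance to `±c`, cut off at `|k| ≤ 2 κ`. -/
def foldW (κ c : ℝ) (φ : ℝ → ℝ) (k : ℝ) : ℝ :=
  Set.indicator (Set.Icc (-(2 * κ)) (2 * κ)) (fun k => φ |(|k| - c)|) k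

theorem foldW_of_mem {κ k : ℝ} (c : ℝ) (φ : ℝ → ℝ) (h : |k| ≤ 2 * κ) :
    foldW κ c φ k = φ |(|k| - c)| :=
  Set.indicator_of_mem (s := Set.Icc (-(2 * κ)) (2 * κ)) (abs_le.mp h) _

theorem foldW_of_notMem {κ k : ℝ} (c : ℝ) (φ : ℝ → ℝ) (h : 2 * κ < |k|) : foldW κ c φ k = 0 :=
  Set.indicator_of_notMem (s := Set.Icc (-(2 * κ)) (2 * κ))
    (fun h' => absurd (abs_le.mpr h') (not_le.mpr h)) _

theorem foldW_neg (κ c : ℝ) (φ : ℝ → ℝ) (k : ℝ) : foldW κ c φ (-k) = foldW κ c φ k := by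
  rcases le_or_gt |k| (2 * κ) with h | h
  · rw [foldW_of_mem c φ h, foldW_of_mem c φ (by rwa [abs_neg]), abs_neg]
  · rw [foldW_of_notMem c φ h, foldW_of_notMem c φ (by rwa [abs_neg])]

theorem continuous_fold {φ : ℝ → ℝ} (hφ : Continuous φ) (c : ℝ) :
    Continuous fun k : ℝ => φ |(|k| - c)| := by fun_prop

theorem measurable_foldW {φ : ℝ → ℝ} (hφ : Continuous φ) (κ c : ℝ) :
    Measurable (foldW κ c φ) :=
  (continuous_fold hφ c).measurable.indicator measurableSet_Icc

theorem integrable_foldW {φ : ℝ → ℝ} (hφ : Continuous φ) (κ c : ℝ) :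
    Integrable (foldW κ c φ) :=
  ((continuous_fold hφ c).integrableOn_Icc).integrable_indicator measurableSet_Icc

/-- Fold onto k ≥ 0 and split at `c`. For c = κ both integrals reach the singularity, for c = 0 only
one does: the source of the factor 2 between the logarithmic coefficients. -/
theorem integral_foldW {φ : ℝ → ℝ} (hφ : Continuous φ) {κ c : ℝ} (hc : 0 ≤ c) (hcκ : c ≤ 2 * κ) :
    ∫ k, foldW κ c φ k = 2 * ((∫ t in (0 : ℝ)..c, φ t) + ∫ t in (0 : ℝ)..(2 * κ - c), φ t) := by
  have hcont : Continuous fun k : ℝ => φ |k - c| := by fun_prop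
  have e : foldW κ c φ = fun k => Set.indicator (Set.Iic (2 * κ)) (fun k => φ |k - c|) |k| := by
    funext k
    rcases le_or_gt |k| (2 * κ) with h | h
    · rw [foldW_of_mem c φ h, Set.indicator_of_mem (Set.mem_Iic.mpr h)]
    · rw [foldW_of_notMem c φ h, Set.indicator_of_notMem (by simpa using h)]
  rw [e, integral_comp_abs, setIntegral_indicator measurableSet_Iic, Set.Ioi_inter_Iic,
    ← intervalIntegral.integral_of_le (hc.trans hcκ),
    ← intervalIntegral.integral_add_adjacent_intervals (b := c)
      (hcont.intervalIntegrable _ _) (hcont.intervalIntegrable _ _)]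
  congr 2
  · have h1 : ∫ k in (0 : ℝ)..c, φ |k - c| = ∫ k in (0 : ℝ)..c, φ (c - k) := by
      refine intervalIntegral.integral_congr fun k hk => ?_
      rw [Set.uIcc_of_le hc] at hk
      rw [abs_sub_comm, abs_of_nonneg (by linarith [hk.2])]
    rw [h1, intervalIntegral.integral_comp_sub_left]; simp
  · have h1 : ∫ k in c..(2 * κ), φ |k - c| = ∫ k in c..(2 * κ), φ (k - c) := by
      refine intervalIntegral.integral_congr fun k hk => ?_
      rw [Set.uIcc_of_le hcκ] at hk
      rw [abs_of_nonneg (by linarith [hk.1])]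
    rw [h1, intervalIntegral.integral_comp_sub_right]; simp

theorem integral_one_div_affine {α β A : ℝ} (hα : 0 < α) (hβ : 0 < β) (hA : 0 ≤ A) :
    ∫ t in (0 : ℝ)..A, 1 / (α + β * t) = 1 / β * Real.log (1 + β * A / α) := by
  have hpos : ∀ t ∈ Set.uIcc 0 A, 0 < α + β * t := fun t ht => by
    rw [Set.uIcc_of_le hA] at ht
    have := ht.1
    positivity
  have h := intervalIntegral.integral_eq_sub_of_hasDerivAt
    (f := fun t => 1 / β * Real.log (α + β * t)) (f' := fun t => 1 / (α + β * t)) (a := 0) (b := A)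
    (fun t ht => by
      have h1 : HasDerivAt (fun t : ℝ => α + β * t) β t := by
        simpa using ((hasDerivAt_id t).const_mul β).const_add α
      have h2 := (h1.log (hpos t ht).ne').const_mul (1 / β)
      exact h2.congr_deriv (by rw [one_div_mul_eq_div, div_div_cancel_left' hβ.ne', one_div]))
    ((ContinuousOn.div (by fun_prop) (by fun_prop) fun t ht => (hpos t ht).ne').intervalIntegrable)
  rw [h, ← mul_sub, ← Real.log_div (hpos A Set.right_mem_uIcc).ne' (hpos 0 Set.left_mem_uIcc).ne']
  congr 2
  field_simp
  simp

theorem integral_one_div_affine_sq_le {α β A : ℝ} (hα : 0 < α) (hβ : 0 < β) (hA : 0 ≤ A) :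
    ∫ t in (0 : ℝ)..A, 1 / (α + β * t) ^ 2 ≤ 1 / (β * α) := by
  have hpos : ∀ t ∈ Set.uIcc 0 A, 0 < α + β * t := fun t ht => by
    rw [Set.uIcc_of_le hA] at ht
    have := ht.1
    positivity
  have h := intervalIntegral.integral_eq_sub_of_hasDerivAt
    (f := fun t => -(1 / β) * (α + β * t)⁻¹) (f' := fun t => 1 / (α + β * t) ^ 2) (a := 0) (b := A)
    (fun t ht => by
      have h1 : HasDerivAt (fun t : ℝ => α + β * t) β t := by
        simpa using ((hasDerivAt_id t).const_mul β).const_add α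
      have h2 := (h1.inv (hpos t ht).ne').const_mul (-(1 / β))
      exact h2.congr_deriv (by have := (hpos t ht).ne'; field_simp))
    ((ContinuousOn.div (by fun_prop) (by fun_prop)
      fun t ht => pow_ne_zero 2 (hpos t ht).ne').intervalIntegrable)
  rw [h]
  have h3 : 0 < (α + β * A)⁻¹ := inv_pos.mpr (hpos A Set.right_mem_uIcc)
  have h4 : 0 ≤ 1 / β * (α + β * A)⁻¹ := by positivity
  have h5 : 1 / β * (α + β * 0)⁻¹ = 1 / (β * α) := by
    rw [mul_zero, add_zero, one_div, one_div, mul_inv]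
  simp only [neg_mul]
  linarith

/-- Trades the maximum for terms with elementary primitives: the first integrates to the logarithm
with the sharp coefficient, the second to a bounded correction. -/
theorem one_div_max_le {a b : ℝ} (ha : 0 < a) (hb : 0 ≤ b) :
    1 / max a b ≤ 1 / (a + b) + 2 * a * (1 / (a + b) ^ 2) := by
  have e : 1 / (a + b) + 2 * a * (1 / (a + b) ^ 2) = (3 * a + b) / (a + b) ^ 2 := by
    field_simp; ring
  rw [e]
  rcases le_total a b with h | h
  · rw [max_eq_right h, div_le_div_iff₀ (by linarith) (by positivity)]; nlinarith
  · rw [max_eq_left h, div_le_div_iff₀ ha (by positivity)]; nlinarith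

variable {κ T T₀ A : ℝ}

/-- The profile of `singW`. -/
def singProfile (κ T t : ℝ) : ℝ := 1 / max (2 * T) (2 * κ * t)

theorem continuous_singProfile (hT : 0 < T) : Continuous (singProfile κ T) :=
  continuous_const.div (by fun_prop) fun t =>
    ((by linarith : 0 < 2 * T).trans_le (le_max_left _ _)).ne'

theorem singW_eq_foldW (κ T c : ℝ) : singW κ T c = foldW κ c (singProfile κ T) := rfl

/-- The profile decreases in T, so T₀ can replace T and the bound is uniform in T ≥ T₀. In the
constant 4, one 2 bounds log 3 and the other comes from the correction in `one_div_max_le`. -/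
theorem integral_singProfile_le (hκ : 0 < κ) (hT₀ : 0 < T₀) (hT₀κ : T₀ ≤ κ ^ 2) (hT : T₀ ≤ T)
    (hA : 0 ≤ A) (hAκ : A ≤ 2 * κ) :
    ∫ t in (0 : ℝ)..A, singProfile κ T t ≤ 1 / (2 * κ) * (Real.log (κ ^ 2 / T₀) + 4) := by
  have hpos : ∀ t ∈ Set.Icc 0 A, 0 < 2 * T₀ + 2 * κ * t := fun t ht => by
    have := ht.1
    positivity
  have hi1 : IntervalIntegrable (fun t => 1 / (2 * T₀ + 2 * κ * t)) volume 0 A :=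
    ContinuousOn.intervalIntegrable (by
      rw [Set.uIcc_of_le hA]
      exact continuousOn_const.div (by fun_prop) fun t ht => (hpos t ht).ne')
  have hi2 : IntervalIntegrable (fun t => 2 * (2 * T₀) * (1 / (2 * T₀ + 2 * κ * t) ^ 2)) volume 0 A :=
    ContinuousOn.intervalIntegrable (by
      rw [Set.uIcc_of_le hA]
      exact continuousOn_const.mul (continuousOn_const.div (by fun_prop)
        fun t ht => pow_ne_zero 2 (hpos t ht).ne'))
  have h1 : ∫ t in (0 : ℝ)..A, singProfile κ T t ≤
      ∫ t in (0 : ℝ)..A, (1 / (2 * T₀ + 2 * κ * t) + 2 * (2 * T₀) * (1 / (2 * T₀ + 2 * κ * t) ^ 2)) := by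
    refine intervalIntegral.integral_mono_on hA
      ((continuous_singProfile (hT₀.trans_le hT)).intervalIntegrable _ _) (hi1.add hi2) fun t ht => ?_
    refine le_trans (one_div_le_one_div_of_le ?_ (max_le_max_right _ ?_))
      (one_div_max_le (by linarith) (mul_nonneg (by linarith) ht.1))
    · exact (by linarith : 0 < 2 * T₀).trans_le (le_max_left _ _)
    · linarith
  rw [intervalIntegral.integral_add hi1 hi2, intervalIntegral.integral_const_mul,
    integral_one_div_affine (by linarith) (by linarith) hA] at h1
  have h2 := integral_one_div_affine_sq_le (α := 2 * T₀) (β := 2 * κ) (A := A)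
    (by linarith) (by linarith) hA
  have h3 : 2 * (2 * T₀) * (1 / (2 * κ * (2 * T₀))) = 1 / (2 * κ) * 2 := by field_simp
  have h4 : 2 * (2 * T₀) * ∫ t in (0 : ℝ)..A, 1 / (2 * T₀ + 2 * κ * t) ^ 2 ≤ 1 / (2 * κ) * 2 := by
    rw [← h3]; gcongr
  have h5 : Real.log (1 + 2 * κ * A / (2 * T₀)) ≤ Real.log (κ ^ 2 / T₀) + 2 := by
    have h6 : 1 + 2 * κ * A / (2 * T₀) ≤ κ ^ 2 / T₀ * 3 := by
      have : 2 * κ * A ≤ 2 * κ * (2 * κ) := by gcongr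
      rw [show 1 + 2 * κ * A / (2 * T₀) = (2 * T₀ + 2 * κ * A) / (2 * T₀) by field_simp,
        div_mul_eq_mul_div, div_le_div_iff₀ (by positivity) hT₀]
      nlinarith
    have h7 := Real.log_le_log (by positivity) h6
    rw [Real.log_mul (by positivity) (by norm_num)] at h7
    have h8 := Real.log_le_sub_one_of_pos (show (0 : ℝ) < 3 by norm_num)
    linarith
  have h9 : 1 / (2 * κ) * Real.log (1 + 2 * κ * A / (2 * T₀)) ≤
      1 / (2 * κ) * (Real.log (κ ^ 2 / T₀) + 2) := by gcongr
  linarith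

theorem integral_two_pi_mul (F : ℝ → ℝ) :
    ∫ ζ, F (2 * Real.pi * ζ) = 1 / (2 * Real.pi) * ∫ k, F k := by
  rw [Measure.integral_comp_mul_left, abs_of_pos (by positivity), smul_eq_mul, one_div]

theorem integrable_two_pi_mul {F : ℝ → ℝ} (hF : Integrable F) :
    Integrable fun ζ => F (2 * Real.pi * ζ) :=
  hF.comp_mul_left' (by positivity)

theorem integrable_one_div_sq_add_sq {s : ℝ} (hs : 0 < s) :
    Integrable (fun k : ℝ => 1 / (s ^ 2 + k ^ 2)) ∧ ∫ k : ℝ, 1 / (s ^ 2 + k ^ 2) = Real.pi / s := by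
  have e : (fun k : ℝ => 1 / (s ^ 2 + k ^ 2)) = fun k => 1 / s ^ 2 * (1 + (s⁻¹ * k) ^ 2)⁻¹ := by
    funext k
    field_simp
  rw [e]
  constructor
  · exact (integrable_inv_one_add_sq.comp_mul_left' (inv_ne_zero hs.ne')).const_mul _
  · rw [integral_const_mul, Measure.integral_comp_mul_left (fun k : ℝ => (1 + k ^ 2)⁻¹),
      integral_univ_inv_one_add_sq, inv_inv, abs_of_pos hs, smul_eq_mul]
    field_simp

theorem integrable_tailW (hκ : 0 < κ) : Integrable (tailW κ) := by
  have := (integrable_one_div_sq_add_sq hκ).1.const_mul 80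
  refine this.congr (ae_of_all _ fun k => ?_)
  simp only [tailW]; ring

/-- The weights for the upper bounds on the temperatures, in the Fourier variable `ζ`. -/
def upperW (κ T c ζ : ℝ) : ℝ := singW κ T c (2 * Real.pi * ζ) + tailW κ (2 * Real.pi * ζ)

theorem upperW_pos (hκ : 0 < κ) (hT : 0 < T) (c ζ : ℝ) : 0 < upperW κ T c ζ :=
  add_pos_of_nonneg_of_pos (singW_nonneg hT c) (tailW_pos hκ)

theorem integrable_upperW (hκ : 0 < κ) (hT : 0 < T) (c : ℝ) : Integrable (upperW κ T c) := by
  refine (integrable_two_pi_mul ?_).add (integrable_two_pi_mul (integrable_tailW hκ))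
  rw [singW_eq_foldW]
  exact integrable_foldW (continuous_singProfile hT) κ c

theorem integral_upperW (hκ : 0 < κ) (hT : 0 < T) {c : ℝ} (hc : 0 ≤ c) (hcκ : c ≤ 2 * κ) :
    ∫ ζ, upperW κ T c ζ = 1 / Real.pi * ((∫ t in (0 : ℝ)..c, singProfile κ T t) +
      ∫ t in (0 : ℝ)..(2 * κ - c), singProfile κ T t) + ∫ ζ, tailW κ (2 * Real.pi * ζ) := by
  have h1 : Integrable fun ζ => singW κ T c (2 * Real.pi * ζ) := by
    rw [singW_eq_foldW]
    exact integrable_two_pi_mul (integrable_foldW (continuous_singProfile hT) κ c)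
  have h2 : Integrable fun ζ => tailW κ (2 * Real.pi * ζ) :=
    integrable_two_pi_mul (integrable_tailW hκ)
  have e : ∫ ζ, upperW κ T c ζ =
      (∫ ζ, singW κ T c (2 * Real.pi * ζ)) + ∫ ζ, tailW κ (2 * Real.pi * ζ) := integral_add h1 h2
  rw [e, integral_two_pi_mul (singW κ T c), singW_eq_foldW,
    integral_foldW (continuous_singProfile hT) hc hcκ]
  have := Real.pi_pos
  congr 1
  field_simp

theorem integral_upperW_near_le (hκ : 0 < κ) : ∃ C, ∀ T₀ T, 0 < T₀ → T₀ ≤ κ ^ 2 → T₀ ≤ T →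
    ∫ ζ, upperW κ T κ ζ ≤ 1 / (Real.pi * κ) * Real.log (κ ^ 2 / T₀) + C := by
  refine ⟨1 / (Real.pi * κ) * 4 + ∫ ζ, tailW κ (2 * Real.pi * ζ), fun T₀ T h0 h1 h2 => ?_⟩
  rw [integral_upperW hκ (h0.trans_le h2) hκ.le (by linarith), show 2 * κ - κ = κ by ring]
  have h := integral_singProfile_le hκ h0 h1 h2 hκ.le (by linarith)
  have e : 1 / Real.pi * (1 / (2 * κ) * (Real.log (κ ^ 2 / T₀) + 4) +
      1 / (2 * κ) * (Real.log (κ ^ 2 / T₀) + 4)) =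
      1 / (Real.pi * κ) * Real.log (κ ^ 2 / T₀) + 1 / (Real.pi * κ) * 4 := by
    have := Real.pi_pos
    field_simp
    ring
  have h3 := mul_le_mul_of_nonneg_left (add_le_add h h) (show 0 ≤ 1 / Real.pi by positivity)
  linarith

theorem integral_upperW_far_le (hκ : 0 < κ) : ∃ C, ∀ T₀ T, 0 < T₀ → T₀ ≤ κ ^ 2 → T₀ ≤ T →
    ∫ ζ, upperW κ T 0 ζ ≤ 1 / (2 * Real.pi * κ) * Real.log (κ ^ 2 / T₀) + C := by
  refine ⟨1 / (2 * Real.pi * κ) * 4 + ∫ ζ, tailW κ (2 * Real.pi * ζ), fun T₀ T h0 h1 h2 => ?_⟩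
  rw [integral_upperW hκ (h0.trans_le h2) le_rfl (by linarith), intervalIntegral.integral_same,
    zero_add, sub_zero]
  have h := integral_singProfile_le hκ h0 h1 h2 (by linarith) (le_refl (2 * κ))
  have e : 1 / Real.pi * (1 / (2 * κ) * (Real.log (κ ^ 2 / T₀) + 4)) =
      1 / (2 * Real.pi * κ) * Real.log (κ ^ 2 / T₀) + 1 / (2 * Real.pi * κ) * 4 := by
    have := Real.pi_pos
    field_simp
  have h3 := mul_le_mul_of_nonneg_left h (show 0 ≤ 1 / Real.pi by positivity)
  linarith

theorem cutDist_le (c ζ : ℝ) : cutDist c ζ ≤ |(|2 * Real.pi * ζ| - c)| := by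
  rw [abs_mul, abs_of_pos (show 0 < 2 * Real.pi by positivity)]
  exact min_le_right _ _

/-- A weight whose singularity is at most `1 / d`, integrated against the distance `d`. -/
theorem integral_cutDist_foldW_le {φ : ℝ → ℝ} (hφ : Continuous φ) (hφ0 : ∀ t, 0 ≤ t → 0 ≤ φ t)
    (hκ : 0 < κ) (hφ1 : ∀ t, 0 ≤ t → t * φ t ≤ 1 / (2 * κ)) (c : ℝ) :
    ∫ ζ, cutDist c ζ * foldW κ c φ (2 * Real.pi * ζ) ≤ 1 / Real.pi := by
  have h1 : Integrable fun ζ => cutDist c ζ * foldW κ c φ (2 * Real.pi * ζ) :=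
    integrable_cutDist_mul (integrable_two_pi_mul (integrable_foldW hφ κ c)) c
  have h2 : ∫ ζ, foldW κ c (fun _ => 1 / (2 * κ)) (2 * Real.pi * ζ) = 1 / Real.pi := by
    rw [integral_two_pi_mul]
    have : foldW κ c (fun _ => 1 / (2 * κ)) = foldW κ 0 (fun _ => 1 / (2 * κ)) := rfl
    rw [this, integral_foldW continuous_const le_rfl (by linarith)]
    have := Real.pi_pos
    simp
    field_simp
  rw [← h2]
  refine integral_mono h1 (integrable_two_pi_mul (integrable_foldW continuous_const κ c)) fun ζ => ?_
  simp only
  rcases le_or_gt |2 * Real.pi * ζ| (2 * κ) with h | h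
  · rw [foldW_of_mem c _ h, foldW_of_mem c _ h]
    exact (mul_le_mul_of_nonneg_right (cutDist_le c ζ) (hφ0 _ (abs_nonneg _))).trans
      (hφ1 _ (abs_nonneg _))
  · rw [foldW_of_notMem c _ h, foldW_of_notMem c _ h, mul_zero]

/-- The distance to ±c cancels the singularity, which leaves a constant independent of T; the error
terms therefore never see the logarithm. -/
theorem integral_cutDist_upperW_le (hκ : 0 < κ) :
    ∃ C₁, 0 < C₁ ∧ ∀ T, 0 < T → ∀ c, ∫ ζ, cutDist c ζ * upperW κ T c ζ ≤ C₁ := by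
  have h0 : 0 ≤ ∫ ζ, tailW κ (2 * Real.pi * ζ) := integral_nonneg fun ζ => (tailW_pos hκ).le
  refine ⟨1 / Real.pi + ∫ ζ, tailW κ (2 * Real.pi * ζ), by positivity, fun T hT c => ?_⟩
  have h1 : Integrable fun ζ => singW κ T c (2 * Real.pi * ζ) := by
    rw [singW_eq_foldW]
    exact integrable_two_pi_mul (integrable_foldW (continuous_singProfile hT) κ c)
  have h2 : Integrable fun ζ => tailW κ (2 * Real.pi * ζ) :=
    integrable_two_pi_mul (integrable_tailW hκ)
  have e : ∫ ζ, cutDist c ζ * upperW κ T c ζ = (∫ ζ, cutDist c ζ * singW κ T c (2 * Real.pi * ζ)) +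
      ∫ ζ, cutDist c ζ * tailW κ (2 * Real.pi * ζ) := by
    rw [← integral_add (integrable_cutDist_mul h1 c) (integrable_cutDist_mul h2 c)]
    exact integral_congr_ae (ae_of_all _ fun ζ => mul_add _ _ _)
  rw [e]
  refine add_le_add ?_ (integral_mono (integrable_cutDist_mul h2 c) h2 fun ζ =>
    mul_le_of_le_one_left (tailW_pos hκ).le (cutDist_le_one c ζ))
  rw [singW_eq_foldW]
  refine integral_cutDist_foldW_le (continuous_singProfile hT) (fun t _ => ?_) hκ (fun t ht => ?_) c
  · exact one_div_nonneg.mpr (le_max_of_le_left (by linarith))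
  · have hm : 0 < max (2 * T) (2 * κ * t) := (by linarith : 0 < 2 * T).trans_le (le_max_left _ _)
    rw [singProfile, mul_one_div, div_le_div_iff₀ hm (by positivity)]
    linarith [le_max_right (2 * T) (2 * κ * t)]

theorem integrable_exp_neg_mul_abs {b : ℝ} (hb : 0 < b) :
    Integrable (fun k : ℝ => Real.exp (-(b * |k|))) ∧ ∫ k : ℝ, Real.exp (-(b * |k|)) = 2 / b := by
  have e : ∫ k : ℝ, Real.exp (-(b * |k|)) = 2 / b := by
    have h := integral_comp_abs (f := fun x => Real.exp (-b * x))
    rw [integral_exp_mul_Ioi (by linarith) 0] at h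
    simp only [neg_mul] at h
    rw [h]
    simp
    ring
  -- A non-integrable function has integral 0 by convention, so the nonzero value proves
  -- integrability.
  exact ⟨Integrable.of_integral_ne_zero (by rw [e]; positivity), e⟩

/-- In the variable k the exponential contributes 8/|P|. The plateau has height 3/(2s) and width
8s/|P|, so its contribution is at most 12/|P| whatever s is. No logarithm of T appears. -/
theorem integral_farW_le (hκ : 0 < κ) : ∃ B, 0 < B ∧ ∀ T P, 0 < T → κ / 2 ≤ |P| →
    Integrable (fun ζ => farW κ T P (2 * Real.pi * ζ)) ∧
      ∫ ζ, farW κ T P (2 * Real.pi * ζ) ≤ B := by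
  have h0 : 0 ≤ ∫ k, tailW κ k := integral_nonneg fun ζ => (tailW_pos hκ).le
  have hpi := Real.pi_pos
  refine ⟨1 / (2 * Real.pi) * (40 / κ + ∫ k, tailW κ k), by positivity, fun T P hT hP => ?_⟩
  have hq : 0 < |P| := by linarith
  set s := |κ ^ 2 - P ^ 2 / 4| with hs
  have hs0 : 0 ≤ s := abs_nonneg _
  obtain ⟨hi1, he1⟩ := integrable_exp_neg_mul_abs (b := |P| / (2 * T)) (by positivity)
  have hi1' := hi1.const_mul (2 / T)
  have hi2 : Integrable (Set.indicator (Set.Icc (-(4 * s / |P|)) (4 * s / |P|))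
      (fun _ : ℝ => 3 / (2 * s))) :=
    (integrable_indicator_iff measurableSet_Icc).mpr (by simp)
  have hi3 := integrable_tailW hκ
  have hi : Integrable (farW κ T P) := (hi1'.add hi2).add hi3
  have hI : ∫ k, farW κ T P k = 2 / T * (2 / (|P| / (2 * T))) +
      (8 * s / |P|) * (3 / (2 * s)) + ∫ k, tailW κ k := by
    have e : ∫ k, farW κ T P k = (∫ k, 2 / T * Real.exp (-(|P| / (2 * T) * |k|))) +
        (∫ k, Set.indicator (Set.Icc (-(4 * s / |P|)) (4 * s / |P|)) (fun _ : ℝ => 3 / (2 * s)) k) +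
          ∫ k, tailW κ k := by
      have e1 := integral_add hi1' hi2
      have e2 := integral_add (hi1'.add hi2) hi3
      rw [← e1]
      exact e2
    rw [e, integral_const_mul, he1, integral_indicator measurableSet_Icc, setIntegral_const,
      Real.volume_real_Icc_of_le (by linarith [show 0 ≤ 4 * s / |P| by positivity]), smul_eq_mul]
    ring
  refine ⟨integrable_two_pi_mul hi, ?_⟩
  rw [integral_two_pi_mul, hI]
  refine mul_le_mul_of_nonneg_left (add_le_add_left ?_ _) (by positivity)
  have h1 : 2 / T * (2 / (|P| / (2 * T))) = 8 / |P| := by field_simp; norm_num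
  have h2 : (8 * s / |P|) * (3 / (2 * s)) ≤ 12 / |P| := by
    rcases hs0.eq_or_lt with h | h
    · rw [← h]; simp; positivity
    · apply le_of_eq; field_simp; norm_num
  have h3 : 20 / |P| ≤ 40 / κ := by
    rw [div_le_div_iff₀ hq hκ]; linarith
  have e : 8 / |P| + 12 / |P| = 20 / |P| := by ring
  linarith

/-- The profile of the test functions for the lower bounds on the temperatures. -/
def testProfile (κ T t : ℝ) : ℝ := 1 / (2 * κ * |t| + t ^ 2 + 4 * T)

theorem continuous_testProfile (hκ : 0 < κ) (hT : 0 < T) : Continuous (testProfile κ T) :=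
  continuous_const.div (by fun_prop) fun t => by positivity

theorem testProfile_pos (hκ : 0 < κ) (hT : 0 < T) (t : ℝ) : 0 < testProfile κ T t := by
  rw [testProfile]; positivity

/-- The relative wave function of the test functions for the lower bounds. -/
def lowerW (κ T c ζ : ℝ) : ℝ := foldW κ c (testProfile κ T) (2 * Real.pi * ζ)

theorem lowerW_nonneg (hκ : 0 < κ) (hT : 0 < T) (c ζ : ℝ) : 0 ≤ lowerW κ T c ζ :=
  Set.indicator_nonneg (fun _ _ => (testProfile_pos hκ hT _).le) _

theorem lowerW_neg (κ T c ζ : ℝ) : lowerW κ T c (-ζ) = lowerW κ T c ζ := by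
  rw [lowerW, mul_neg, foldW_neg, lowerW]

theorem measurable_lowerW (hκ : 0 < κ) (hT : 0 < T) (c : ℝ) : Measurable (lowerW κ T c) :=
  (measurable_foldW (continuous_testProfile hκ hT) κ c).comp (by fun_prop)

theorem lowerW_le (hκ : 0 < κ) (hT : 0 < T) (c ζ : ℝ) : lowerW κ T c ζ ≤ 1 / (4 * T) := by
  rw [lowerW]
  rcases le_or_gt |2 * Real.pi * ζ| (2 * κ) with h | h
  · rw [foldW_of_mem c _ h, testProfile]
    refine one_div_le_one_div_of_le (by positivity) ?_
    have : 0 ≤ 2 * κ * |(|(|2 * Real.pi * ζ| - c)|)| + |(|2 * Real.pi * ζ| - c)| ^ 2 := by positivity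
    linarith
  · rw [foldW_of_notMem c _ h]; positivity

theorem nice_lowerW (hκ : 0 < κ) (hT : 0 < T) (c : ℝ) :
    Nice (fun ζ => (lowerW κ T c ζ : ℂ)) (1 / (4 * T)) κ where
  meas := Complex.measurable_ofReal.comp (measurable_lowerW hκ hT c)
  bound ζ := by
    rw [Complex.norm_real, Real.norm_of_nonneg (lowerW_nonneg hκ hT c ζ)]
    exact lowerW_le hκ hT c ζ
  supp ζ h := by
    rw [lowerW, foldW_of_notMem, Complex.ofReal_zero]
    rw [Real.norm_eq_abs] at h
    rw [abs_mul, abs_of_pos (show 0 < 2 * Real.pi by positivity)]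
    have := Real.pi_gt_three
    nlinarith

theorem integrable_lowerW (hκ : 0 < κ) (hT : 0 < T) (c : ℝ) : Integrable (lowerW κ T c) :=
  integrable_two_pi_mul (integrable_foldW (continuous_testProfile hκ hT) κ c)

theorem integral_cutDist_lowerW_le (hκ : 0 < κ) (hT : 0 < T) (c : ℝ) :
    ∫ ζ, cutDist c ζ * lowerW κ T c ζ ≤ 1 / Real.pi := by
  refine integral_cutDist_foldW_le (continuous_testProfile hκ hT)
    (fun t _ => (testProfile_pos hκ hT t).le) hκ (fun t ht => ?_) c
  rw [testProfile, abs_of_nonneg ht, mul_one_div, div_le_div_iff₀ (by positivity) (by positivity)]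
  nlinarith [sq_nonneg t]

/-- Dropping t² from the denominator costs at most t²/(2κt)² = 1/(4κ²) pointwise. The loss of 2 is
shared by this error and by log(1/2) ≥ −1. -/
theorem le_integral_testProfile (hκ : 0 < κ) (hT : 0 < T) (hA : κ ≤ A) (hAκ : A ≤ 2 * κ) :
    1 / (2 * κ) * (Real.log (κ ^ 2 / T) - 2) ≤ ∫ t in (0 : ℝ)..A, testProfile κ T t := by
  have hA0 : 0 ≤ A := hκ.le.trans hA
  have hpos : ∀ t ∈ Set.Icc 0 A, 0 < 4 * T + 2 * κ * t := fun t ht => by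
    have := ht.1
    positivity
  have hi1 : IntervalIntegrable (fun t => 1 / (4 * T + 2 * κ * t)) volume 0 A :=
    ContinuousOn.intervalIntegrable (by
      rw [Set.uIcc_of_le hA0]
      exact continuousOn_const.div (by fun_prop) fun t ht => (hpos t ht).ne')
  have hi2 : IntervalIntegrable (fun _ : ℝ => 1 / (4 * κ ^ 2)) volume 0 A := intervalIntegrable_const
  have h1 : ∫ t in (0 : ℝ)..A, (1 / (4 * T + 2 * κ * t) - 1 / (4 * κ ^ 2)) ≤
      ∫ t in (0 : ℝ)..A, testProfile κ T t := by
    refine intervalIntegral.integral_mono_on hA0 (hi1.sub hi2)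
      ((continuous_testProfile hκ hT).intervalIntegrable _ _) fun t ht => ?_
    have ht0 := ht.1
    have hp := hpos t ht
    rw [testProfile, abs_of_nonneg ht0]
    have hp2 : 0 < 2 * κ * t + t ^ 2 + 4 * T := by positivity
    rw [sub_le_iff_le_add, div_add_div _ _ hp2.ne' (by positivity), div_le_div_iff₀ hp (by positivity)]
    have h2 : (2 * κ * t) ^ 2 ≤ (4 * T + 2 * κ * t) ^ 2 := by gcongr; linarith
    have h3 : (4 * T + 2 * κ * t) * (4 * T + 2 * κ * t) ≤
        (2 * κ * t + t ^ 2 + 4 * T) * (4 * T + 2 * κ * t) := by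
      nlinarith [mul_nonneg (sq_nonneg t) hp.le]
    nlinarith
  rw [intervalIntegral.integral_sub hi1 hi2, integral_one_div_affine (by positivity) (by positivity) hA0,
    intervalIntegral.integral_const, smul_eq_mul, sub_zero] at h1
  have h2 : A * (1 / (4 * κ ^ 2)) ≤ 1 / (2 * κ) := by
    rw [mul_one_div, div_le_div_iff₀ (by positivity) (by positivity)]; nlinarith
  have h3 : Real.log (κ ^ 2 / T) - 1 ≤ Real.log (1 + 2 * κ * A / (4 * T)) := by
    have h4 : κ ^ 2 / T * (1 / 2) ≤ 1 + 2 * κ * A / (4 * T) := by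
      have : κ * κ ≤ κ * A := by gcongr
      rw [show 1 + 2 * κ * A / (4 * T) = (4 * T + 2 * κ * A) / (4 * T) by field_simp,
        div_mul_eq_mul_div, div_le_div_iff₀ hT (by positivity)]
      nlinarith
    have h5 := Real.log_le_log (by positivity) h4
    rw [Real.log_mul (by positivity) (by norm_num)] at h5
    have h6 := Real.one_sub_inv_le_log_of_pos (show (0 : ℝ) < 1 / 2 by norm_num)
    norm_num at h6
    norm_num at h5
    linarith
  have h7 : 1 / (2 * κ) * (Real.log (κ ^ 2 / T) - 1) ≤
      1 / (2 * κ) * Real.log (1 + 2 * κ * A / (4 * T)) := by gcongr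
  linarith

theorem integral_lowerW (hκ : 0 < κ) (hT : 0 < T) {c : ℝ} (hc : 0 ≤ c) (hcκ : c ≤ 2 * κ) :
    ∫ ζ, lowerW κ T c ζ = 1 / Real.pi * ((∫ t in (0 : ℝ)..c, testProfile κ T t) +
      ∫ t in (0 : ℝ)..(2 * κ - c), testProfile κ T t) := by
  have e : ∫ ζ, lowerW κ T c ζ = 1 / (2 * Real.pi) * ∫ k, foldW κ c (testProfile κ T) k :=
    integral_two_pi_mul _
  rw [e, integral_foldW (continuous_testProfile hκ hT) hc hcκ]
  have := Real.pi_pos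
  field_simp

theorem le_integral_lowerW_near (hκ : 0 < κ) (hT : 0 < T) :
    1 / (Real.pi * κ) * (Real.log (κ ^ 2 / T) - 2) ≤ ∫ ζ, lowerW κ T κ ζ := by
  rw [integral_lowerW hκ hT hκ.le (by linarith), show 2 * κ - κ = κ by ring]
  have h := le_integral_testProfile hκ hT le_rfl (by linarith)
  have h3 := mul_le_mul_of_nonneg_left (add_le_add h h) (show 0 ≤ 1 / Real.pi by positivity)
  refine le_trans (le_of_eq ?_) h3
  have := Real.pi_pos
  field_simp
  ring

theorem le_integral_lowerW_far (hκ : 0 < κ) (hT : 0 < T) :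
    1 / (2 * Real.pi * κ) * (Real.log (κ ^ 2 / T) - 2) ≤ ∫ ζ, lowerW κ T 0 ζ := by
  rw [integral_lowerW hκ hT le_rfl (by linarith), intervalIntegral.integral_same, zero_add, sub_zero]
  have h := le_integral_testProfile hκ hT (show κ ≤ 2 * κ by linarith) le_rfl
  have h3 := mul_le_mul_of_nonneg_left h (show 0 ≤ 1 / Real.pi by positivity)
  refine le_trans (le_of_eq ?_) h3
  have := Real.pi_pos
  field_simp

end WeightIntegrals
/-! ### The weak-coupling constants -/

section Constants

variable {V : ℝ → ℝ}

theorem integrable_mul_cos (hV : Integrable V) (p : ℝ) :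
    Integrable fun r => V r * Real.cos (p * r) :=
  hV.mul_bdd (c := 1) (by fun_prop) (ae_of_all _ fun r => by
    rw [Real.norm_eq_abs]; exact Real.abs_cos_le_one _)

theorem integrable_mul_sin (hV : Integrable V) (p : ℝ) :
    Integrable fun r => V r * Real.sin (p * r) :=
  hV.mul_bdd (c := 1) (by fun_prop) (ae_of_all _ fun r => by
    rw [Real.norm_eq_abs]; exact Real.abs_sin_le_one _)

theorem VHat_eq (hV : Integrable V) (hev : ∀ r, V (-r) = V r) (p : ℝ) :
    VHat V p = ((1 / Real.sqrt (2 * Real.pi) * ∫ r, V r * Real.cos (p * r) : ℝ) : ℂ) := by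
  have h0 : ∫ r, V r * Real.sin (p * r) = 0 := by
    have h := integral_neg_eq_self (fun r => V r * Real.sin (p * r)) volume
    simp only [hev, mul_neg, Real.sin_neg, integral_neg] at h
    linarith
  have e : ∀ r : ℝ, Complex.exp (-Complex.I * (p : ℂ) * (r : ℂ)) * (V r : ℂ) =
      ((V r * Real.cos (p * r) : ℝ) : ℂ) - Complex.I * ((V r * Real.sin (p * r) : ℝ) : ℂ) := by
    intro r
    rw [show -Complex.I * (p : ℂ) * (r : ℂ) = ((-(p * r) : ℝ) : ℂ) * Complex.I by push_cast; ring,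
      Complex.exp_mul_I, ← Complex.ofReal_cos, ← Complex.ofReal_sin, Real.cos_neg, Real.sin_neg]
    push_cast
    ring
  rw [VHat]
  simp only [e]
  have h1 : Integrable fun r => ((V r * Real.cos (p * r) : ℝ) : ℂ) :=
    (integrable_mul_cos hV p).ofReal
  have h2 : Integrable fun r => Complex.I * ((V r * Real.sin (p * r) : ℝ) : ℂ) :=
    (integrable_mul_sin hV p).ofReal.const_mul Complex.I
  rw [integral_sub h1 h2, integral_const_mul, integral_complex_ofReal, integral_complex_ofReal, h0,
    Complex.ofReal_zero, mul_zero, sub_zero, Complex.ofReal_mul]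

theorem VHat_zero_re (hV : Integrable V) (hev : ∀ r, V (-r) = V r) :
    (VHat V 0).re = 1 / Real.sqrt (2 * Real.pi) * ∫ r, V r := by
  rw [VHat_eq hV hev, Complex.ofReal_re]
  simp

theorem eS0_eq (hV : Integrable V) (hev : ∀ r, V (-r) = V r) :
    eS0 V = cosMoment V 0 / Real.pi := by
  have hpi := Real.pi_pos
  have hs : Real.sqrt (2 * Real.pi) ^ 2 = 2 * Real.pi := Real.sq_sqrt (by positivity)
  have hs0 : 0 < Real.sqrt (2 * Real.pi) := Real.sqrt_pos.mpr (by positivity)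
  have hc : cosMoment V 0 = ∫ r, V r := by simp [cosMoment]
  rw [eS0, VHat_zero_re hV hev, hc, div_eq_div_iff hs0.ne' hpi.ne']
  field_simp
  rw [hs]

/-- cos²(κr) = (1 + cos 2κr)/2 merges the two Fourier coefficients into the moment that appears in
the fibre estimates. -/
theorem VHat_zero_add (hV : Integrable V) (hev : ∀ r, V (-r) = V r) (κ : ℝ) :
    ((1 / Real.sqrt (2 * Real.pi) : ℝ) : ℂ) * (VHat V 0 + VHat V (2 * κ)) =
      ((cosMoment V κ / Real.pi : ℝ) : ℂ) := by
  have hpi := Real.pi_pos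
  have hs : Real.sqrt (2 * Real.pi) ^ 2 = 2 * Real.pi := Real.sq_sqrt (by positivity)
  have hs0 : 0 < Real.sqrt (2 * Real.pi) := Real.sqrt_pos.mpr (by positivity)
  have hc : cosMoment V κ = 1 / 2 * ((∫ r, V r * Real.cos (0 * r)) +
      ∫ r, V r * Real.cos (2 * κ * r)) := by
    rw [cosMoment, ← integral_add (integrable_mul_cos hV 0) (integrable_mul_cos hV _),
      ← integral_const_mul]
    refine integral_congr_ae (ae_of_all _ fun r => ?_)
    simp only
    rw [Real.cos_sq, zero_mul, Real.cos_zero, mul_assoc]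
    ring
  rw [VHat_eq hV hev, VHat_eq hV hev, ← Complex.ofReal_add, ← Complex.ofReal_mul, ← mul_add, hc,
    Complex.ofReal_inj, ← mul_assoc, div_mul_div_comm, one_mul, ← sq, hs]
  field_simp

theorem VHat_neg (hV : Integrable V) (hev : ∀ r, V (-r) = V r) (p : ℝ) :
    VHat V (-p) = VHat V p := by
  rw [VHat_eq hV hev, VHat_eq hV hev]
  simp only [neg_mul, Real.cos_neg]

/-- Even functions on two points are constant, so the operator acts on them as a scalar and its
spectrum there is a single point. -/
theorem sphereOperator_even (hV : Integrable V) (hev : ∀ r, V (-r) = V r) (μ : ℝ)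
    {f : SphereL2} (hf : f ∈ sphereEven) :
    sphereOperator μ V f = ((cosMoment V (Real.sqrt μ) / Real.pi : ℝ) : ℂ) • f := by
  have h1 : f (-1) = f 1 := hf 1
  rw [← VHat_zero_add hV hev]
  ext p
  have e : (sphereOperator μ V f) p = ∑ q : ℤˣ, ((1 / Real.sqrt (2 * Real.pi) : ℝ) : ℂ) *
      VHat V (Real.sqrt μ * (((p : ℤ) : ℝ) - ((q : ℤ) : ℝ))) * f q := rfl
  rw [e, UnitsInt.univ, Finset.sum_pair (by decide), PiLp.smul_apply, smul_eq_mul, h1]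
  rcases Int.units_eq_one_or p with rfl | rfl
  · have e1 : Real.sqrt μ * ((((1 : ℤˣ) : ℤ) : ℝ) - (((-1 : ℤˣ) : ℤ) : ℝ)) = 2 * Real.sqrt μ := by
      push_cast; ring
    rw [e1, sub_self, mul_zero]
    ring
  · have e1 : Real.sqrt μ * ((((-1 : ℤˣ) : ℤ) : ℝ) - (((1 : ℤˣ) : ℤ) : ℝ)) =
        -(2 * Real.sqrt μ) := by
      push_cast; ring
    rw [e1, sub_self, mul_zero, h1, VHat_neg hV hev]
    ring

theorem eS_eq (hV : Integrable V) (hev : ∀ r, V (-r) = V r) (μ : ℝ) :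
    eS μ V = cosMoment V (Real.sqrt μ) / Real.pi := by
  set e := cosMoment V (Real.sqrt μ) / Real.pi with he
  have h : {t : ℝ | (t : ℂ) ∈ spectrumOn {z | z.2 = sphereOperator μ V z.1} sphereEven} = {e} := by
    ext t
    rw [Set.mem_ofPred_eq, Set.mem_singleton_iff, spectrumOn, Set.mem_ofPred_eq]
    constructor
    · intro h
      by_contra hne
      have hne' : (e : ℂ) - (t : ℂ) ≠ 0 := by
        rw [← Complex.ofReal_sub, Complex.ofReal_ne_zero]
        exact sub_ne_zero.mpr (Ne.symm hne)
      refine h ⟨((e : ℂ) - t)⁻¹ • ContinuousLinearMap.id ℂ _, fun g f => ?_⟩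
      rw [Set.mem_ofPred_eq, sphereOperator_even hV hev μ f.2, ← he]
      rw [_root_.smul_apply, ContinuousLinearMap.id_apply,
        inv_smul_eq_iff₀ hne', Subtype.ext_iff, Submodule.coe_smul, sub_smul, eq_sub_iff_add_eq,
        eq_comm]
    · rintro rfl ⟨R, hR⟩
      have hone : (WithLp.toLp 2 (fun _ => 1) : SphereL2) ∈ sphereEven := fun p => rfl
      have h0 := (hR 0 ⟨_, hone⟩).mpr (by
        rw [Set.mem_ofPred_eq, sphereOperator_even hV hev μ hone, ← he]
        simp)
      rw [map_zero] at h0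
      have h1 := congrArg (fun f : sphereEven => (f : SphereL2) 1) h0
      simp at h1
  rw [eS, h, csSup_singleton]

end Constants
/-! ### The symbols on the fibres of constant total momentum -/

section Symbols

/-- The momenta with total momentum `P` and relative momentum `k`. -/
def momenta (P k : ℝ) : Plane := momMap (P, k)

theorem two_pi_smul_momMap (η ζ : ℝ) : (2 * Real.pi) • momMap (η, ζ) =
    momenta (2 * Real.pi * η) (2 * Real.pi * ζ) := by
  ext i
  fin_cases i
  · change (2 * Real.pi) * momMap (η, ζ) 0 = momMap (2 * Real.pi * η, 2 * Real.pi * ζ) 0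
    rw [momMap_zero, momMap_zero]; ring
  · change (2 * Real.pi) * momMap (η, ζ) 1 = momMap (2 * Real.pi * η, 2 * Real.pi * ζ) 1
    rw [momMap_one, momMap_one]; ring

/-- The properties of the symbols of `L_T` and `D_T` from which the operators are defined. -/
structure IsSymbol (κ T : ℝ) (m : Plane → ℝ) : Prop where
  meas : Measurable m
  nonneg : ∀ p, 0 ≤ m p
  symm : ∀ p, m (exchange p) = m p
  ge : ∀ P, ∀ᵐ k : ℝ, 2 * T ≤ m (momenta P k) ∧
    |k ^ 2 + P ^ 2 / 4 - κ ^ 2| ≤ m (momenta P k) ∧ |P * k| ≤ m (momenta P k)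

theorem symbolL_momenta (κ T P k : ℝ) : symbolL (κ ^ 2) T (momenta P k) =
    energyL T ((P / 2 + k) ^ 2 - κ ^ 2) ((P / 2 - k) ^ 2 - κ ^ 2) := by
  rw [symbolL, hSymbol, hSymbol, momenta, momMap_zero, momMap_one, energyL]

theorem symbolD_momenta (κ T P k : ℝ) : symbolD (κ ^ 2) T (momenta P k) =
    energyD T ((P / 2 + k) ^ 2 - κ ^ 2) ((P / 2 - k) ^ 2 - κ ^ 2) := by
  rw [symbolD, hSymbol, hSymbol, momenta, momMap_zero, momMap_one, energyD]

theorem ae_sq_ne (a s : ℝ) : ∀ᵐ k : ℝ, (a + k) ^ 2 ≠ s := by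
  have h : {k : ℝ | (a + k) ^ 2 = s} ⊆ {Real.sqrt s - a, -Real.sqrt s - a} := by
    intro k hk
    have h1 : |a + k| = Real.sqrt s := by
      rw [← Set.mem_ofPred_eq.mp hk, Real.sqrt_sq_eq_abs]
    rcases eq_or_eq_neg_of_abs_eq h1 with h2 | h2
    · left; linarith
    · right; rw [Set.mem_singleton_iff]; linarith
  refine measure_mono_null ?_ ((Set.toFinite _).measure_zero volume) (t := {Real.sqrt s - a, -Real.sqrt s - a})
  intro k hk
  exact h (not_not.mp hk)

/-- Each fibre has finitely many momenta where a symbol is 0/0 and takes the conventional value 0.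
The lower bounds on the symbols can fail only there. -/
theorem ae_momenta_ne (κ P : ℝ) : ∀ᵐ k : ℝ, k ≠ 0 ∧ k ^ 2 + P ^ 2 / 4 - κ ^ 2 ≠ 0 ∧
    (P / 2 + k) ^ 2 - κ ^ 2 ≠ 0 ∧ (P / 2 - k) ^ 2 - κ ^ 2 ≠ 0 := by
  filter_upwards [ae_sq_ne 0 0, ae_sq_ne 0 (κ ^ 2 - P ^ 2 / 4), ae_sq_ne (P / 2) (κ ^ 2),
    ae_sq_ne (-(P / 2)) (κ ^ 2)] with k h0 h1 h2 h3
  refine ⟨fun h => h0 (by rw [h]; ring), fun h => h1 (by linarith), sub_ne_zero.mpr h2,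
    sub_ne_zero.mpr fun h => h3 (by rw [← h]; ring)⟩

theorem symbol_sum_diff (κ P k : ℝ) :
    |((P / 2 + k) ^ 2 - κ ^ 2) + ((P / 2 - k) ^ 2 - κ ^ 2)| / 2 = |k ^ 2 + P ^ 2 / 4 - κ ^ 2| ∧
    |((P / 2 + k) ^ 2 - κ ^ 2) - ((P / 2 - k) ^ 2 - κ ^ 2)| / 2 = |P * k| := by
  constructor
  · rw [show ((P / 2 + k) ^ 2 - κ ^ 2) + ((P / 2 - k) ^ 2 - κ ^ 2) =
      2 * (k ^ 2 + P ^ 2 / 4 - κ ^ 2) by ring, abs_mul, abs_two]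
    ring
  · rw [show ((P / 2 + k) ^ 2 - κ ^ 2) - ((P / 2 - k) ^ 2 - κ ^ 2) = 2 * (P * k) by ring, abs_mul,
      abs_two]
    ring

theorem measurable_tanh : Measurable Real.tanh := by
  have : Real.tanh = fun x => Real.sinh x / Real.cosh x := by
    funext x; exact Real.tanh_eq_sinh_div_cosh x
  rw [this]
  exact Real.measurable_sinh.div Real.measurable_cosh

theorem measurable_hSymbol (μ : ℝ) (i : Fin 2) : Measurable fun p : Plane => hSymbol μ (p i) := by
  unfold hSymbol; fun_prop

theorem isSymbolL (κ : ℝ) {T : ℝ} (hT : 0 < T) : IsSymbol κ T (symbolL (κ ^ 2) T) where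
  meas := by
    have h0 := measurable_hSymbol (κ ^ 2) 0
    have h1 := measurable_hSymbol (κ ^ 2) 1
    exact (h0.add h1).div ((measurable_tanh.comp (h0.div_const _)).add
      (measurable_tanh.comp (h1.div_const _)))
  nonneg p := energyL_nonneg hT _ _
  symm p := by
    rw [symbolL, symbolL, exchange_apply_zero, exchange_apply_one, add_comm (hSymbol _ (p 1)),
      add_comm (Real.tanh (hSymbol _ (p 1) / _))]
  ge P := by
    filter_upwards [ae_momenta_ne κ P] with k hk
    rw [symbolL_momenta]
    have h := energyL_ge hT ((P / 2 + k) ^ 2 - κ ^ 2) ((P / 2 - k) ^ 2 - κ ^ 2) (by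
      intro h; apply hk.2.1; linarith)
    rwa [(symbol_sum_diff κ P k).1, (symbol_sum_diff κ P k).2] at h

theorem isSymbolD (κ : ℝ) {T : ℝ} (hT : 0 < T) : IsSymbol κ T (symbolD (κ ^ 2) T) where
  meas := by
    have h0 := measurable_hSymbol (κ ^ 2) 0
    have h1 := measurable_hSymbol (κ ^ 2) 1
    exact ((h0.div (measurable_tanh.comp (h0.div_const _))).const_mul _).add
      ((h1.div (measurable_tanh.comp (h1.div_const _))).const_mul _)
  nonneg p := energyD_nonneg hT _ _
  symm p := by
    rw [symbolD, symbolD, exchange_apply_zero, exchange_apply_one, add_comm]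
  ge P := by
    filter_upwards [ae_momenta_ne κ P] with k hk
    rw [symbolD_momenta]
    have h := energyD_ge hT ((P / 2 + k) ^ 2 - κ ^ 2) ((P / 2 - k) ^ 2 - κ ^ 2) hk.2.2.1 hk.2.2.2
    rwa [(symbol_sum_diff κ P k).1, (symbol_sum_diff κ P k).2] at h

theorem ae_two_pi_mul {p : ℝ → Prop} (h : ∀ᵐ k : ℝ, p k) : ∀ᵐ ζ : ℝ, p (2 * Real.pi * ζ) := by
  have hq : Measure.QuasiMeasurePreserving (fun ζ : ℝ => 2 * Real.pi * ζ) volume volume := by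
    refine ⟨by fun_prop, ?_⟩
    rw [Real.map_volume_mul_left (by positivity)]
    exact Measure.smul_absolutelyContinuous
  exact hq.ae h

end Symbols

/-! ### The form domain -/

section Bound

variable {κ T : ℝ} {m : Plane → ℝ} {V : ℝ → ℝ}

theorem aestronglyMeasurable_comp_diff (hV : AEStronglyMeasurable V) :
    AEStronglyMeasurable (fun x : Plane => V (x 0 - x 1)) volume := by
  rw [← measurePreserving_posMap.aestronglyMeasurable_comp_iff
    (measurableEmbedding_planeMap (by norm_num))]
  have : (fun x : Plane => V (x 0 - x 1)) ∘ posMap = fun z : ℝ × ℝ => V z.2 := by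
    funext z; simp only [Function.comp]; rw [← posMap_diff z.1 z.2]
  rw [this]
  exact hV.comp_quasiMeasurePreserving Measure.quasiMeasurePreserving_snd

theorem integral_two_pi_one_div {s : ℝ} (hs : 0 < s) :
    Integrable (fun ζ : ℝ => 1 / (s ^ 2 + (2 * Real.pi * ζ) ^ 2)) ∧
      ∫ ζ : ℝ, 1 / (s ^ 2 + (2 * Real.pi * ζ) ^ 2) = 1 / (2 * s) := by
  have h := integrable_one_div_sq_add_sq hs
  refine ⟨integrable_two_pi_mul h.1, ?_⟩
  rw [integral_two_pi_mul (fun k => 1 / (s ^ 2 + k ^ 2)), h.2]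
  have := Real.pi_pos
  field_simp

theorem integrable_of_nice {f : ℝ → ℂ} {C R : ℝ} (hf : Nice f C R) {g : ℝ → ℝ}
    (hg : Continuous g) : Integrable fun ζ => g ζ * ‖f ζ‖ ^ 2 := by
  obtain ⟨K, hK⟩ := (isCompact_Icc (a := -R) (b := R)).exists_bound_of_continuousOn hg.continuousOn
  have h1 : Integrable fun ζ => K * C * ‖f ζ‖ := hf.integrable.norm.const_mul _
  refine h1.mono' (hg.aestronglyMeasurable.mul (hf.meas.norm.pow_const 2).aestronglyMeasurable)
    (ae_of_all _ fun ζ => ?_)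
  by_cases h : ζ ∈ Set.Icc (-R) R
  · have hK0 : 0 ≤ K := (norm_nonneg _).trans (hK ζ h)
    rw [norm_mul, norm_pow, norm_norm, sq, mul_assoc, ← mul_assoc]
    calc ‖g ζ‖ * ‖f ζ‖ * ‖f ζ‖ ≤ K * C * ‖f ζ‖ := by
          gcongr
          · exact hK ζ h
          · exact hf.bound ζ
      _ = K * (C * ‖f ζ‖) := by ring
  · rw [hf.supp ζ (by rw [Real.norm_eq_abs]; by_contra! h'; exact h (abs_le.mp h'))]
    simp

/-- The form domain controls the values of the relative wave function. -/
theorem enorm_fourierInv_sq_le {f : ℝ → ℂ} {C R : ℝ} (hf : Nice f C R) {s : ℝ} (hs : 0 < s)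
    (r : ℝ) : ‖𝓕⁻ f r‖ₑ ^ 2 ≤ ENNReal.ofReal (1 / (2 * s)) *
      ∫⁻ ζ, ENNReal.ofReal (s ^ 2 + (2 * Real.pi * ζ) ^ 2) * ‖f ζ‖ₑ ^ 2 := by
  have hi : Integrable fun ζ => (s ^ 2 + (2 * Real.pi * ζ) ^ 2) * ‖f ζ‖ ^ 2 :=
    integrable_of_nice hf (by fun_prop)
  have e : (fun ζ : ℝ => (s ^ 2 + (2 * Real.pi * ζ) ^ 2) * ‖f ζ‖ ^ 2) =
      fun ζ => ‖f ζ‖ ^ 2 / (1 / (s ^ 2 + (2 * Real.pi * ζ) ^ 2)) := by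
    funext ζ; rw [div_div_eq_mul_div, div_one, mul_comm]
  have h1 := (sq_integral_le_mul (ω := fun ζ : ℝ => 1 / (s ^ 2 + (2 * Real.pi * ζ) ^ 2))
    (fun ζ => norm_nonneg (f ζ)) hf.meas.norm.aestronglyMeasurable (fun ζ => by positivity)
    (integral_two_pi_one_div hs).1 (by rw [← e]; exact hi)).2
  rw [(integral_two_pi_one_div hs).2, ← e] at h1
  have h2 : ‖𝓕⁻ f r‖ ^ 2 ≤ 1 / (2 * s) * ∫ ζ, (s ^ 2 + (2 * Real.pi * ζ) ^ 2) * ‖f ζ‖ ^ 2 :=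
    (pow_le_pow_left₀ (norm_nonneg _) (norm_fourierInv_le r) 2).trans h1
  have h3 := ENNReal.ofReal_le_ofReal h2
  rw [ENNReal.ofReal_mul (by positivity), ofReal_integral_eq_lintegral_ofReal hi
    (ae_of_all _ fun ζ => by positivity), ENNReal.ofReal_pow (norm_nonneg _), ofReal_norm] at h3
  refine h3.trans (le_of_eq ?_)
  congr 1
  refine lintegral_congr fun ζ => ?_
  rw [ENNReal.ofReal_mul (by positivity), ENNReal.ofReal_pow (norm_nonneg _), ofReal_norm]

/-- The form of the potential is bounded relative to the form of the kinetic energy. -/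
theorem IsSymbol.formData (hm : IsSymbol κ T m) (hV : Integrable V)
    (hev : ∀ r, V (-r) = V r) : FormData m V (((∫ r, |V r|) + 1) ^ 2 + κ ^ 2) where
  meas := hm.meas
  nonneg := hm.nonneg
  symm := hm.symm
  measW := aestronglyMeasurable_comp_diff hV.aestronglyMeasurable
  evenW := hev
  posM := by positivity
  bound := by
    have hI : 0 ≤ ∫ r, |V r| := integral_nonneg fun r => abs_nonneg _
    -- The Sobolev constant is 1/(2s): one half is the relative bound, and 1/s must compensate ∫
    -- |V|.
    set s := (∫ r, |V r|) + 1 with hs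
    have hs0 : 0 < s := by linarith
    refine relative_bound_of_nice (F := fun ξ => ENNReal.ofReal
      ((m ((2 * Real.pi) • ξ) + (s ^ 2 + κ ^ 2)) / 2))
      (aestronglyMeasurable_comp_diff hV.aestronglyMeasurable) fun u C R hu => ?_
    rw [hu.lintegral_potential (F := fun r => ‖V r‖ₑ) hV.aestronglyMeasurable.enorm,
      ← lintegral_momMap]
    have hmeas : Measurable fun ξ : Plane => ENNReal.ofReal
        ((m ((2 * Real.pi) • ξ) + (s ^ 2 + κ ^ 2)) / 2) * ‖u ξ‖ₑ ^ 2 := by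
      have h1 : Measurable fun ξ : Plane => m ((2 * Real.pi) • ξ) :=
        hm.meas.comp (measurable_const_smul _)
      exact (((h1.add_const _).div_const _).ennreal_ofReal).mul (hu.meas.enorm.pow_const 2)
    have hmeas' : Measurable fun z : ℝ × ℝ => ENNReal.ofReal
        ((m ((2 * Real.pi) • momMap z) + (s ^ 2 + κ ^ 2)) / 2) * ‖u (momMap z)‖ₑ ^ 2 :=
      hmeas.comp measurePreserving_momMap.measurable
    rw [Measure.volume_eq_prod, lintegral_prod _ hmeas'.aemeasurable]
    set Z := ∫⁻ η, ∫⁻ ζ, ENNReal.ofReal ((m ((2 * Real.pi) • momMap (η, ζ)) +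
      (s ^ 2 + κ ^ 2)) / 2) * ‖u (momMap (η, ζ))‖ₑ ^ 2 with hZ
    have hfib : ∀ η r, ‖Nice.relFourier u η r‖ₑ ^ 2 ≤ ENNReal.ofReal (1 / s) *
        ∫⁻ ζ, ENNReal.ofReal ((m ((2 * Real.pi) • momMap (η, ζ)) + (s ^ 2 + κ ^ 2)) / 2) *
          ‖u (momMap (η, ζ))‖ₑ ^ 2 := by
      intro η r
      refine (enorm_fourierInv_sq_le (hu.slice η) hs0 r).trans ?_
      have e1 : ENNReal.ofReal (1 / (2 * s)) = ENNReal.ofReal (1 / s) * ENNReal.ofReal (1 / 2) := by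
        rw [← ENNReal.ofReal_mul (by positivity)]; congr 1; field_simp
      rw [e1, mul_assoc]
      gcongr
      rw [← lintegral_const_mul' _ _ ENNReal.ofReal_ne_top]
      refine lintegral_mono_ae ?_
      filter_upwards [ae_two_pi_mul (hm.ge (2 * Real.pi * η))] with ζ h
      rw [← mul_assoc, ← ENNReal.ofReal_mul (by positivity), two_pi_smul_momMap]
      refine mul_le_mul_left (ENNReal.ofReal_le_ofReal ?_) _
      have h1 := (le_abs_self _).trans h.2.1
      nlinarith [sq_nonneg (2 * Real.pi * η)]
    calc ∫⁻ r, ‖V r‖ₑ * ∫⁻ η, ‖Nice.relFourier u η r‖ₑ ^ 2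
        ≤ ∫⁻ r, ‖V r‖ₑ * (ENNReal.ofReal (1 / s) * Z) := by
          refine lintegral_mono fun r => mul_le_mul_right ?_ _
          rw [hZ, ← lintegral_const_mul' _ _ ENNReal.ofReal_ne_top]
          exact lintegral_mono fun η => hfib η r
      _ = (∫⁻ r, ‖V r‖ₑ) * (ENNReal.ofReal (1 / s) * Z) :=
          lintegral_mul_const'' _ hV.aestronglyMeasurable.enorm
      _ = ENNReal.ofReal ((∫ r, |V r|) * (1 / s)) * Z := by
          rw [← mul_assoc, ENNReal.ofReal_mul hI, ofReal_integral_eq_lintegral_ofReal hV.abs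
            (ae_of_all _ fun r => abs_nonneg _)]
          simp only [← Real.norm_eq_abs, ofReal_norm]
      _ ≤ 1 * Z := by
          gcongr
          rw [ENNReal.ofReal_le_one, mul_one_div, div_le_one hs0]
          linarith
      _ = _ := one_mul Z

end Bound
/-! ### Upper bounds on the temperatures -/

section Upper

variable {κ T : ℝ} {m : Plane → ℝ} {V : ℝ → ℝ}

/-- The form of `l V` is bounded by the form of the Fourier multiplier `m`. -/
def FormLE (m : Plane → ℝ) (V : ℝ → ℝ) (l : ℝ) : Prop :=
  ∀ (u : Plane → ℂ) (C R : ℝ), Nice u C R → (∀ ξ, u (exchange ξ) = u ξ) →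
    Integrable (fun ξ : Plane => m ((2 * Real.pi) • ξ) * ‖u ξ‖ ^ 2) →
    l * ∫ x : Plane, V (x 0 - x 1) * ‖𝓕⁻ u x‖ ^ 2 ≤
      ∫ ξ : Plane, m ((2 * Real.pi) • ξ) * ‖u ξ‖ ^ 2

/-- It suffices to compare the forms on the fibres of constant total momentum. -/
theorem formLE_of_fibre (hV : Integrable V) {l : ℝ}
    (h : ∀ (η : ℝ) (f : ℝ → ℂ) (C R : ℝ), Nice f C R → (∀ ζ, f (-ζ) = f ζ) →
      Integrable (fun ζ : ℝ => m (momenta (2 * Real.pi * η) (2 * Real.pi * ζ)) * ‖f ζ‖ ^ 2) →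
      l * ∫ r, V r * ‖𝓕⁻ f r‖ ^ 2 ≤
        ∫ ζ, m (momenta (2 * Real.pi * η) (2 * Real.pi * ζ)) * ‖f ζ‖ ^ 2) :
    FormLE m V l := by
  intro u C R hu hus hui
  have h1 := integrable_comp_momMap hui
  rw [Measure.volume_eq_prod] at h1
  have h2 := hu.integrable_relFourier hV
  rw [hu.integral_potential hV, ← integral_momMap (fun ξ => m ((2 * Real.pi) • ξ) * ‖u ξ‖ ^ 2),
    Measure.volume_eq_prod, integral_prod _ h1, ← integral_const_mul]
  refine integral_mono_ae (h2.integral_prod_left.const_mul l) h1.integral_prod_left ?_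
  filter_upwards [h1.prod_right_ae] with η hη
  simp only [two_pi_smul_momMap] at hη ⊢
  exact h η _ C R (hu.slice η) (fun ζ => by rw [← exchange_momMap, hus]) hη

/-- Comparison of a symbol with a weight. -/
theorem le_of_one_div_le {f : ℝ → ℂ} {C R : ℝ} (hf : Nice f C R) {g ω : ℝ → ℝ}
    (hω : ∀ ζ, 0 < ω ζ) (hωi : Integrable ω) (hg : ∀ᵐ ζ, 0 < g ζ ∧ 1 / g ζ ≤ ω ζ)
    (hi : Integrable fun ζ => g ζ * ‖f ζ‖ ^ 2) :
    Integrable (fun ζ => ‖f ζ‖ ^ 2 / ω ζ) ∧ ∫ ζ, ‖f ζ‖ ^ 2 / ω ζ ≤ ∫ ζ, g ζ * ‖f ζ‖ ^ 2 := by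
  have hle : ∀ᵐ ζ, ‖f ζ‖ ^ 2 / ω ζ ≤ g ζ * ‖f ζ‖ ^ 2 := by
    filter_upwards [hg] with ζ h
    rw [div_le_iff₀ (hω ζ)]
    have h1 : 1 ≤ g ζ * ω ζ := by
      have := mul_le_mul_of_nonneg_left h.2 h.1.le
      rwa [mul_one_div_cancel h.1.ne'] at this
    nlinarith [sq_nonneg ‖f ζ‖]
  have h1 : Integrable fun ζ => ‖f ζ‖ ^ 2 / ω ζ := by
    refine hi.mono' (((hf.meas.norm.pow_const 2).aemeasurable.div
      hωi.aestronglyMeasurable.aemeasurable).aestronglyMeasurable) ?_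
    filter_upwards [hle] with ζ h
    rwa [Real.norm_of_nonneg (div_nonneg (sq_nonneg _) (hω ζ).le)]
  exact ⟨h1, integral_mono_ae h1 hi hle⟩

theorem IsSymbol.le_integral (hm : IsSymbol κ T m) {u : Plane → ℂ} {C R : ℝ} (hu : Nice u C R)
    (hui : Integrable (fun ξ : Plane => m ((2 * Real.pi) • ξ) * ‖u ξ‖ ^ 2)) :
    2 * T * ∫ ξ, ‖u ξ‖ ^ 2 ≤ ∫ ξ : Plane, m ((2 * Real.pi) • ξ) * ‖u ξ‖ ^ 2 := by
  have h0 : Integrable fun ξ => ‖u ξ‖ ^ 2 :=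
    (memLp_two_iff_integrable_sq_norm hu.meas.aestronglyMeasurable).mp hu.memLp
  have h1 := integrable_comp_momMap hui
  have h2 := (integrable_comp_momMap h0).const_mul (2 * T)
  rw [Measure.volume_eq_prod] at h1 h2
  rw [← integral_const_mul, ← integral_momMap, ← integral_momMap, Measure.volume_eq_prod,
    integral_prod _ h1, integral_prod _ h2]
  refine integral_mono_ae h2.integral_prod_left h1.integral_prod_left ?_
  filter_upwards [h1.prod_right_ae, h2.prod_right_ae] with η h3 h4
  refine integral_mono_ae h4 h3 ?_
  filter_upwards [ae_two_pi_mul (hm.ge (2 * Real.pi * η))] with ζ h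
  rw [two_pi_smul_momMap]
  exact mul_le_mul_of_nonneg_right h.1 (sq_nonneg _)

/-- The slack θ leaves θ/(1 + θ) of the kinetic energy, which is at least 2T. A strictly positive
bound is needed because T_u is defined by the non-strict condition ≤ 0. -/
theorem le_infSpec_of_formLE (hm : IsSymbol κ T m) (hV : Integrable V)
    (hev : ∀ r, V (-r) = V r) {l θ : ℝ} (hθ : 0 < θ) (h : FormLE m V (l * (1 + θ))) :
    ((θ / (1 + θ) * (2 * T) : ℝ) : EReal) ≤
      infSpec (formOperator m (fun r => l * V r)) symmetricSubspace := by
  refine (hm.formData (hV.const_mul l) (fun r => by rw [hev])).le_infSpec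
    fun u C R hu hus hui => ?_
  have h1 := h u C R hu hus hui
  have h2 := hm.le_integral hu hui
  simp only [mul_assoc l]
  rw [integral_const_mul]
  set X := ∫ x : Plane, V (x 0 - x 1) * ‖𝓕⁻ u x‖ ^ 2
  set Y := ∫ ξ : Plane, m ((2 * Real.pi) • ξ) * ‖u ξ‖ ^ 2
  have h3 : l * X ≤ Y / (1 + θ) := by rw [le_div_iff₀ (by linarith)]; linarith
  have h4 : Y - Y / (1 + θ) = θ / (1 + θ) * Y := by field_simp; ring
  have h5 := mul_le_mul_of_nonneg_left h2 (show 0 ≤ θ / (1 + θ) by positivity)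
  linarith

/-- Adding m ≥ 2T and m ≥ k² − κ² ≥ k² − T gives 1/m ≤ 2/(T + k²), whose integral over the fibre is
1/√T. -/
theorem formLE_of_large (hm : IsSymbol κ T m) (hT : 0 < T) (hκT : κ ^ 2 ≤ T) (hV : Integrable V)
    {l : ℝ} (hl : 0 ≤ l) (h : l * ((∫ r, |V r|) * (1 / Real.sqrt T)) ≤ 1) : FormLE m V l := by
  have hs : 0 < Real.sqrt T := Real.sqrt_pos.mpr hT
  have hs2 : Real.sqrt T ^ 2 = T := Real.sq_sqrt hT.le
  obtain ⟨hi, hI⟩ := integral_two_pi_one_div hs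
  refine formLE_of_fibre hV fun η f C R hf hfe hfi => ?_
  obtain ⟨h1, h2⟩ := le_of_one_div_le hf
    (ω := fun ζ : ℝ => 2 * (1 / (Real.sqrt T ^ 2 + (2 * Real.pi * ζ) ^ 2)))
    (fun ζ => by positivity) (hi.const_mul 2) (by
      filter_upwards [ae_two_pi_mul (hm.ge (2 * Real.pi * η))] with ζ h
      have h3 := (le_abs_self _).trans h.2.1
      refine ⟨by linarith [h.1], ?_⟩
      rw [mul_one_div, hs2, div_le_div_iff₀ (by linarith [h.1]) (by positivity)]
      nlinarith [h.1, sq_nonneg (2 * Real.pi * η)]) hfi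
  refine (potential_le_of_weight_crude hV hf (fun ζ => by positivity) (hi.const_mul 2) h1 hl
    (B := 1 / Real.sqrt T) ?_ h).trans h2
  rw [integral_const_mul, hI]
  apply le_of_eq
  field_simp

/-- The upper bound on the critical temperature on one fibre. -/
theorem exists_fibre_bound (hκ : 0 < κ) (hV : Integrable (fun r : ℝ => (1 + |r| ^ 2) * V r))
    {c e g C E : ℝ} (he : 0 < e) (hE : 0 < E) (hcos : cosMoment V c ≤ e) (hge : e * g = E / κ)
    (hI : ∀ T₀ T, 0 < T₀ → T₀ ≤ κ ^ 2 → T₀ ≤ T →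
      ∫ ζ, upperW κ T c ζ ≤ g * Real.log (κ ^ 2 / T₀) + C) :
    ∃ A l₀, 0 < l₀ ∧ ∀ l, 0 < l → l < l₀ → ∀ T, κ ^ 2 * Real.exp (-κ / (l * E) + A) ≤ T →
      ∀ (f : ℝ → ℂ) (C R : ℝ) (w : ℝ → ℝ), Nice f C R → (∀ ζ, f (-ζ) = f ζ) →
        (∀ᵐ ζ, 0 < w ζ ∧ 1 / w ζ ≤ upperW κ T c ζ) → Integrable (fun ζ => w ζ * ‖f ζ‖ ^ 2) →
        l * (1 + l) * ∫ r, V r * ‖𝓕⁻ f r‖ ^ 2 ≤ ∫ ζ, w ζ * ‖f ζ‖ ^ 2 := by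
  obtain ⟨C₁, hC₁, hd⟩ := integral_cutDist_upperW_le hκ
  have herr : 0 ≤ errMoment V := errMoment_nonneg V
  set C₂ := 3 * errMoment V * C₁ + errMoment V ^ 2 * C₁ / (2 * e) with hC₂
  -- `A` is chosen to give e ∫ ω ≤ 1/l − (C₂ + 1). The extra 1 pays for the slack, since the final
  -- expression is then l(1 + l)(1/l − 1) = 1 − l².
  set A := κ / E * (e * C + C₂ + 1) with hA
  have hpos : 0 < 8 * errMoment V * C₁ + 1 := by positivity
  -- The three bounds on `l` ensure 1 + l ≤ 2, smallness of the error terms, and T₀ ≤ κ².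
  refine ⟨A, min 1 (min (1 / (8 * errMoment V * C₁ + 1)) (κ / (E * (|A| + 1)))),
    by positivity, fun l hl hl0 T hT f C' R w hf hfe hw hwi => ?_⟩
  rw [lt_min_iff, lt_min_iff] at hl0
  obtain ⟨hl1, hl2, hl3⟩ := hl0
  rw [lt_div_iff₀ hpos] at hl2
  rw [lt_div_iff₀ (by positivity)] at hl3
  set T₀ := κ ^ 2 * Real.exp (-κ / (l * E) + A) with hT₀
  have hT₀0 : 0 < T₀ := by positivity
  have hT0 : 0 < T := hT₀0.trans_le hT
  have hAl : A ≤ κ / (l * E) := by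
    rw [le_div_iff₀ (by positivity)]
    have h1 : A * (l * E) ≤ (|A| + 1) * (l * E) := by
      gcongr
      linarith [le_abs_self A]
    linarith
  have hT₀κ : T₀ ≤ κ ^ 2 := by
    refine mul_le_of_le_one_right (by positivity) (Real.exp_le_one_iff.mpr ?_)
    rw [neg_div]; linarith
  have hlog : Real.log (κ ^ 2 / T₀) = κ / (l * E) - A := by
    rw [hT₀, ← div_div, div_self (by positivity), one_div, ← Real.exp_neg, Real.log_exp]
    ring
  have hI' := hI T₀ T hT₀0 hT₀κ hT
  rw [hlog] at hI'
  obtain ⟨h1, h2⟩ := le_of_one_div_le hf (upperW_pos hκ hT0 c) (integrable_upperW hκ hT0 c) hw hwi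
  refine (potential_le_of_weight hV hf hfe (upperW_pos hκ hT0 c) (integrable_upperW hκ hT0 c) h1
    he hcos hC₁ (hd T hT0 c) (by positivity) ?_ ?_).trans h2
  · have h3 : l * (1 + l) ≤ l * 2 := by gcongr; linarith
    have h4 : l * (1 + l) * (errMoment V * C₁) ≤ l * 2 * (errMoment V * C₁) := by gcongr
    nlinarith
  · rw [← hC₂]
    have h3 : e * ∫ ζ, upperW κ T c ζ ≤ 1 / l - (C₂ + 1) := by
      have h4 := mul_le_mul_of_nonneg_left hI' he.le
      have h5 : e * (g * (κ / (l * E) - A) + C) = 1 / l - (C₂ + 1) := by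
        rw [mul_add, ← mul_assoc, hge, hA]
        field_simp
        ring
      linarith
    have h6 := mul_le_mul_of_nonneg_left h3 (show 0 ≤ l * (1 + l) by positivity)
    have h7 : l * (1 + l) * (1 / l - (C₂ + 1)) + l * (1 + l) * C₂ = 1 - l ^ 2 := by
      field_simp
      ring
    nlinarith [sq_nonneg l]

/-- `g_κ = 1 / (π κ)` and `g_0 = 1 / (2 π κ)` are the coefficients of the logarithms. -/
theorem exists_fibre_bound_near (hκ : 0 < κ)
    (hV : Integrable (fun r : ℝ => (1 + |r| ^ 2) * V r)) {E : ℝ} (hE : 0 < E)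
    (hcos : cosMoment V κ / Real.pi ≤ E) :
    ∃ A l₀, 0 < l₀ ∧ ∀ l, 0 < l → l < l₀ → ∀ T, κ ^ 2 * Real.exp (-κ / (l * E) + A) ≤ T →
      ∀ (f : ℝ → ℂ) (C R : ℝ) (w : ℝ → ℝ), Nice f C R → (∀ ζ, f (-ζ) = f ζ) →
        (∀ᵐ ζ, 0 < w ζ ∧ 1 / w ζ ≤ upperW κ T κ ζ) → Integrable (fun ζ => w ζ * ‖f ζ‖ ^ 2) →
        l * (1 + l) * ∫ r, V r * ‖𝓕⁻ f r‖ ^ 2 ≤ ∫ ζ, w ζ * ‖f ζ‖ ^ 2 := by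
  have hpi := Real.pi_pos
  obtain ⟨C, hC⟩ := integral_upperW_near_le hκ
  refine exists_fibre_bound hκ hV (e := Real.pi * E) (by positivity) hE ?_ ?_ hC
  · rw [div_le_iff₀ hpi] at hcos; linarith
  · field_simp

theorem exists_fibre_bound_far (hκ : 0 < κ)
    (hV : Integrable (fun r : ℝ => (1 + |r| ^ 2) * V r)) {E : ℝ} (hE : 0 < E)
    (hcos : 1 / 2 * (cosMoment V 0 / Real.pi) ≤ E) :
    ∃ A l₀, 0 < l₀ ∧ ∀ l, 0 < l → l < l₀ → ∀ T, κ ^ 2 * Real.exp (-κ / (l * E) + A) ≤ T →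
      ∀ (f : ℝ → ℂ) (C R : ℝ) (w : ℝ → ℝ), Nice f C R → (∀ ζ, f (-ζ) = f ζ) →
        (∀ᵐ ζ, 0 < w ζ ∧ 1 / w ζ ≤ upperW κ T 0 ζ) → Integrable (fun ζ => w ζ * ‖f ζ‖ ^ 2) →
        l * (1 + l) * ∫ r, V r * ‖𝓕⁻ f r‖ ^ 2 ≤ ∫ ζ, w ζ * ‖f ζ‖ ^ 2 := by
  have hpi := Real.pi_pos
  obtain ⟨C, hC⟩ := integral_upperW_far_le hκ
  refine exists_fibre_bound hκ hV (e := 2 * Real.pi * E) (by positivity) hE ?_ ?_ hC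
  · have : cosMoment V 0 / Real.pi ≤ 2 * E := by linarith
    rw [div_le_iff₀ hpi] at this; linarith
  · field_simp

/-- The upper bound for `L_T`. -/
theorem exists_formLE_symbolL (hκ : 0 < κ)
    (hV : Integrable (fun r : ℝ => (1 + |r| ^ 2) * V r)) {E : ℝ} (hE : 0 < E)
    (hcos : cosMoment V κ / Real.pi ≤ E) :
    ∃ A l₀, 0 < l₀ ∧ ∀ l, 0 < l → l < l₀ → ∀ T, κ ^ 2 * Real.exp (-κ / (l * E) + A) ≤ T →
      FormLE (symbolL (κ ^ 2) T) V (l * (1 + l)) := by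
  have hVi := integrable_of_moment hV
  obtain ⟨A, l₀, hl₀, h⟩ := exists_fibre_bound_near hκ hV hE hcos
  obtain ⟨B, hB, hfar⟩ := integral_farW_le hκ
  have hI : 0 ≤ ∫ r, |V r| := integral_nonneg fun r => abs_nonneg _
  refine ⟨A, min l₀ (min 1 (1 / (2 * ((∫ r, |V r|) * B) + 1))), by positivity,
    fun l hl hl1 T hT => formLE_of_fibre hVi fun η f C R hf hfe hfi => ?_⟩
  rw [lt_min_iff, lt_min_iff] at hl1
  have hT0 : 0 < T := lt_of_lt_of_le (by positivity) hT
  have hm := ae_two_pi_mul ((isSymbolL κ hT0).ge (2 * Real.pi * η))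
  -- Only the fibres of small total momentum carry a logarithm. On the others the weight has bounded
  -- mass, and the crude estimate works for small `l`.
  rcases le_total |2 * Real.pi * η| (κ / 2) with hP | hP
  · refine h l hl hl1.1 T hT f C R _ hf hfe ?_ hfi
    filter_upwards [hm] with ζ hζ
    exact ⟨by linarith [hζ.1], one_div_le_weight_near hκ hT0 hP hζ.1 hζ.2.1 hζ.2.2⟩
  · obtain ⟨hWi, hWB⟩ := hfar T (2 * Real.pi * η) hT0 hP
    obtain ⟨h1, h2⟩ := le_of_one_div_le hf (fun ζ => farW_pos hκ hT0) hWi (by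
      filter_upwards [hm, ae_two_pi_mul (ae_momenta_ne κ (2 * Real.pi * η))] with ζ hζ hne
      refine ⟨by linarith [hζ.1], ?_⟩
      rw [symbolL_momenta]
      exact one_div_energyL_le_farW hκ hT0 hP hne.1 hne.2.1) hfi
    refine (potential_le_of_weight_crude hVi hf (fun ζ => farW_pos hκ hT0) hWi h1 (by positivity)
      hWB ?_).trans h2
    have h3 := hl1.2.2
    rw [lt_div_iff₀ (by positivity)] at h3
    have h4 : l * (1 + l) * ((∫ r, |V r|) * B) ≤ l * 2 * ((∫ r, |V r|) * B) := by
      gcongr; linarith [hl1.2.1]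
    nlinarith

/-- The upper bound for `D_T`. -/
theorem exists_formLE_symbolD (hκ : 0 < κ)
    (hV : Integrable (fun r : ℝ => (1 + |r| ^ 2) * V r)) {E : ℝ} (hE : 0 < E)
    (hcos : cosMoment V κ / Real.pi ≤ E) (hcos0 : 1 / 2 * (cosMoment V 0 / Real.pi) ≤ E) :
    ∃ A l₀, 0 < l₀ ∧ ∀ l, 0 < l → l < l₀ → ∀ T, κ ^ 2 * Real.exp (-κ / (l * E) + A) ≤ T →
      FormLE (symbolD (κ ^ 2) T) V (l * (1 + l)) := by
  have hVi := integrable_of_moment hV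
  obtain ⟨A₁, l₁, hl₁, h₁⟩ := exists_fibre_bound_near hκ hV hE hcos
  obtain ⟨A₂, l₂, hl₂, h₂⟩ := exists_fibre_bound_far hκ hV hE hcos0
  refine ⟨max A₁ A₂, min l₁ l₂, by positivity,
    fun l hl hl0 T hT => formLE_of_fibre hVi fun η f C R hf hfe hfi => ?_⟩
  rw [lt_min_iff] at hl0
  have hT0 : 0 < T := lt_of_lt_of_le (by positivity) hT
  have hm := ae_two_pi_mul ((isSymbolD κ hT0).ge (2 * Real.pi * η))
  -- Unlike for L_T, the far fibres keep a logarithmic singularity at k = 0, so their constant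
  -- e_0^s/2 enters through the second fibre bound.
  rcases le_total |2 * Real.pi * η| (κ / 2) with hP | hP
  · refine h₁ l hl hl0.1 T (le_trans (by gcongr; exact le_max_left _ _) hT) f C R _ hf hfe ?_ hfi
    filter_upwards [hm] with ζ hζ
    exact ⟨by linarith [hζ.1], one_div_le_weight_near hκ hT0 hP hζ.1 hζ.2.1 hζ.2.2⟩
  · refine h₂ l hl hl0.2 T (le_trans (by gcongr; exact le_max_right _ _) hT) f C R _ hf hfe ?_ hfi
    filter_upwards [hm] with ζ hζ
    exact ⟨by linarith [hζ.1], one_div_le_weight_far hκ hT0 hP hζ.1 hζ.2.1 hζ.2.2⟩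

end Upper
/-! ### Lower bounds on the temperatures -/

section Lower

variable {κ T c η₀ ε : ℝ} {m : Plane → ℝ} {V : ℝ → ℝ}

/-- The test functions, with total momentum close to `2 π η₀`. -/
def testFun (κ T c η₀ ε : ℝ) (ξ : Plane) : ℂ :=
  Set.indicator {ξ : Plane | |ξ 0 + ξ 1 - η₀| ≤ ε}
    (fun ξ => (lowerW κ T c ((ξ 0 - ξ 1) / 2) : ℂ)) ξ

theorem testFun_momMap (η ζ : ℝ) : testFun κ T c η₀ ε (momMap (η, ζ)) =
    Set.indicator (Set.Icc (η₀ - ε) (η₀ + ε)) (fun _ => (lowerW κ T c ζ : ℂ)) η := by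
  have e0 : momMap (η, ζ) 0 + momMap (η, ζ) 1 = η := by rw [momMap_zero, momMap_one]; ring
  have e1 : (momMap (η, ζ) 0 - momMap (η, ζ) 1) / 2 = ζ := by rw [momMap_zero, momMap_one]; ring
  by_cases h : |η - η₀| ≤ ε
  · have h1 : η ∈ Set.Icc (η₀ - ε) (η₀ + ε) := by
      rw [abs_le] at h; constructor <;> linarith
    rw [testFun, Set.indicator_of_mem h1, Set.indicator_of_mem, e1]
    rw [Set.mem_ofPred_eq, e0]; exact h
  · have h1 : η ∉ Set.Icc (η₀ - ε) (η₀ + ε) := fun h' =>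
      h (abs_le.mpr ⟨by linarith [h'.1], by linarith [h'.2]⟩)
    rw [testFun, Set.indicator_of_notMem h1, Set.indicator_of_notMem]
    rw [Set.mem_ofPred_eq, e0]; exact h

theorem momMap_surj (ξ : Plane) : momMap (ξ 0 + ξ 1, (ξ 0 - ξ 1) / 2) = ξ := by
  ext i
  fin_cases i
  · change momMap (ξ 0 + ξ 1, (ξ 0 - ξ 1) / 2) 0 = ξ 0
    rw [momMap_zero]; ring
  · change momMap (ξ 0 + ξ 1, (ξ 0 - ξ 1) / 2) 1 = ξ 1
    rw [momMap_one]; ring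

theorem testFun_exchange (ξ : Plane) :
    testFun κ T c η₀ ε (exchange ξ) = testFun κ T c η₀ ε ξ := by
  rw [← momMap_surj ξ, exchange_momMap, testFun_momMap, testFun_momMap, lowerW_neg]

theorem norm_testFun (hκ : 0 < κ) (hT : 0 < T) (η ζ : ℝ) :
    ‖testFun κ T c η₀ ε (momMap (η, ζ))‖ =
      Set.indicator (Set.Icc (η₀ - ε) (η₀ + ε)) (fun _ => lowerW κ T c ζ) η := by
  rw [testFun_momMap]
  by_cases h : η ∈ Set.Icc (η₀ - ε) (η₀ + ε)
  · rw [Set.indicator_of_mem h, Set.indicator_of_mem h, Complex.norm_real,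
      Real.norm_of_nonneg (lowerW_nonneg hκ hT c ζ)]
  · rw [Set.indicator_of_notMem h, Set.indicator_of_notMem h, norm_zero]

theorem nice_testFun (hκ : 0 < κ) (hT : 0 < T) :
    Nice (testFun κ T c η₀ ε) (1 / (4 * T)) (2 * κ + |η₀| + |ε|) where
  meas := by
    refine Measurable.indicator ?_ ?_
    · have h := measurable_lowerW hκ hT c
      exact Complex.measurable_ofReal.comp (h.comp (by fun_prop))
    · exact measurableSet_le (by fun_prop) measurable_const
  bound ξ := by
    rw [← momMap_surj ξ, norm_testFun hκ hT]
    refine Set.indicator_apply_le' (fun _ => lowerW_le hκ hT c _) fun _ => by positivity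
  supp ξ h := by
    by_contra hne
    rw [← momMap_surj ξ, testFun_momMap] at hne
    have h1 := Set.mem_of_indicator_ne_zero hne
    rw [Set.indicator_of_mem h1] at hne
    have h2 : |(ξ 0 - ξ 1) / 2| ≤ κ := by
      by_contra! h2
      exact hne ((nice_lowerW hκ hT c).supp _ (by rwa [Real.norm_eq_abs]))
    have h3 : |ξ 0 + ξ 1| ≤ |η₀| + |ε| := by
      have := le_abs_self ε
      rw [abs_le]
      constructor
      · linarith [h1.1, neg_abs_le η₀]
      · linarith [h1.2, le_abs_self η₀]
    have h4 : ‖ξ‖ ^ 2 = (ξ 0) ^ 2 + (ξ 1) ^ 2 := by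
      rw [EuclideanSpace.real_norm_sq_eq, Fin.sum_univ_two]
    have h5 : ‖ξ‖ ^ 2 ≤ (2 * κ + |η₀| + |ε|) ^ 2 := by
      have e : ‖ξ‖ ^ 2 = (ξ 0 + ξ 1) ^ 2 / 2 + 2 * ((ξ 0 - ξ 1) / 2) ^ 2 := by rw [h4]; ring
      have h6 : (ξ 0 + ξ 1) ^ 2 ≤ (|η₀| + |ε|) ^ 2 := by
        rw [← sq_abs (ξ 0 + ξ 1)]; gcongr
      have h7 : ((ξ 0 - ξ 1) / 2) ^ 2 ≤ κ ^ 2 := by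
        rw [← sq_abs ((ξ 0 - ξ 1) / 2)]; gcongr
      have h8 : 0 ≤ κ * (|η₀| + |ε|) := by positivity
      nlinarith [sq_nonneg (|η₀| + |ε|)]
    have := abs_le_of_sq_le_sq' h5 (by positivity)
    linarith [this.2]

theorem relFourier_testFun (η r : ℝ) : Nice.relFourier (testFun κ T c η₀ ε) η r =
    Set.indicator (Set.Icc (η₀ - ε) (η₀ + ε))
      (fun _ => 𝓕⁻ (fun ζ => (lowerW κ T c ζ : ℂ)) r) η := by
  rw [Nice.relFourier]
  by_cases h : η ∈ Set.Icc (η₀ - ε) (η₀ + ε)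
  · simp only [testFun_momMap, Set.indicator_of_mem h]
  · simp only [testFun_momMap, Set.indicator_of_notMem h]
    rw [Real.fourierInv_eq']
    simp

/-- On its support the trial function is 1/S with M ≤ S, so M/S² ≤ 1/S: its kinetic energy is at
most its mass. -/
theorem lowerW_mul_sq_le (hκ : 0 < κ) (hT : 0 < T) {M ζ : ℝ}
    (h : |2 * Real.pi * ζ| ≤ 2 * κ → M ≤ 2 * κ * |(|2 * Real.pi * ζ| - c)| +
      (|2 * Real.pi * ζ| - c) ^ 2 + 4 * T) :
    M * lowerW κ T c ζ ^ 2 ≤ lowerW κ T c ζ := by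
  rcases le_or_gt |2 * Real.pi * ζ| (2 * κ) with h1 | h1
  · have h2 := h h1
    rw [lowerW, foldW_of_mem c _ h1, testProfile, abs_abs, sq_abs]
    have h3 : 0 < 2 * κ * |(|2 * Real.pi * ζ| - c)| + (|2 * Real.pi * ζ| - c) ^ 2 + 4 * T := by
      positivity
    obtain ⟨S, hS⟩ : ∃ S, S = 2 * κ * |(|2 * Real.pi * ζ| - c)| + (|2 * Real.pi * ζ| - c) ^ 2 +
      4 * T := ⟨_, rfl⟩
    rw [← hS] at h2 h3 ⊢
    rw [div_pow, one_pow, mul_one_div, div_le_div_iff₀ (by positivity) h3, one_mul, sq]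
    exact mul_le_mul_of_nonneg_right h2 h3.le
  · rw [lowerW, foldW_of_notMem c _ h1]; simp

/-- A sufficient condition for negative spectrum. -/
theorem IsSymbol.infSpec_neg (hm : IsSymbol κ T m) (hκ : 0 < κ) (hT : 0 < T) (hV : Integrable V)
    (hev : ∀ r, V (-r) = V r) {l : ℝ} (hε : 0 < ε)
    (hb : ∀ η, |η - η₀| ≤ ε → ∀ k, |k| ≤ 2 * κ → m (momenta (2 * Real.pi * η) k) ≤
      2 * κ * |(|k| - c)| + (|k| - c) ^ 2 + 4 * T)
    (hneg : ∫ ζ, lowerW κ T c ζ <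
      l * ∫ r, V r * ‖𝓕⁻ (fun ζ => (lowerW κ T c ζ : ℂ)) r‖ ^ 2) :
    infSpec (formOperator m (fun r => l * V r)) symmetricSubspace < 0 := by
  have hu := nice_testFun (c := c) (η₀ := η₀) (ε := ε) hκ hT
  set u := testFun κ T c η₀ ε with hudef
  have hfib : ∀ η ζ, m ((2 * Real.pi) • momMap (η, ζ)) * ‖u (momMap (η, ζ))‖ ^ 2 ≤
      Set.indicator (Set.Icc (η₀ - ε) (η₀ + ε)) (fun _ => lowerW κ T c ζ) η := by
    intro η ζ
    rw [hudef, norm_testFun hκ hT, two_pi_smul_momMap]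
    by_cases h : η ∈ Set.Icc (η₀ - ε) (η₀ + ε)
    · rw [Set.indicator_of_mem h]
      exact lowerW_mul_sq_le hκ hT (hb η (abs_le.mpr ⟨by linarith [h.1], by linarith [h.2]⟩) _)
    · rw [Set.indicator_of_notMem h]; simp
  have hui : Integrable (fun ξ : Plane => m ((2 * Real.pi) • ξ) * ‖u ξ‖ ^ 2) := by
    have h1 : Measurable fun ξ : Plane => m ((2 * Real.pi) • ξ) :=
      hm.meas.comp (measurable_const_smul _)
    refine (hu.integrable (ν := volume)).norm.mono'
      (h1.mul (hu.meas.norm.pow_const 2)).aestronglyMeasurable (ae_of_all _ fun ξ => ?_)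
    rw [Real.norm_of_nonneg (mul_nonneg (hm.nonneg _) (sq_nonneg _))]
    have := hfib (ξ 0 + ξ 1) ((ξ 0 - ξ 1) / 2)
    rwa [← norm_testFun hκ hT, momMap_surj] at this
  refine (hm.formData (hV.const_mul l) (fun r => by rw [hev])).infSpec_neg hu testFun_exchange hui ?_
  have h1 := integrable_comp_momMap hui
  rw [Measure.volume_eq_prod] at h1
  set I := ∫ ζ, lowerW κ T c ζ
  set X := ∫ r, V r * ‖𝓕⁻ (fun ζ => (lowerW κ T c ζ : ℂ)) r‖ ^ 2
  -- The trial function does not depend on η inside its window, so the window length 2ε is a common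
  -- factor of both energies and drops out.
  have hkin : ∫ ξ : Plane, m ((2 * Real.pi) • ξ) * ‖u ξ‖ ^ 2 ≤ 2 * ε * I := by
    rw [← integral_momMap, Measure.volume_eq_prod, integral_prod _ h1]
    have e : ∫ η, Set.indicator (Set.Icc (η₀ - ε) (η₀ + ε)) (fun _ => I) η = 2 * ε * I := by
      rw [integral_indicator measurableSet_Icc, setIntegral_const,
        Real.volume_real_Icc_of_le (by linarith), smul_eq_mul]
      ring
    rw [← e]
    refine integral_mono_ae h1.integral_prod_left
      ((integrable_indicator_iff measurableSet_Icc).mpr (integrableOn_const (by simp))) ?_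
    filter_upwards [h1.prod_right_ae] with η hη
    by_cases h : η ∈ Set.Icc (η₀ - ε) (η₀ + ε)
    · rw [Set.indicator_of_mem h]
      refine integral_mono hη (integrable_lowerW hκ hT c) fun ζ => ?_
      have := hfib η ζ
      rwa [Set.indicator_of_mem h] at this
    · rw [Set.indicator_of_notMem h]
      refine integral_nonpos fun ζ => ?_
      have := hfib η ζ
      rwa [Set.indicator_of_notMem h] at this
  have hpot : ∫ x : Plane, l * V (x 0 - x 1) * ‖𝓕⁻ u x‖ ^ 2 = 2 * ε * (l * X) := by
    simp only [mul_assoc l]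
    rw [integral_const_mul, hu.integral_potential hV]
    have e : ∀ η, ∫ r, V r * ‖Nice.relFourier u η r‖ ^ 2 =
        Set.indicator (Set.Icc (η₀ - ε) (η₀ + ε)) (fun _ => X) η := by
      intro η
      by_cases h : η ∈ Set.Icc (η₀ - ε) (η₀ + ε)
      · simp only [hudef, relFourier_testFun, Set.indicator_of_mem h]; rfl
      · simp only [hudef, relFourier_testFun, Set.indicator_of_notMem h]
        simp
    simp only [e]
    rw [integral_indicator measurableSet_Icc, setIntegral_const,
      Real.volume_real_Icc_of_le (by linarith), smul_eq_mul]
    ring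
  rw [hpot]
  have := mul_lt_mul_of_pos_left hneg (show 0 < 2 * ε by linarith)
  linarith

/-- The condition for negative spectrum holds at sufficiently low temperature. -/
theorem exists_lower_condition (hκ : 0 < κ) (hV : Integrable (fun r : ℝ => (1 + |r| ^ 2) * V r))
    {g E : ℝ} (hg : 0 < g) (hE : 0 < E) (hcos : g * cosMoment V c = E / κ)
    (hI : ∀ T, 0 < T → g * (Real.log (κ ^ 2 / T) - 2) ≤ ∫ ζ, lowerW κ T c ζ) :
    ∃ A, ∀ l, 0 < l → ∀ T, 0 < T → T < κ ^ 2 * Real.exp (-κ / (l * E) - A) →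
      ∫ ζ, lowerW κ T c ζ < l * ∫ r, V r * ‖𝓕⁻ (fun ζ => (lowerW κ T c ζ : ℂ)) r‖ ^ 2 := by
  have hpi := Real.pi_pos
  have herr := errMoment_nonneg V
  have hcm : 0 < cosMoment V c := by
    by_contra! h
    have := mul_nonpos_of_nonneg_of_nonpos hg.le h
    rw [hcos] at this
    have : 0 < E / κ := by positivity
    linarith
  set D := errMoment V * (1 / Real.pi + (1 / Real.pi) ^ 2) with hD
  have hD0 : 0 ≤ D := by positivity
  -- The 2 offsets the loss in `hI`, the term 1/g gives ∫ lowerW ≥ 1 so that the constant error is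
  -- absorbed into the linear one, and κ D/E compensates that linear error.
  refine ⟨2 + 1 / g + κ / E * D, fun l hl T hT hTl => ?_⟩
  set I := ∫ ζ, lowerW κ T c ζ
  have hlog : κ / (l * E) + (2 + 1 / g + κ / E * D) < Real.log (κ ^ 2 / T) := by
    have h1 := Real.log_lt_log hT hTl
    rw [Real.log_mul (by positivity) (Real.exp_ne_zero _), Real.log_exp, neg_div] at h1
    rw [Real.log_div (by positivity) hT.ne']
    linarith
  have hI1 : g * (κ / (l * E) + (1 / g + κ / E * D)) < I := by
    refine lt_of_lt_of_le ?_ (hI T hT)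
    have := mul_lt_mul_of_pos_left hlog hg
    linarith
  have hI2 : 1 ≤ I := by
    have h1 : g * (κ / (l * E) + (1 / g + κ / E * D)) =
        g * (κ / (l * E)) + 1 + g * (κ / E * D) := by
      field_simp
      ring
    have h2 : 0 ≤ g * (κ / (l * E)) := by positivity
    have h3 : 0 ≤ g * (κ / E * D) := by positivity
    linarith
  have hI3 : 1 / l + D < I * cosMoment V c := by
    have h1 := mul_lt_mul_of_pos_right hI1 hcm
    have h2 : g * (κ / (l * E) + (1 / g + κ / E * D)) * cosMoment V c =
        1 / l + D + cosMoment V c := by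
      have : g * (κ / (l * E) + (1 / g + κ / E * D)) * cosMoment V c =
        (g * cosMoment V c) * (κ / (l * E) + κ / E * D) + (g * (1 / g)) * cosMoment V c := by ring
      rw [this, hcos, mul_one_div_cancel hg.ne']
      field_simp
    linarith
  have hX := le_potential_of_weight hV (nice_lowerW hκ hT c) (lowerW_neg κ T c)
    (lowerW_nonneg hκ hT c) (integral_cutDist_lowerW_le hκ hT c)
  refine lt_of_lt_of_le ?_ (mul_le_mul_of_nonneg_left hX hl.le)
  have h1 : errMoment V * (I * (1 / Real.pi) + (1 / Real.pi) ^ 2) ≤ I * D := by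
    have : (1 / Real.pi) ^ 2 * 1 ≤ (1 / Real.pi) ^ 2 * I := by gcongr
    have h2 : I * (1 / Real.pi) + (1 / Real.pi) ^ 2 ≤ I * (1 / Real.pi + (1 / Real.pi) ^ 2) := by
      linarith
    calc _ ≤ errMoment V * (I * (1 / Real.pi + (1 / Real.pi) ^ 2)) := by gcongr
      _ = I * D := by rw [hD]; ring
  have h3 : I * (1 / l) < I * (I * cosMoment V c - D) :=
    mul_lt_mul_of_pos_left (by linarith) (by linarith)
  have h4 := mul_lt_mul_of_pos_left h3 hl
  have h5 : l * (I * (1 / l)) = I := by field_simp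
  rw [h5] at h4
  refine h4.trans_le (mul_le_mul_of_nonneg_left ?_ hl.le)
  change I * (I * cosMoment V c - D) ≤ I ^ 2 * cosMoment V c -
    errMoment V * (I * (1 / Real.pi) + (1 / Real.pi) ^ 2)
  linarith

/-- A width of the test functions. -/
theorem exists_width (hκ : 0 < κ) (hT : 0 < T) :
    ∃ δ, 0 < δ ∧ δ ^ 2 ≤ T ∧ 2 * κ * δ ≤ T := by
  refine ⟨T / (2 * κ + T + 1), by positivity, ?_, ?_⟩
  · have h1 : T / (2 * κ + T + 1) ≤ 1 := by rw [div_le_one (by positivity)]; linarith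
    have h2 : T / (2 * κ + T + 1) ≤ T := div_le_self hT.le (by linarith)
    have h3 : 0 ≤ T / (2 * κ + T + 1) := by positivity
    nlinarith
  · rw [mul_div_assoc', div_le_iff₀ (by positivity)]; nlinarith

theorem abs_sq_sub_sq_le (hκ : 0 < κ) (k : ℝ) :
    |k ^ 2 - κ ^ 2| ≤ 2 * κ * |(|k| - κ)| + (|k| - κ) ^ 2 := by
  rw [← sq_abs k, show |k| ^ 2 - κ ^ 2 = 2 * κ * (|k| - κ) + (|k| - κ) ^ 2 by ring]
  refine (abs_add_le _ _).trans ?_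
  rw [abs_mul, abs_of_pos (show 0 < 2 * κ by linarith), abs_of_nonneg (sq_nonneg (|k| - κ))]

/-- The width `δ` makes |P k| ≤ T, so the hyperbolic cosine is below 2.75, and P²/4 ≤ T/4. With the
remaining T this adds up to 4T. -/
theorem symbolL_le_near (hκ : 0 < κ) (hT : 0 < T) {P k δ : ℝ} (hδ : δ ^ 2 ≤ T)
    (hδ2 : 2 * κ * δ ≤ T) (hP : |P| ≤ δ) (hk : |k| ≤ 2 * κ) :
    symbolL (κ ^ 2) T (momenta P k) ≤ 2 * κ * |(|k| - κ)| + (|k| - κ) ^ 2 + 4 * T := by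
  rw [symbolL_momenta]
  refine (energyL_le hT _ _).trans ?_
  rw [(symbol_sum_diff κ P k).1]
  have h1 : |k ^ 2 + P ^ 2 / 4 - κ ^ 2| ≤ |k ^ 2 - κ ^ 2| + P ^ 2 / 4 := by
    rw [show k ^ 2 + P ^ 2 / 4 - κ ^ 2 = (k ^ 2 - κ ^ 2) + P ^ 2 / 4 by ring]
    refine (abs_add_le _ _).trans (le_of_eq ?_)
    rw [abs_of_nonneg (show 0 ≤ P ^ 2 / 4 by positivity)]
  have h2 : P ^ 2 ≤ T := by
    rw [← sq_abs]
    exact (pow_le_pow_left₀ (abs_nonneg _) hP 2).trans hδ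
  have h3 : Real.cosh (((P / 2 + k) ^ 2 - κ ^ 2 - ((P / 2 - k) ^ 2 - κ ^ 2)) / (2 * T)) ≤ 2.75 := by
    rw [show ((P / 2 + k) ^ 2 - κ ^ 2 - ((P / 2 - k) ^ 2 - κ ^ 2)) / (2 * T) = P * k / T by
      field_simp; ring]
    have h4 : |P * k / T| ≤ 1 := by
      rw [abs_div, abs_mul, abs_of_pos hT, div_le_one hT]
      calc |P| * |k| ≤ δ * (2 * κ) :=
            mul_le_mul hP hk (abs_nonneg _) ((abs_nonneg _).trans hP)
        _ ≤ T := by linarith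
    refine (Real.cosh_le_exp_half_sq _).trans ?_
    have h5 : (P * k / T) ^ 2 ≤ 1 := by
      rw [← sq_abs]; exact pow_le_one₀ (abs_nonneg _) h4
    have h6 : Real.exp ((P * k / T) ^ 2 / 2) ≤ Real.exp 1 := Real.exp_le_exp.mpr (by linarith)
    have := Real.exp_one_lt_d9
    linarith
  have h7 := abs_sq_sub_sq_le hκ k
  nlinarith

theorem symbolD_le_near (hκ : 0 < κ) (hT : 0 < T) {P k δ : ℝ} (hδ : δ ^ 2 ≤ T)
    (hδ2 : 2 * κ * δ ≤ T) (hP : |P| ≤ δ) (hk : |k| ≤ 2 * κ) :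
    symbolD (κ ^ 2) T (momenta P k) ≤ 2 * κ * |(|k| - κ)| + (|k| - κ) ^ 2 + 4 * T := by
  rw [symbolD_momenta]
  refine (energyD_le hT _ _).trans ?_
  have h2 : P ^ 2 ≤ T := by
    rw [← sq_abs]
    exact (pow_le_pow_left₀ (abs_nonneg _) hP 2).trans hδ
  have h3 : |P * k| ≤ T := by
    rw [abs_mul]
    calc |P| * |k| ≤ δ * (2 * κ) :=
          mul_le_mul hP hk (abs_nonneg _) ((abs_nonneg _).trans hP)
      _ ≤ T := by linarith
  have h7 := abs_sq_sub_sq_le hκ k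
  obtain ⟨h8, h9⟩ := abs_le.mp h7
  obtain ⟨h10, h11⟩ := abs_le.mp h3
  have ha : |(P / 2 + k) ^ 2 - κ ^ 2| ≤ 2 * κ * |(|k| - κ)| + (|k| - κ) ^ 2 + 2 * T := by
    rw [abs_le]; constructor <;> nlinarith [sq_nonneg P]
  have hb : |(P / 2 - k) ^ 2 - κ ^ 2| ≤ 2 * κ * |(|k| - κ)| + (|k| - κ) ^ 2 + 2 * T := by
    rw [abs_le]; constructor <;> nlinarith [sq_nonneg P]
  linarith

/-- At P = 2κ the momenta are κ ± k, and both energies are about 2κ|k| in absolute value. D_T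
averages the absolute values, so the opposite signs do not matter. -/
theorem symbolD_le_far (hκ : 0 < κ) (hT : 0 < T) {P k δ : ℝ} (hδ : δ ^ 2 ≤ T)
    (hδ2 : 2 * κ * δ ≤ T) (hP : |P - 2 * κ| ≤ δ) (hk : |k| ≤ 2 * κ) :
    symbolD (κ ^ 2) T (momenta P k) ≤ 2 * κ * |(|k| - 0)| + (|k| - 0) ^ 2 + 4 * T := by
  rw [symbolD_momenta, sub_zero, abs_abs, sq_abs]
  refine (energyD_le hT _ _).trans ?_
  obtain ⟨q, rfl⟩ : ∃ q, P = 2 * κ + q := ⟨P - 2 * κ, by ring⟩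
  rw [add_sub_cancel_left] at hP
  have h2 : q ^ 2 ≤ T := by
    rw [← sq_abs]
    exact (pow_le_pow_left₀ (abs_nonneg _) hP 2).trans hδ
  have h3 : |q * k| ≤ T := by
    rw [abs_mul]
    calc |q| * |k| ≤ δ * (2 * κ) :=
          mul_le_mul hP hk (abs_nonneg _) ((abs_nonneg _).trans hP)
      _ ≤ T := by linarith
  have h4 : |κ * q| ≤ T / 2 := by
    rw [abs_mul, abs_of_pos hκ]
    have : κ * |q| ≤ κ * δ := by gcongr
    linarith
  have h5 : |κ * k| ≤ κ * |k| := by rw [abs_mul, abs_of_pos hκ]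
  obtain ⟨h8, h9⟩ := abs_le.mp h4
  obtain ⟨h10, h11⟩ := abs_le.mp h3
  obtain ⟨h12, h13⟩ := abs_le.mp h5
  have ha : |((2 * κ + q) / 2 + k) ^ 2 - κ ^ 2| ≤ 2 * κ * |k| + k ^ 2 + 2 * T := by
    rw [abs_le]; constructor <;> nlinarith [sq_nonneg q, sq_nonneg k]
  have hb : |((2 * κ + q) / 2 - k) ^ 2 - κ ^ 2| ≤ 2 * κ * |k| + k ^ 2 + 2 * T := by
    rw [abs_le]; constructor <;> nlinarith [sq_nonneg q, sq_nonneg k]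
  linarith

/-- The lower bound for `L_T`. -/
theorem exists_infSpec_symbolL_neg (hκ : 0 < κ)
    (hV : Integrable (fun r : ℝ => (1 + |r| ^ 2) * V r)) (hev : ∀ r, V (-r) = V r) {E : ℝ}
    (hE : 0 < E) (hcos : cosMoment V κ / Real.pi = E) :
    ∃ A, ∀ l, 0 < l → ∀ T, 0 < T → T < κ ^ 2 * Real.exp (-κ / (l * E) - A) →
      infSpec (formOperator (symbolL (κ ^ 2) T) (fun r => l * V r)) symmetricSubspace < 0 := by
  have hpi := Real.pi_pos
  obtain ⟨A, hA⟩ := exists_lower_condition (c := κ) (g := 1 / (Real.pi * κ)) hκ hV (by positivity) hE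
    (by rw [← hcos]; field_simp) (fun T hT => le_integral_lowerW_near hκ hT)
  refine ⟨A, fun l hl T hT hTl => ?_⟩
  obtain ⟨δ, hδ, hδ1, hδ2⟩ := exists_width hκ hT
  refine (isSymbolL κ hT).infSpec_neg (c := κ) (η₀ := 0) (ε := δ / (2 * Real.pi)) hκ hT
    (integrable_of_moment hV) hev (by positivity) (fun η hη k hk => ?_) (hA l hl T hT hTl)
  refine symbolL_le_near hκ hT hδ1 hδ2 ?_ hk
  rw [sub_zero, le_div_iff₀ (by positivity)] at hη
  rw [abs_mul, abs_of_pos (show 0 < 2 * Real.pi by positivity)]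
  linarith

/-- The lower bound for `D_T`. -/
theorem exists_infSpec_symbolD_neg (hκ : 0 < κ)
    (hV : Integrable (fun r : ℝ => (1 + |r| ^ 2) * V r)) (hev : ∀ r, V (-r) = V r) {E : ℝ}
    (hE : 0 < E) (hcos : cosMoment V κ / Real.pi = E ∨ 1 / 2 * (cosMoment V 0 / Real.pi) = E) :
    ∃ A, ∀ l, 0 < l → ∀ T, 0 < T → T < κ ^ 2 * Real.exp (-κ / (l * E) - A) →
      infSpec (formOperator (symbolD (κ ^ 2) T) (fun r => l * V r)) symmetricSubspace < 0 := by
  have hpi := Real.pi_pos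
  rcases hcos with hcos | hcos
  · obtain ⟨A, hA⟩ := exists_lower_condition (c := κ) (g := 1 / (Real.pi * κ)) hκ hV
      (by positivity) hE (by rw [← hcos]; field_simp) (fun T hT => le_integral_lowerW_near hκ hT)
    refine ⟨A, fun l hl T hT hTl => ?_⟩
    obtain ⟨δ, hδ, hδ1, hδ2⟩ := exists_width hκ hT
    refine (isSymbolD κ hT).infSpec_neg (c := κ) (η₀ := 0) (ε := δ / (2 * Real.pi)) hκ hT
      (integrable_of_moment hV) hev (by positivity) (fun η hη k hk => ?_) (hA l hl T hT hTl)
    refine symbolD_le_near hκ hT hδ1 hδ2 ?_ hk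
    rw [sub_zero, le_div_iff₀ (by positivity)] at hη
    rw [abs_mul, abs_of_pos (show 0 < 2 * Real.pi by positivity)]
    linarith
  · obtain ⟨A, hA⟩ := exists_lower_condition (c := 0) (g := 1 / (2 * Real.pi * κ)) hκ hV
      (by positivity) hE (by rw [← hcos]; field_simp) (fun T hT => le_integral_lowerW_far hκ hT)
    refine ⟨A, fun l hl T hT hTl => ?_⟩
    obtain ⟨δ, hδ, hδ1, hδ2⟩ := exists_width hκ hT
    refine (isSymbolD κ hT).infSpec_neg (c := 0) (η₀ := 2 * κ / (2 * Real.pi))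
      (ε := δ / (2 * Real.pi)) hκ hT
      (integrable_of_moment hV) hev (by positivity) (fun η hη k hk => ?_) (hA l hl T hT hTl)
    refine symbolD_le_far hκ hT hδ1 hδ2 ?_ hk
    have e : 2 * Real.pi * η - 2 * κ = 2 * Real.pi * (η - 2 * κ / (2 * Real.pi)) := by field_simp
    rw [le_div_iff₀ (by positivity)] at hη
    rw [e, abs_mul, abs_of_pos (show 0 < 2 * Real.pi by positivity)]
    linarith

end Lower
/-! ### The two temperatures -/

section Temperatures

variable {κ : ℝ} {V : ℝ → ℝ}

/-- For every coupling this makes the set defining T_l nonempty and the set defining T_u bounded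
above; otherwise the infimum or supremum would only have its conventional value 0. -/
theorem exists_formLE_large (hV : Integrable V) {l : ℝ} (hl : 0 < l) :
    ∃ T₀, 0 < T₀ ∧ ∀ T, T₀ ≤ T → ∀ m, IsSymbol κ T m → FormLE m V (l * (1 + 1)) := by
  have hI : 0 ≤ ∫ r, |V r| := integral_nonneg fun r => abs_nonneg _
  set B := l * (1 + 1) * ∫ r, |V r| with hB
  have hB0 : 0 ≤ B := by positivity
  refine ⟨κ ^ 2 + B ^ 2 + 1, by positivity, fun T hT m hm => ?_⟩
  have hT0 : 0 < T := by nlinarith [sq_nonneg κ, sq_nonneg B]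
  refine formLE_of_large hm hT0 (by nlinarith [sq_nonneg B]) hV (by positivity) ?_
  rw [← mul_assoc, ← hB, mul_one_div, div_le_one (Real.sqrt_pos.mpr hT0)]
  exact Real.le_sqrt_of_sq_le (by nlinarith [sq_nonneg κ])

/-- For the upper bound it is enough that the single temperature on the right belongs to the set;
for the lower bound, that no smaller temperature than the threshold does. -/
theorem Tl_bounds (hκ : 0 < κ) (hV : Integrable (fun r : ℝ => (1 + |r| ^ 2) * V r))
    (hev : ∀ r, V (-r) = V r) {E : ℝ} (hE : 0 < E) (hcos : cosMoment V κ / Real.pi = E) :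
    ∃ A B l₀, 0 < l₀ ∧
      (∀ l, 0 < l → κ ^ 2 * Real.exp (-κ / (l * E) - A) ≤ Tl (κ ^ 2) (fun r => l * V r)) ∧
      ∀ l, 0 < l → l < l₀ →
        Tl (κ ^ 2) (fun r => l * V r) ≤ κ ^ 2 * Real.exp (-κ / (l * E) + B) := by
  have hVi := integrable_of_moment hV
  obtain ⟨A, hA⟩ := exists_infSpec_symbolL_neg hκ hV hev hE hcos
  obtain ⟨B, l₀, hl₀, hB⟩ := exists_formLE_symbolL hκ hV hE hcos.le
  refine ⟨A, B, l₀, hl₀, fun l hl => ?_, fun l hl hl1 => ?_⟩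
  · obtain ⟨T₀, hT₀, h⟩ := exists_formLE_large (κ := κ) hVi hl
    refine le_csInf ⟨T₀, hT₀, ?_⟩ fun T hT => ?_
    · have hm := isSymbolL κ hT₀
      refine le_trans ?_ (le_infSpec_of_formLE hm hVi hev one_pos (h T₀ le_rfl _ hm))
      exact_mod_cast (by positivity : (0 : ℝ) ≤ 1 / (1 + 1) * (2 * T₀))
    · by_contra! hlt
      exact absurd hT.2 (not_le.mpr (hA l hl T hT.1 hlt))
  · have hT : 0 < κ ^ 2 * Real.exp (-κ / (l * E) + B) := by positivity
    refine csInf_le ⟨0, fun T hT => hT.1.le⟩ ⟨hT, ?_⟩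
    refine le_trans ?_ (le_infSpec_of_formLE (isSymbolL κ hT) hVi hev hl (hB l hl hl1 _ le_rfl))
    exact_mod_cast (by positivity :
      (0 : ℝ) ≤ l / (1 + l) * (2 * (κ ^ 2 * Real.exp (-κ / (l * E) + B))))

theorem Tu_bounds (hκ : 0 < κ) (hV : Integrable (fun r : ℝ => (1 + |r| ^ 2) * V r))
    (hev : ∀ r, V (-r) = V r) {E : ℝ} (hE : 0 < E)
    (hcos : max (cosMoment V κ / Real.pi) (1 / 2 * (cosMoment V 0 / Real.pi)) = E) :
    ∃ A B l₀, 0 < l₀ ∧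
      (∀ l, 0 < l → κ ^ 2 * Real.exp (-κ / (l * E) - A) ≤ Tu (κ ^ 2) (fun r => l * V r)) ∧
      ∀ l, 0 < l → l < l₀ →
        Tu (κ ^ 2) (fun r => l * V r) ≤ κ ^ 2 * Real.exp (-κ / (l * E) + B) := by
  have hVi := integrable_of_moment hV
  obtain ⟨A, hA⟩ := exists_infSpec_symbolD_neg hκ hV hev hE
    ((max_choice _ _).imp (fun h => h.symm.trans hcos) fun h => h.symm.trans hcos)
  obtain ⟨B, l₀, hl₀, hB⟩ := exists_formLE_symbolD hκ hV hE ((le_max_left _ _).trans hcos.le)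
    ((le_max_right _ _).trans hcos.le)
  have hmem : ∀ l, 0 < l → ∀ T, 0 < T → T < κ ^ 2 * Real.exp (-κ / (l * E) - A) →
      T ∈ {T : ℝ | 0 < T ∧ infSpec (formOperator (symbolD (κ ^ 2) T) (fun r => l * V r))
        symmetricSubspace ≤ 0} := fun l hl T hT hlt => ⟨hT, (hA l hl T hT hlt).le⟩
  refine ⟨A, B, l₀, hl₀, fun l hl => ?_, fun l hl hl1 => ?_⟩
  · obtain ⟨T₀, hT₀, h⟩ := exists_formLE_large (κ := κ) hVi hl
    -- Every temperature strictly below the threshold is in the set, so each S below it is exceeded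
    -- by a member; boundedness of the set makes the supremum meaningful.
    refine le_of_forall_lt fun S hS => ?_
    obtain ⟨T, hST, hT⟩ := exists_between (max_lt hS
      (show 0 < κ ^ 2 * Real.exp (-κ / (l * E) - A) by positivity))
    rw [max_lt_iff] at hST
    refine hST.1.trans_le (le_csSup ⟨T₀, fun T' hT' => ?_⟩ (hmem l hl T hST.2 hT))
    by_contra! hlt
    have hm := isSymbolD κ hT'.1
    have h1 := (le_infSpec_of_formLE hm hVi hev one_pos (h T' hlt.le _ hm)).trans hT'.2
    have h2 : (1 : ℝ) / (1 + 1) * (2 * T') ≤ 0 := by exact_mod_cast h1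
    linarith [hT'.1]
  · have hT : 0 < κ ^ 2 * Real.exp (-κ / (l * E) - A) := by positivity
    refine csSup_le ⟨_, hmem l hl _ (half_pos hT) (half_lt_self hT)⟩ fun T hT' => ?_
    by_contra! hlt
    have h1 := (le_infSpec_of_formLE (isSymbolD κ hT'.1) hVi hev hl
      (hB l hl hl1 _ hlt.le)).trans hT'.2
    have h2 : l / (1 + l) * (2 * T) ≤ 0 := by exact_mod_cast h1
    have h3 : 0 < l / (1 + l) * (2 * T) := by have := hT'.1; positivity
    linarith

/-- Two-sided bounds as an asymptotic formula with a bounded error in the exponent. -/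
theorem exists_error_of_bounds (hκ : 0 < κ) {f : ℝ → ℝ} {E A B l₀ : ℝ} (hl₀ : 0 < l₀)
    (hA : ∀ l, 0 < l → κ ^ 2 * Real.exp (-κ / (l * E) - A) ≤ f l)
    (hB : ∀ l, 0 < l → l < l₀ → f l ≤ κ ^ 2 * Real.exp (-κ / (l * E) + B)) :
    ∃ R : ℝ → ℝ, R =O[𝓝[>] 0] (fun _ => (1 : ℝ)) ∧
      ∀ l, 0 < l → f l = κ ^ 2 * Real.exp (-κ / (l * E) + R l) := by
  have hpos : ∀ l, 0 < l → 0 < f l := fun l hl => lt_of_lt_of_le (by positivity) (hA l hl)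
  -- The identity is solved for the error. The lower bound holds for all l > 0, so the logarithm has
  -- a positive argument even outside the weak-coupling range.
  refine ⟨fun l => Real.log (f l / κ ^ 2) - -κ / (l * E), ?_, fun l hl => ?_⟩
  · refine IsBigO.of_bound (|A| + |B|) ?_
    filter_upwards [Ioo_mem_nhdsGT hl₀] with l hl
    have h1 := hA l hl.1
    have h2 := hB l hl.1 hl.2
    rw [mul_comm, ← le_div_iff₀ (by positivity), ← Real.le_log_iff_exp_le (by
      have := hpos l hl.1; positivity)] at h1
    rw [mul_comm, ← div_le_iff₀ (by positivity), ← Real.log_le_iff_le_exp (by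
      have := hpos l hl.1; positivity)] at h2
    rw [norm_one, mul_one, Real.norm_eq_abs, abs_le]
    constructor
    · linarith [le_abs_self A, abs_nonneg B]
    · linarith [le_abs_self B, abs_nonneg A]
  · have := hpos l hl
    rw [add_sub_cancel, Real.exp_log (by positivity)]
    field_simp

/-- The exponents differ by κ(1/E − 1/F)/l, which tends to infinity and outweighs the bounded
errors. -/
theorem tendsto_ratio (hκ : 0 < κ) {f g : ℝ → ℝ} {E F A B l₀ : ℝ} (hl₀ : 0 < l₀) (hE : 0 < E)
    (hEF : E < F) (hA : ∀ l, 0 < l → κ ^ 2 * Real.exp (-κ / (l * F) - A) ≤ f l)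
    (hg : ∀ l, 0 < l → 0 < g l)
    (hB : ∀ l, 0 < l → l < l₀ → g l ≤ κ ^ 2 * Real.exp (-κ / (l * E) + B)) :
    Tendsto (fun l => f l / g l) (𝓝[>] 0) atTop := by
  have h1 : Tendsto (fun l : ℝ => κ * (1 / E - 1 / F) * l⁻¹ + (-A - B)) (𝓝[>] 0) atTop := by
    refine tendsto_atTop_add_const_right _ _ (tendsto_inv_nhdsGT_zero.const_mul_atTop ?_)
    have := one_div_lt_one_div_of_lt hE hEF
    exact mul_pos hκ (by linarith)
  refine tendsto_atTop_mono' _ ?_ (Real.tendsto_exp_atTop.comp h1)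
  filter_upwards [Ioo_mem_nhdsGT hl₀] with l hl
  have hl0 := hl.1
  have hF : 0 < F := hE.trans hEF
  rw [Function.comp, le_div_iff₀ (hg l hl0)]
  refine le_trans ?_ (hA l hl0)
  refine (mul_le_mul_of_nonneg_left (hB l hl0 hl.2) (Real.exp_pos _).le).trans (le_of_eq ?_)
  rw [mul_left_comm, ← Real.exp_add]
  congr 2
  field_simp
  ring

end Temperatures

end BCS
end

theorem theorem1p1 (μ : ℝ) (hμ : 0 < μ) (V : ℝ → ℝ)
    (hV_even : ∀ r : ℝ, V (-r) = V r)
    (hV_int : Integrable (fun r : ℝ => (1 + |r| ^ 2) * V r))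
    (he : 0 < BCS.eS μ V) :
    (∀ l : ℝ, 0 < l →
      0 < BCS.Tl μ (fun r => l * V r) ∧ 0 < BCS.Tu μ (fun r => l * V r)) ∧
    (∃ R : ℝ → ℝ, R =O[𝓝[>] 0] (fun _ => (1 : ℝ)) ∧
      ∀ l : ℝ, 0 < l → BCS.Tl μ (fun r => l * V r) =
        μ * Real.exp (-Real.sqrt μ / (l * BCS.eS μ V) + R l)) ∧
    (∃ R : ℝ → ℝ, R =O[𝓝[>] 0] (fun _ => (1 : ℝ)) ∧
      ∀ l : ℝ, 0 < l → BCS.Tu μ (fun r => l * V r) =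
        μ * Real.exp (-Real.sqrt μ / (l * max (BCS.eS μ V) (1 / 2 * BCS.eS0 V)) + R l)) ∧
    (0 < (BCS.VHat V 0).re → (BCS.VHat V (2 * Real.sqrt μ)).re < 0 →
      Tendsto (fun l : ℝ => BCS.Tu μ (fun r => l * V r) / BCS.Tl μ (fun r => l * V r))
        (𝓝[>] 0) atTop) := by
  have hVi := BCS.integrable_of_moment hV_int
  have hκ : 0 < Real.sqrt μ := Real.sqrt_pos.mpr hμ
  have hκμ : Real.sqrt μ ^ 2 = μ := Real.sq_sqrt hμ.le
  have heS := BCS.eS_eq hVi hV_even μ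
  have heS0 := BCS.eS0_eq hVi hV_even
  have hmax : 0 < max (BCS.eS μ V) (1 / 2 * BCS.eS0 V) := lt_max_of_lt_left he
  obtain ⟨A₁, B₁, l₁, hl₁, hA₁, hB₁⟩ := BCS.Tl_bounds hκ hV_int hV_even he heS.symm
  obtain ⟨A₂, B₂, l₂, hl₂, hA₂, hB₂⟩ := BCS.Tu_bounds hκ hV_int hV_even hmax
    (by rw [heS, heS0])
  rw [hκμ] at hA₁ hB₁ hA₂ hB₂
  refine ⟨fun l hl => ⟨lt_of_lt_of_le (by positivity) (hA₁ l hl),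
    lt_of_lt_of_le (by positivity) (hA₂ l hl)⟩, ?_, ?_, fun h0 h2 => ?_⟩
  · have h := BCS.exists_error_of_bounds hκ hl₁ (by rw [hκμ]; exact hA₁) (by rw [hκμ]; exact hB₁)
    rwa [hκμ] at h
  · have h := BCS.exists_error_of_bounds hκ hl₂ (by rw [hκμ]; exact hA₂) (by rw [hκμ]; exact hB₂)
    rwa [hκμ] at h
  · refine BCS.tendsto_ratio hκ (E := BCS.eS μ V) hl₁ he (lt_max_of_lt_right ?_)
      (by rw [hκμ]; exact hA₂) (fun l hl => lt_of_lt_of_le (by positivity) (hA₁ l hl))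
      (by rw [hκμ]; exact hB₁)
    -- e_0^s/2 − e_μ^s = −(2π)^(-1/2) V̂(2√μ), so a negative V̂(2√μ) makes e_0^s/2 the strict
    -- maximum.
    have h := congrArg Complex.re (BCS.VHat_zero_add hVi hV_even (Real.sqrt μ))
    rw [Complex.re_ofReal_mul, Complex.add_re, Complex.ofReal_re, ← heS] at h
    have hs : 0 < 1 / Real.sqrt (2 * Real.pi) := by
      have := Real.pi_pos
      positivity
    have e : 1 / 2 * BCS.eS0 V = 1 / Real.sqrt (2 * Real.pi) * (BCS.VHat V 0).re := by
      rw [BCS.eS0]; ring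
    rw [e, ← h]
    exact mul_lt_mul_of_pos_left (by linarith) hs
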